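/- Notation. Let $q=e^{\hbar}\in\mathbb C[[\hbar]]$ and $\mathfrak g=\mathfrak{gl}(n)$, with weights $\varepsilon_1,\dots,\varepsilon_n$ (an orthonormal basis of $\mathfrak h^*$), simple roots $\alpha_i=\varepsilon_i-\varepsilon_{i+1}$, positive roots $R^+$, and half-sum of positive roots $\rho$. Let $U_q(\mathfrak g)$ be the quantum group over $\mathbb C((\hbar))$ generated by $q^{\pm h_{\varepsilon_i}}$, $e_\alpha$, $f_\alpha$ ($\alpha$ simple), with the usual relations: $q^{h_{\varepsilon_i}}q^{-h_{\varepsilon_i}}=1$, the $q^{h_{\varepsilon_i}}$ commute, $q^{h_{\varepsilon_i}}e_\alpha=q^{(\varepsilon_i,\alpha)}e_\alpha q^{h_{\varepsilon_i}}$, $q^{h_{\varepsilon_i}}f_\alpha=q^{-(\varepsilon_i,\alpha)}f_\alpha q^{h_{\varepsilon_i}}$, $[e_\alpha,f_\beta]=\delta_{\alpha\beta}\frac{q^{h_\alpha}-q^{-h_\alpha}}{q-q^{-1}}$, and the quantum Serre relations. Let $U\subset U_q(\mathfrak g)$ be the $\mathbb C[[\hbar]]$-subalgebra generated by all $q^{\pm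 h_{\varepsilon_i}}$, $f_\alpha$ and $(q-q^{-1})e_\alpha$. For $\mu\in\frac1\hbar\mathfrak h^*\oplus\mathfrak h^*$ let $\hat M_\mu^{K}$ be the Verma module over $U_q(\mathfrak g)$ with highest weight vector $v_\mu$, so that $e_\alpha v_\mu=0$ and $q^{h_{\varepsilon_i}}v_\mu=q^{(\mu,\varepsilon_i)}v_\mu$, and let $\hat M_\mu=Uv_\mu\subset\hat M^K_\mu$ be the Verma module over $\mathbb C[[\hbar]]$. A vector of $\hat M^K_\mu$ is singular if it is non-zero and is annihilated by all $e_\alpha$. For $\gamma=\varepsilon_i-\varepsilon_j\in R^+$ define $\check f_\gamma\in U_q(\mathfrak g)$ by $\check f_{\gamma}=f_\gamma$ if $j=i+1$, and otherwise, with $\beta=\gamma-\alpha_i$, by $$\check f_\gamma=f_{\alpha_i}\check f_\beta\,\frac{q^{h_\beta+(\rho,\beta)}-q^{-h_\beta-(\rho,\beta)}}{q-q^{-1}}-\check f_\beta f_{\alpha_i}\,\frac{q^{h_\beta+(\rho,\beta)-1}-q^{-h_\beta-(\rho,\beta)+1}}{q-q^{-1}} .$$ Then $(q-q^{-1})^{j-i-1}\check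 f_\gamma\in U$. Let $\mathfrak l=\mathfrak{gl}(n_1)\oplus\dots\oplus\mathfrak{gl}(n_k)\subset\mathfrak g$ be block diagonal, $n_1+\dots+n_k=n$, with simple roots $\Pi^+_{\mathfrak l}\subset\Pi^+$ and positive roots $R^+_{\mathfrak l}$, and put $m_i=n_1+\dots+n_{i-1}+1$. Let $\mathfrak c^*_{\mathfrak l}\subset\mathfrak h^*$ be the orthogonal complement of $\Pi^+_{\mathfrak l}$, and let $\mathfrak c^*_{\mathfrak l,reg}$ be the set of $a\in\mathfrak c^*_{\mathfrak l}$ such that, for $\lambda=\frac1\hbar a$, the complex numbers $q^{2(\lambda,\varepsilon_{m_i})}=e^{2(a,\varepsilon_{m_i})}$, $i=1,\dots,k$, are pairwise distinct. A permutation $\sigma\in S_n$ is admissible if $\sigma(R^+_{\mathfrak l})\subset R^+$, that is, if $\sigma$ is increasing on each block of indices. Put $\sigma\cdot\lambda=\sigma(\lambda+\rho)-\rho$. Proposition (freeness of $M_{\sigma\cdot\lambda}$). Let $\lambda\in\frac1\hbar\mathfrak c^*_{\mathfrak l,reg}$ and let $\sigma\in S_n$ be admissible. For every $\alpha\in\Pi^+_{\mathfrak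 l}$ the vector $\check f_{\sigma(\alpha)}v_{\sigma\cdot\lambda}$ is singular. Let $M_{\sigma\cdot\lambda}$ be the quotient of the Verma module $\hat M_{\sigma\cdot\lambda}$ over $\mathbb C[[\hbar]]$ by the sum of the $U$-submodules generated by the vectors $(q-q^{-1})^{j-i-1}\check f_{\sigma(\alpha)}v_{\sigma\cdot\lambda}$, where $\alpha\in\Pi^+_{\mathfrak l}$ and $\sigma(\alpha)=\varepsilon_i-\varepsilon_j$. Then $M_{\sigma\cdot\lambda}$ is a free $\mathbb C[[\hbar]]$-module. -/

import Mathlib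

noncomputable section

namespace QuantumGL

/-! ### Scalars: power series and Laurent series in `ħ`, and the powers of `q = exp ħ` -/

/-- The ring `ℂ⟦ħ⟧` of formal power series. -/
abbrev Rh : Type := PowerSeries ℂ

/-- The field `ℂ((ħ))` of formal Laurent series. -/
def Kh : Type := LaurentSeries ℂ

instance : Field Kh := inferInstanceAs (Field (LaurentSeries ℂ))

instance : Algebra Rh Kh := inferInstanceAs (Algebra (PowerSeries ℂ) (LaurentSeries ℂ))

instance : IsFractionRing Rh Kh :=
  inferInstanceAs (IsFractionRing (PowerSeries ℂ) (LaurentSeries ℂ))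

/-- `q ^ c = exp (c ħ)` in `ℂ⟦ħ⟧`, for a complex number `c`. -/
def qpow (c : ℂ) : Rh := PowerSeries.rescale c (PowerSeries.exp ℂ)

/-- `q ^ c` in `ℂ((ħ))`. -/
def qK (c : ℂ) : Kh := algebraMap Rh Kh (qpow c)

/-- `q - q⁻¹` in `ℂ⟦ħ⟧`. -/
def qDelta : Rh := qpow 1 - qpow (-1)

/-- `q - q⁻¹` in `ℂ((ħ))`. -/
def qDeltaK : Kh := qK 1 - qK (-1)

theorem algebraMap_qDelta : algebraMap Rh Kh qDelta = qDeltaK := by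
  simp [qDelta, qDeltaK, qK]

theorem qDelta_ne_zero : qDelta ≠ 0 := by
  intro h
  have h1 := congrArg (PowerSeries.coeff 1) h
  simp [qDelta, qpow, PowerSeries.coeff_rescale, PowerSeries.coeff_exp] at h1

theorem qDeltaK_ne_zero : qDeltaK ≠ 0 := by
  rw [← algebraMap_qDelta]
  intro h
  exact qDelta_ne_zero
    ((injective_iff_map_eq_zero (algebraMap Rh Kh)).1
      (IsFractionRing.injective Rh Kh) _ h)

/-! ### The quantum group `U_q(gl(n))` over `ℂ((ħ))`

Indices are counted from `0`: the weights `ε_i` are indexed by `i : Fin n` and the simple roots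
`α_a = ε_a - ε_{a+1}` by `a : Fin (n - 1)`. -/

/-- The index `a` of the positive part of `α_a = ε_a - ε_{a+1}`. -/
def lo {n : ℕ} (a : Fin (n - 1)) : Fin n := ⟨a, by omega⟩

/-- The index `a + 1` of the negative part of `α_a = ε_a - ε_{a+1}`. -/
def hi {n : ℕ} (a : Fin (n - 1)) : Fin n := ⟨a + 1, by omega⟩

/-- The inner product `(ε_i, α_a)`. -/
def pair {n : ℕ} (i : Fin n) (a : Fin (n - 1)) : ℂ :=
  (if i = lo a then 1 else 0) - (if i = hi a then 1 else 0)

/-- The generators `q^{h_{ε_i}}`, `q^{-h_{ε_i}}`, `e_{α_a}`, `f_{α_a}`. -/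
inductive Gen (n : ℕ) : Type
  | k (i : Fin n)
  | kinv (i : Fin n)
  | e (a : Fin (n - 1))
  | f (a : Fin (n - 1))

/-- The free algebra on the generators. -/
abbrev FreeU (n : ℕ) : Type := FreeAlgebra Kh (Gen n)

/-- A generator as an element of the free algebra. -/
abbrev gen {n : ℕ} (x : Gen n) : FreeU n := FreeAlgebra.ι Kh x

/-- The defining relations of `U_q(gl(n))`. -/
inductive UqRel (n : ℕ) : FreeU n → FreeU n → Prop
  | k_kinv (i : Fin n) : UqRel n (gen (.k i) * gen (.kinv i)) 1
  | kinv_k (i : Fin n) : UqRel n (gen (.kinv i) * gen (.k i)) 1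
  | k_comm (i j : Fin n) : UqRel n (gen (.k i) * gen (.k j)) (gen (.k j) * gen (.k i))
  | k_e (i : Fin n) (a : Fin (n - 1)) :
      UqRel n (gen (.k i) * gen (.e a)) (qK (pair i a) • (gen (.e a) * gen (.k i)))
  | k_f (i : Fin n) (a : Fin (n - 1)) :
      UqRel n (gen (.k i) * gen (.f a)) (qK (-pair i a) • (gen (.f a) * gen (.k i)))
  | e_f_self (a : Fin (n - 1)) :
      UqRel n (gen (.e a) * gen (.f a) - gen (.f a) * gen (.e a))
        (qDeltaK⁻¹ • (gen (.k (lo a)) * gen (.kinv (hi a))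
          - gen (.kinv (lo a)) * gen (.k (hi a))))
  | e_f_ne (a b : Fin (n - 1)) (h : a ≠ b) :
      UqRel n (gen (.e a) * gen (.f b)) (gen (.f b) * gen (.e a))
  | e_serre (a b : Fin (n - 1)) (h : (a : ℕ) + 1 = b ∨ (b : ℕ) + 1 = a) :
      UqRel n (gen (.e a) * gen (.e a) * gen (.e b)
        - (qK 1 + qK (-1)) • (gen (.e a) * gen (.e b) * gen (.e a))
        + gen (.e b) * gen (.e a) * gen (.e a)) 0
  | f_serre (a b : Fin (n - 1)) (h : (a : ℕ) + 1 = b ∨ (b : ℕ) + 1 = a) :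
      UqRel n (gen (.f a) * gen (.f a) * gen (.f b)
        - (qK 1 + qK (-1)) • (gen (.f a) * gen (.f b) * gen (.f a))
        + gen (.f b) * gen (.f a) * gen (.f a)) 0
  | e_comm (a b : Fin (n - 1)) (h : (a : ℕ) + 1 < b) :
      UqRel n (gen (.e a) * gen (.e b)) (gen (.e b) * gen (.e a))
  | f_comm (a b : Fin (n - 1)) (h : (a : ℕ) + 1 < b) :
      UqRel n (gen (.f a) * gen (.f b)) (gen (.f b) * gen (.f a))

/-- The quantum group `U_q(gl(n))` over `ℂ((ħ))`, `q = exp ħ`. -/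
def Uq (n : ℕ) : Type := RingQuot (UqRel n)

instance (n : ℕ) : Ring (Uq n) := inferInstanceAs (Ring (RingQuot (UqRel n)))

instance (n : ℕ) : Algebra Kh (Uq n) := inferInstanceAs (Algebra Kh (RingQuot (UqRel n)))

instance (n : ℕ) : Algebra Rh (Uq n) :=
  Algebra.compHom (Uq n) (algebraMap Rh Kh)

instance (n : ℕ) : Module Rh (Uq n) := Algebra.toModule

instance (n : ℕ) : MulAction Rh (Uq n) := Module.toDistribMulAction.toMulAction

instance (n : ℕ) : IsScalarTower Rh Kh (Uq n) := IsScalarTower.of_algebraMap_eq' rfl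

/-- The image of a generator in `U_q(gl(n))`. -/
def uGen {n : ℕ} (x : Gen n) : Uq n := RingQuot.mkAlgHom Kh (UqRel n) (gen x)

/-- `q^{h_{ε_i}}` -/
def uk {n : ℕ} (i : Fin n) : Uq n := uGen (.k i)

/-- `q^{-h_{ε_i}}` -/
def ukinv {n : ℕ} (i : Fin n) : Uq n := uGen (.kinv i)

/-- `e_{α_a}` -/
def ue {n : ℕ} (a : Fin (n - 1)) : Uq n := uGen (.e a)

/-- `f_{α_a}` -/
def uf {n : ℕ} (a : Fin (n - 1)) : Uq n := uGen (.f a)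

/-! ### Dynamical root vectors -/

/-- The half-sum `ρ` of the positive roots in the basis `ε`. -/
def rho {n : ℕ} (i : Fin n) : ℂ := ((n : ℂ) - 1) / 2 - (i : ℕ)

/-- `(q^{h_β + s} - q^{-h_β - s}) / (q - q⁻¹)` for `β = ε_i - ε_j`. -/
def bracketH {n : ℕ} (i j : Fin n) (s : ℂ) : Uq n :=
  qDeltaK⁻¹ • (qK s • (uk i * ukinv j) - qK (-s) • (ukinv i * uk j))

/-- The dynamical root vector of the positive root `ε_i - ε_{i + d + 1}`, by recursion on `d`;
in the recursion step `β = ε_{i+1} - ε_{i+d+2}`. -/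
def fCheckAux {n : ℕ} : (d i : ℕ) → i + d + 1 < n → Uq n
  | 0, i, h => uf ⟨i, by omega⟩
  | d + 1, i, h =>
      let p : Fin n := ⟨i + 1, by omega⟩
      let r : Fin n := ⟨i + d + 2, by omega⟩
      let fi : Uq n := uf ⟨i, by omega⟩
      let fβ : Uq n := fCheckAux d (i + 1) (by omega)
      fi * fβ * bracketH p r (rho p - rho r) - fβ * fi * bracketH p r (rho p - rho r - 1)

/-- The dynamical root vector `f̌_{ε_i - ε_j}`, equal to `1` if `i = j` and to `0` if `i > j`. -/
def fCheck {n : ℕ} (i j : Fin n) : Uq n :=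
  if h : i < j then fCheckAux (j - i - 1) i (by have := Fin.lt_def.1 h; omega)
  else if i = j then 1 else 0

/-! ### The `ℂ⟦ħ⟧`-form of `U_q(gl(n))` -/

/-- The `ℂ⟦ħ⟧`-subalgebra of `U_q(gl(n))` generated by all `q^{±h_{ε_i}}`, `f_α` and
`(q - q⁻¹) e_α`. -/
def uqForm (n : ℕ) : Subalgebra Rh (Uq n) :=
  Algebra.adjoin Rh
    (Set.range uk ∪ Set.range ukinv ∪ Set.range uf ∪ Set.range fun a => qDelta • ue a)

/-- The `ℂ⟦ħ⟧`-form of `U_q(gl(n))` as a type. -/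
def UqForm (n : ℕ) : Type := uqForm n

instance (n : ℕ) : Ring (UqForm n) := inferInstanceAs (Ring (uqForm n))

instance (n : ℕ) : Algebra Rh (UqForm n) := inferInstanceAs (Algebra Rh (uqForm n))

/-- The inclusion of the `ℂ⟦ħ⟧`-form into `U_q(gl(n))`. -/
def UqForm.incl (n : ℕ) : UqForm n →ₐ[Rh] Uq n := (uqForm n).val

theorem uk_mem {n : ℕ} (i : Fin n) : uk i ∈ uqForm n :=
  Algebra.subset_adjoin (Or.inl (Or.inl (Or.inl ⟨i, rfl⟩)))

theorem ukinv_mem {n : ℕ} (i : Fin n) : ukinv i ∈ uqForm n :=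
  Algebra.subset_adjoin (Or.inl (Or.inl (Or.inr ⟨i, rfl⟩)))

theorem uf_mem {n : ℕ} (a : Fin (n - 1)) : uf a ∈ uqForm n :=
  Algebra.subset_adjoin (Or.inl (Or.inr ⟨a, rfl⟩))

theorem qDelta_smul_bracketH {n : ℕ} (i j : Fin n) (s : ℂ) :
    qDelta • bracketH i j s
      = qpow s • (uk i * ukinv j) - qpow (-s) • (ukinv i * uk j) := by
  rw [bracketH, ← algebraMap_smul Kh qDelta, algebraMap_qDelta, smul_smul,
    mul_inv_cancel₀ qDeltaK_ne_zero, one_smul, qK, qK, algebraMap_smul, algebraMap_smul]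

theorem bracketH_mem {n : ℕ} (i j : Fin n) (s : ℂ) : qDelta • bracketH i j s ∈ uqForm n := by
  rw [qDelta_smul_bracketH]
  exact sub_mem (Subalgebra.smul_mem _ (mul_mem (uk_mem _) (ukinv_mem _)) _)
    (Subalgebra.smul_mem _ (mul_mem (ukinv_mem _) (uk_mem _)) _)

theorem fCheckAux_mem {n : ℕ} : ∀ (d i : ℕ) (h : i + d + 1 < n),
    qDelta ^ d • fCheckAux (n := n) d i h ∈ uqForm n
  | 0, i, h => by simpa [fCheckAux] using uf_mem _
  | d + 1, i, h => by
      have ih := fCheckAux_mem d (i + 1) (by omega : i + 1 + d + 1 < n)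
      simp only [fCheckAux]
      rw [smul_sub]
      refine sub_mem ?_ ?_
      · have := mul_mem (mul_mem (uf_mem (n := n) ⟨i, by omega⟩) ih)
          (bracketH_mem (n := n) ⟨i + 1, by omega⟩ ⟨i + d + 2, by omega⟩
            (rho (n := n) ⟨i + 1, by omega⟩ - rho (n := n) ⟨i + d + 2, by omega⟩))
        simpa only [pow_succ, smul_mul_assoc, mul_smul_comm, smul_smul, mul_comm qDelta] using this
      · have := mul_mem (mul_mem ih (uf_mem (n := n) ⟨i, by omega⟩))
          (bracketH_mem (n := n) ⟨i + 1, by omega⟩ ⟨i + d + 2, by omega⟩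
            (rho (n := n) ⟨i + 1, by omega⟩ - rho (n := n) ⟨i + d + 2, by omega⟩ - 1))
        simpa only [pow_succ, smul_mul_assoc, mul_smul_comm, smul_smul, mul_comm qDelta] using this

/-- The rescaled dynamical root vector `(q - q⁻¹)^{j-i-1} f̌_{ε_i - ε_j}`, an element of the
`ℂ⟦ħ⟧`-form. -/
def fCheckForm {n : ℕ} (i j : Fin n) : UqForm n :=
  ⟨qDelta ^ ((j : ℕ) - i - 1) • fCheck i j, by
    unfold fCheck
    split_ifs
    · exact fCheckAux_mem _ _ _
    · exact Subalgebra.smul_mem _ (one_mem _) _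
    · rw [smul_zero]; exact zero_mem _⟩

/-! ### Weights and Verma modules -/

/-- A weight `ħ⁻¹ a + b` in `ħ⁻¹ 𝔥* ⊕ 𝔥*`, in the basis `ε`. -/
@[ext]
structure Weight (n : ℕ) where
  /-- the coefficient `a` of `ħ⁻¹` -/
  polar : Fin n → ℂ
  /-- the constant part `b` -/
  const : Fin n → ℂ

/-- The weight `ħ⁻¹ a`. -/
def Weight.ofPolar {n : ℕ} (a : Fin n → ℂ) : Weight n := ⟨a, 0⟩

/-- The shifted action `σ · μ = σ (μ + ρ) - ρ`, where `σ ε_i = ε_{σ i}`. -/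
def Weight.dot {n : ℕ} (σ : Equiv.Perm (Fin n)) (μ : Weight n) : Weight n :=
  ⟨fun i => μ.polar (σ⁻¹ i), fun i => μ.const (σ⁻¹ i) + rho (σ⁻¹ i) - rho i⟩

/-- `q^{(μ, ε_i)} = exp (a_i) exp (b_i ħ)` for `μ = ħ⁻¹ a + b`. -/
def Weight.q {n : ℕ} (μ : Weight n) (i : Fin n) : Rh :=
  PowerSeries.C (Complex.exp (μ.polar i)) * qpow (μ.const i)

/-- The left ideal of `U_q(gl(n))` generated by all `e_α` and `q^{h_{ε_i}} - q^{(μ, ε_i)}`. -/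
def vermaIdeal {n : ℕ} (μ : Weight n) : Submodule (Uq n) (Uq n) :=
  Submodule.span (Uq n)
    (Set.range ue ∪ Set.range fun i => uk i - algebraMap Rh (Uq n) (μ.q i))

/-- The Verma module of highest weight `μ` over `ℂ((ħ))`. -/
def Verma {n : ℕ} (μ : Weight n) : Type := Uq n ⧸ vermaIdeal μ

instance {n : ℕ} (μ : Weight n) : AddCommGroup (Verma μ) :=
  inferInstanceAs (AddCommGroup (Uq n ⧸ vermaIdeal μ))

instance {n : ℕ} (μ : Weight n) : Module (Uq n) (Verma μ) :=
  inferInstanceAs (Module (Uq n) (Uq n ⧸ vermaIdeal μ))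

instance {n : ℕ} (μ : Weight n) : Module Rh (Verma μ) :=
  Module.compHom (Verma μ) (algebraMap Rh (Uq n))

instance {n : ℕ} (μ : Weight n) : IsScalarTower Rh (Uq n) (Verma μ) :=
  IsScalarTower.of_algebraMap_smul fun _ _ => rfl

/-- The highest weight vector `v_μ`. -/
def vermaVec {n : ℕ} (μ : Weight n) : Verma μ := (vermaIdeal μ).mkQ 1

/-- Singular vectors: non-zero vectors annihilated by all `e_α`. -/
def IsSingular {n : ℕ} {μ : Weight n} (x : Verma μ) : Prop :=
  x ≠ 0 ∧ ∀ a : Fin (n - 1), ue a • x = 0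

/-- The `ℂ⟦ħ⟧`-form of `U_q(gl(n))` acts on the Verma module as a subalgebra of `U_q(gl(n))`. -/
instance {n : ℕ} (μ : Weight n) : Module (UqForm n) (Verma μ) :=
  Module.compHom (Verma μ) (UqForm.incl n).toRingHom

/-- The submodule of the Verma module generated by `v_μ` over the `ℂ⟦ħ⟧`-form of
`U_q(gl(n))`. -/
def vermaForm {n : ℕ} (μ : Weight n) : Submodule (UqForm n) (Verma μ) :=
  Submodule.span (UqForm n) {vermaVec μ}

/-- The Verma module over `ℂ⟦ħ⟧`. -/
def VermaForm {n : ℕ} (μ : Weight n) : Type := vermaForm μ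

instance {n : ℕ} (μ : Weight n) : AddCommGroup (VermaForm μ) :=
  inferInstanceAs (AddCommGroup (vermaForm μ))

instance {n : ℕ} (μ : Weight n) : Module (UqForm n) (VermaForm μ) :=
  inferInstanceAs (Module (UqForm n) (vermaForm μ))

/-- The highest weight vector as an element of the Verma module over `ℂ⟦ħ⟧`. -/
def vermaFormVec {n : ℕ} (μ : Weight n) : VermaForm μ :=
  ⟨vermaVec μ, Submodule.mem_span_singleton_self _⟩

/-! ### The Levi subalgebra and the module `M_{σ·λ}`

A composition `c = (n_1, …, n_k)` of `n` gives `𝔩 = gl(n_1) ⊕ … ⊕ gl(n_k)`; the block of an index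
`i` is `c.index i`. -/

/-- The simple roots of `𝔩`: those `α_a = ε_a - ε_{a+1}` with `a` and `a + 1` in one block. -/
def leviSimple {n : ℕ} (c : Composition n) : Set (Fin (n - 1)) :=
  {a | c.index (lo a) = c.index (hi a)}

/-- The first index `m_s` of the block number `s`. -/
def firstIndex {n : ℕ} (c : Composition n) (s : Fin c.length) : Fin n :=
  c.embedding s ⟨0, c.one_le_blocks' s.2⟩

/-- The set `𝔠*_{𝔩,reg}`: vectors `a` orthogonal to the simple roots of `𝔩` for which the numbers
`q^{2(λ, ε_{m_s})} = exp (2 a_{m_s})`, with `λ = ħ⁻¹ a`, are pairwise distinct. -/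
def cReg {n : ℕ} (c : Composition n) : Set (Fin n → ℂ) :=
  {a | (∀ α ∈ leviSimple c, a (lo α) = a (hi α)) ∧
    Function.Injective fun s : Fin c.length => Complex.exp (2 * a (firstIndex c s))}

/-- Admissible permutations: increasing on each block. -/
def Admissible {n : ℕ} (c : Composition n) (σ : Equiv.Perm (Fin n)) : Prop :=
  ∀ i j : Fin n, c.index i = c.index j → i < j → σ i < σ j

/-- The submodule of the Verma module of highest weight `μ` over `ℂ⟦ħ⟧` generated by the rescaled
vectors `f̌_{σ(α)} v_μ`, for `α` a simple root of `𝔩`. -/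
def singularSubmodule {n : ℕ} (c : Composition n) (σ : Equiv.Perm (Fin n)) (μ : Weight n) :
    Submodule (UqForm n) (VermaForm μ) :=
  Submodule.span (UqForm n)
    ((fun α => fCheckForm (σ (lo α)) (σ (hi α)) • vermaFormVec μ) '' leviSimple c)

/-- The module `M_{σ·λ}` over the `ℂ⟦ħ⟧`-form of `U_q(gl(n))`. -/
def MForm {n : ℕ} (c : Composition n) (σ : Equiv.Perm (Fin n)) (lam : Weight n) : Type :=
  VermaForm (lam.dot σ) ⧸ singularSubmodule c σ (lam.dot σ)

instance {n : ℕ} (c : Composition n) (σ : Equiv.Perm (Fin n)) (lam : Weight n) :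
    AddCommGroup (MForm c σ lam) :=
  inferInstanceAs (AddCommGroup (VermaForm (lam.dot σ) ⧸ singularSubmodule c σ (lam.dot σ)))

instance {n : ℕ} (c : Composition n) (σ : Equiv.Perm (Fin n)) (lam : Weight n) :
    Module (UqForm n) (MForm c σ lam) :=
  inferInstanceAs (Module (UqForm n)
    (VermaForm (lam.dot σ) ⧸ singularSubmodule c σ (lam.dot σ)))

/-- `ℂ⟦ħ⟧` acts on `M_{σ·λ}` through the `ℂ⟦ħ⟧`-form of `U_q(gl(n))`. -/
instance {n : ℕ} (c : Composition n) (σ : Equiv.Perm (Fin n)) (lam : Weight n) :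
    Module Rh (MForm c σ lam) :=
  Module.compHom (MForm c σ lam) (algebraMap Rh (UqForm n))

end QuantumGL

end

/-!
Write `μ = σ · λ`, let `v` be the highest weight vector, and let `w_α` be the rescaled vectors
`(q - q⁻¹)^(j-i-1) f̌_{σ(α)} v`, for `α` a simple root of `𝔩`.

*Singularity.* For `γ = ε_i - ε_j` the generator `e_a` kills `f̌_γ v` if `a ≠ i`, and `e_i` maps it
to a multiple of `f̌_{γ - α_i} v`, the factor being the `q`-number `[(μ + ρ, γ) - 1]`
(`uE_fCheckAux`). For `γ = σ(α)` this factor is zero. That the vector is not zero is seen in a map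
from the Verma module to a vector representation of the negative part (`exists_vermaVec_map`); there
the vector becomes a multiple of a basis vector, the factor being a product of `q`-numbers which do
not vanish because the indices strictly between `i` and `j` come under `σ⁻¹` from other blocks,
where `exp (2 a)` takes other values. The map is built on the module of words in the `f_α`, without
a basis of the Verma module: the words carry all relations but the Serre and commutation relations
of the `f_α`, and one divides by the largest submodule on which the map vanishes (`wordKer`).

*Freeness.* Let `V` be the `ℂ⟦ħ⟧`-span of the words in the `f_α` applied to `v`, and `N` the sum of
the spans of the words applied to the `w_α`. These are the Verma module over `ℂ⟦ħ⟧` and its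
submodule (`mem_vermaForm_iff`, `mem_singularSubmodule_iff`), since both are stable under the
`ℂ⟦ħ⟧`-form (`IsHighest.uqForm_le_formStab`). Both are graded by the length of words, with
components of finite type, so by Nakayama's lemma it is enough that the saturation of `N` lies in
`N + ħ V` (`free_quotient_of_graded`).

Modulo `ħ` the module `V` becomes semiclassical: the `f_k` satisfy the ordinary Serre relations, the
`q^{h_{ε_i}}` are scalars `z_i`, and the operators `z_i z_j (q - q⁻¹) e_{ε_i - ε_j}`, completed by
`z_i²` on the diagonal, form an upper triangular matrix `G` on which the `f_k` act by infinitesimal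
conjugation (`IsHighest.isConjAction`). Here `z_i` is the exponential of the coefficient of `ħ⁻¹` in
`(μ, ε_i)`. The image of `w_α` is a unit multiple of `X_{σ(α)} v`, with `X_γ` the classical root
vector (`IsHighest.redFForm_eq`), so that the image `J` of `N` contains `X_γ v` for all roots `γ`
whose indices have equal `z²`. The image `Z` of the saturation of `N` is stable under `G`, because
the `w_α` are singular, and contains no multiple of `v`, because a coefficient functional of `v`
vanishes on `N` (`exists_highest_coeff`).

Finally `Z ≤ J` (`IsConjAction.le_of_stable`): filter `V / ħ V` by the number of root vectors
applied to `v`. On a vector of filtration degree `r` the Euler operator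
`∑ (z_i² - z_j²)⁻¹ X_{ij} G_{ij}`, over the pairs with `z_i² ≠ z_j²`, acts as multiplication by
the number of root vectors, modulo `J` and lower degree, while each `G_{ij}` lowers the degree and
preserves `Z`. Induction on the degree gives the claim.
-/

noncomputable section

namespace QuantumGL

/-! ### Powers of `q` -/

theorem qpow_add (a b : ℂ) : qpow (a + b) = qpow a * qpow b :=
  (PowerSeries.exp_mul_exp_eq_exp_add a b).symm

theorem qpow_zero : qpow 0 = 1 := by
  simp [qpow]

theorem constantCoeff_qpow (a : ℂ) : PowerSeries.constantCoeff (qpow a) = 1 := by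
  rw [qpow, ← PowerSeries.coeff_zero_eq_constantCoeff_apply, PowerSeries.coeff_rescale]
  simp

theorem qK_add (a b : ℂ) : qK (a + b) = qK a * qK b := by
  simp [qK, qpow_add]

theorem qK_zero : qK 0 = 1 := by
  simp [qK, qpow_zero]

theorem qK_mul_neg (a : ℂ) : qK a * qK (-a) = 1 := by
  rw [← qK_add, add_neg_cancel, qK_zero]

theorem qK_ne_zero (a : ℂ) : qK a ≠ 0 := left_ne_zero_of_mul_eq_one (qK_mul_neg a)

theorem qK_neg (a : ℂ) : qK (-a) = (qK a)⁻¹ :=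
  eq_inv_of_mul_eq_one_right (qK_mul_neg a)

theorem qDeltaK_eq : qDeltaK = qK 1 - (qK 1)⁻¹ := by
  rw [qDeltaK, qK_neg]

/-! ### The relations of the quantum group without the Serre relations -/

/-- The inner product `(ε_i, α_a)`, for indices in `ℕ`. -/
def wtPair (i a : ℕ) : ℂ := (if i = a then 1 else 0) - (if i = a + 1 then 1 else 0)

/-- Families of elements of an algebra that satisfy the defining relations of `U_q(gl(n))`, except
for the Serre relations and the commutation of distant generators of the same sign. The families
are indexed by `ℕ`; only the relation between `e_a` and `f_a` is restricted to the range of the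
simple roots. -/
structure IsPreUq (n : ℕ) {A : Type*} [Ring A] [Algebra Kh A] (k kinv e f : ℕ → A) : Prop where
  k_kinv : ∀ i, k i * kinv i = 1
  kinv_k : ∀ i, kinv i * k i = 1
  k_comm : ∀ i j, k i * k j = k j * k i
  k_e : ∀ i a, k i * e a = qK (wtPair i a) • (e a * k i)
  k_f : ∀ i a, k i * f a = qK (-wtPair i a) • (f a * k i)
  e_f_ne : ∀ a b, a ≠ b → e a * f b = f b * e a
  e_f_self : ∀ a, a + 1 < n → e a * f a - f a * e a =
    qDeltaK⁻¹ • (k a * kinv (a + 1) - kinv a * k (a + 1))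

namespace IsPreUq

variable {n : ℕ} {A : Type*} [Ring A] [Algebra Kh A] {k kinv e f : ℕ → A}

theorem commute_k_kinv (h : IsPreUq n k kinv e f) (i j : ℕ) : Commute (k i) (kinv j) := by
  have h1 : Commute (k i) (k j) := h.k_comm i j
  have h2 : kinv j * (k i * k j) * kinv j = kinv j * (k j * k i) * kinv j := by rw [h1.eq]
  rw [← mul_assoc, mul_assoc _ (k j), h.k_kinv, ← mul_assoc, h.kinv_k, mul_one, one_mul] at h2
  exact h2.symm

theorem commute_kinv_kinv (h : IsPreUq n k kinv e f) (i j : ℕ) :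
    Commute (kinv i) (kinv j) := by
  have h1 := h.commute_k_kinv i j
  have h2 : kinv i * (k i * kinv j) * kinv i = kinv i * (kinv j * k i) * kinv i := by rw [h1.eq]
  rw [← mul_assoc, h.kinv_k, one_mul, mul_assoc, mul_assoc, h.k_kinv, mul_one] at h2
  exact h2.symm

theorem kinv_mul_of_k_mul (h : IsPreUq n k kinv e f) {i : ℕ} {c : ℂ} {x : A}
    (hx : k i * x = qK c • (x * k i)) : kinv i * x = qK (-c) • (x * kinv i) := by
  have h1 : kinv i * (k i * x) * kinv i = kinv i * (qK c • (x * k i)) * kinv i := by rw [hx]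
  rw [← mul_assoc, h.kinv_k, one_mul, mul_smul_comm, smul_mul_assoc, mul_assoc, mul_assoc,
    h.k_kinv, mul_one] at h1
  rw [h1, smul_smul, mul_comm, qK_mul_neg, one_smul]

theorem kinv_e (h : IsPreUq n k kinv e f) (i a : ℕ) :
    kinv i * e a = qK (-wtPair i a) • (e a * kinv i) :=
  h.kinv_mul_of_k_mul (h.k_e i a)

theorem kinv_f (h : IsPreUq n k kinv e f) (i a : ℕ) :
    kinv i * f a = qK (wtPair i a) • (f a * kinv i) := by
  simpa using h.kinv_mul_of_k_mul (h.k_f i a)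

/-- The relations are stable under the exchange of `e` with `f` and of `k` with `k⁻¹`. -/
theorem swap (h : IsPreUq n k kinv e f) : IsPreUq n kinv k f e where
  k_kinv := h.kinv_k
  kinv_k := h.k_kinv
  k_comm := fun i j => h.commute_kinv_kinv i j
  k_e := h.kinv_f
  k_f := h.kinv_e
  e_f_ne := fun a b hab => (h.e_f_ne b a hab.symm).symm
  e_f_self := fun a ha => by
    rw [← neg_sub, h.e_f_self a ha, ← smul_neg, neg_sub]

/-- `q^{h_α} e_b`, with exponent `(α_a, α_b)`. -/
theorem kk_e (h : IsPreUq n k kinv e f) (a b : ℕ) :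
    (k a * kinv (a + 1)) * e b =
      qK (wtPair a b - wtPair (a + 1) b) • (e b * (k a * kinv (a + 1))) := by
  rw [mul_assoc, h.kinv_e, mul_smul_comm, ← mul_assoc, h.k_e, smul_mul_assoc, smul_smul,
    mul_assoc, sub_eq_neg_add, qK_add]

theorem kk'_e (h : IsPreUq n k kinv e f) (a b : ℕ) :
    (kinv a * k (a + 1)) * e b =
      qK (-(wtPair a b - wtPair (a + 1) b)) • (e b * (kinv a * k (a + 1))) := by
  rw [mul_assoc, h.k_e, mul_smul_comm, ← mul_assoc, h.kinv_e, smul_mul_assoc, smul_smul,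
    mul_assoc, neg_sub, sub_eq_add_neg, qK_add]

end IsPreUq

/-- The quantum Serre expression of two elements of an algebra. -/
def qSerre {A : Type*} [Ring A] [Algebra Kh A] (x y : A) : A :=
  x * x * y - (qK 1 + qK (-1)) • (x * y * x) + y * x * x

/-- The Serre expression in `e_a`, `e_b` commutes with `f_b`. -/
theorem commute_qSerre_right {A : Type*} [Ring A] [Algebra Kh A] {x y f K K' : A} {d : Kh}
    (hx : x * f = f * x) (hy : y * f = f * y + d • (K - K'))
    (h1 : K * x = qK (-1) • (x * K)) (h2 : K' * x = qK 1 • (x * K')) :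
    Commute (qSerre x y) f := by
  have hq := qK_mul_neg 1
  have hx' : ∀ z, x * (f * z) = f * (x * z) := fun z => by rw [← mul_assoc, hx, mul_assoc]
  have hy' : ∀ z, y * (f * z) = f * (y * z) + d • (K * z - K' * z) := fun z => by
    rw [← mul_assoc, hy, add_mul, mul_assoc, smul_mul_assoc, sub_mul]
  have h1' : ∀ z, K * (x * z) = qK (-1) • (x * (K * z)) := fun z => by
    rw [← mul_assoc, h1, smul_mul_assoc, mul_assoc]
  have h2' : ∀ z, K' * (x * z) = qK 1 • (x * (K' * z)) := fun z => by
    rw [← mul_assoc, h2, smul_mul_assoc, mul_assoc]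
  rw [Commute, SemiconjBy, qSerre]
  simp only [mul_add, add_mul, mul_sub, sub_mul, smul_mul_assoc, mul_smul_comm, mul_assoc, hx, hx',
    hy, hy', h1, h1', h2, h2', smul_add, smul_sub, smul_smul]
  generalize qK 1 = q at *
  generalize qK (-1) = q' at *
  match_scalars <;> grind

/-- The Serre expression in `e_a`, `e_b` commutes with `f_a`. -/
theorem commute_qSerre_left {A : Type*} [Ring A] [Algebra Kh A] {x y f K K' : A} {d : Kh}
    (hy : y * f = f * y) (hx : x * f = f * x + d • (K - K'))
    (h1 : K * x = qK 2 • (x * K)) (h2 : K' * x = qK (-2) • (x * K'))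
    (h3 : K * y = qK (-1) • (y * K)) (h4 : K' * y = qK 1 • (y * K')) :
    Commute (qSerre x y) f := by
  have hq := qK_mul_neg 1
  have hq2 : qK 2 = qK 1 * qK 1 := by rw [← qK_add]; norm_num
  have hq3 : qK (-2) = qK (-1) * qK (-1) := by rw [← qK_add]; norm_num
  have hy' : ∀ z, y * (f * z) = f * (y * z) := fun z => by rw [← mul_assoc, hy, mul_assoc]
  have hx' : ∀ z, x * (f * z) = f * (x * z) + d • (K * z - K' * z) := fun z => by
    rw [← mul_assoc, hx, add_mul, mul_assoc, smul_mul_assoc, sub_mul]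
  have h1' : ∀ z, K * (x * z) = qK 2 • (x * (K * z)) := fun z => by
    rw [← mul_assoc, h1, smul_mul_assoc, mul_assoc]
  have h2' : ∀ z, K' * (x * z) = qK (-2) • (x * (K' * z)) := fun z => by
    rw [← mul_assoc, h2, smul_mul_assoc, mul_assoc]
  have h3' : ∀ z, K * (y * z) = qK (-1) • (y * (K * z)) := fun z => by
    rw [← mul_assoc, h3, smul_mul_assoc, mul_assoc]
  have h4' : ∀ z, K' * (y * z) = qK 1 • (y * (K' * z)) := fun z => by
    rw [← mul_assoc, h4, smul_mul_assoc, mul_assoc]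
  rw [Commute, SemiconjBy, qSerre]
  simp only [mul_add, add_mul, mul_sub, sub_mul, smul_mul_assoc, mul_smul_comm, mul_assoc, hx, hx',
    hy, hy', h1, h1', h2, h2', h3, h3', h4, h4', smul_add, smul_sub, smul_smul, hq2, hq3]
  generalize qK 1 = q at *
  generalize qK (-1) = q' at *
  match_scalars <;> grind

namespace IsPreUq

variable {n : ℕ} {A : Type*} [Ring A] [Algebra Kh A] {k kinv e f : ℕ → A}

/-- The Serre expressions in the `e_a` commute with the `f_a`. -/
theorem commute_qSerre_e (h : IsPreUq n k kinv e f) {a b c : ℕ} (hab : a + 1 = b ∨ b + 1 = a)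
    (hc : c + 1 < n) : Commute (qSerre (e a) (e b)) (f c) := by
  have hself : e c * f c = f c * e c + qDeltaK⁻¹ • (k c * kinv (c + 1) - kinv c * k (c + 1)) := by
    rw [← h.e_f_self c hc, add_sub_cancel]
  have key : ∀ p : ℕ, ∀ s : ℂ, wtPair c p - wtPair (c + 1) p = s →
      (k c * kinv (c + 1)) * e p = qK s • (e p * (k c * kinv (c + 1))) ∧
      (kinv c * k (c + 1)) * e p = qK (-s) • (e p * (kinv c * k (c + 1))) := by
    rintro p s rfl
    exact ⟨h.kk_e c p, h.kk'_e c p⟩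
  rcases eq_or_ne a c with rfl | hac
  · have hne : b ≠ a := by omega
    obtain ⟨h1, h2⟩ := key a 2 (by simp [wtPair]; norm_num)
    obtain ⟨h3, h4⟩ := key b (-1) (by
      rcases hab with rfl | rfl <;> simp [wtPair] <;> omega)
    exact commute_qSerre_left (h.e_f_ne b a hne) hself h1 h2 h3 (by simpa using h4)
  · rcases eq_or_ne b c with rfl | hbc
    · obtain ⟨h3, h4⟩ := key a (-1) (by
        rcases hab with rfl | rfl <;> simp [wtPair] <;> omega)
      exact commute_qSerre_right (h.e_f_ne a b hac) hself h3 (by simpa using h4)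
    · have h1 : Commute (e a) (f c) := h.e_f_ne a c hac
      have h2 : Commute (e b) (f c) := h.e_f_ne b c hbc
      exact (((h1.mul_left h1).mul_left h2).sub_left
        (((h1.mul_left h2).mul_left h1).smul_left _)).add_left ((h2.mul_left h1).mul_left h1)

/-- The commutators of distant `e_a` commute with the `f_a`. -/
theorem commute_commutator_e (h : IsPreUq n k kinv e f) {a b c : ℕ} (hab : a + 1 < b)
    (hc : c + 1 < n) : Commute (e a * e b - e b * e a) (f c) := by
  have hself : e c * f c = f c * e c + qDeltaK⁻¹ • (k c * kinv (c + 1) - kinv c * k (c + 1)) := by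
    rw [← h.e_f_self c hc, add_sub_cancel]
  have key : ∀ p : ℕ, wtPair c p - wtPair (c + 1) p = 0 →
      Commute (k c * kinv (c + 1) - kinv c * k (c + 1)) (e p) := by
    intro p hp
    have h1 := h.kk_e c p
    have h2 := h.kk'_e c p
    rw [hp, qK_zero, one_smul] at h1
    rw [hp, neg_zero, qK_zero, one_smul] at h2
    exact Commute.sub_left h1 h2
  rcases eq_or_ne a c with rfl | hac
  · have h1 : e b * f a = f a * e b := h.e_f_ne b a (by omega)
    have h2 := (key b (by simp [wtPair]; grind)).eq
    rw [Commute, SemiconjBy, sub_mul, mul_sub, mul_assoc, h1, ← mul_assoc, hself, mul_assoc (e b),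
      hself, add_mul, mul_add, smul_mul_assoc, h2, ← mul_assoc (e b), h1, mul_smul_comm]
    noncomm_ring
  · have h1 : e a * f c = f c * e a := h.e_f_ne a c hac
    rcases eq_or_ne b c with rfl | hbc
    · have h2 := (key a (by simp [wtPair]; grind)).eq
      rw [Commute, SemiconjBy, sub_mul, mul_sub, mul_assoc, hself, mul_assoc (e b), h1,
        ← mul_assoc (e b), hself, add_mul, mul_add, smul_mul_assoc, h2, ← mul_assoc (e a), h1,
        mul_smul_comm]
      noncomm_ring
    · have h1 : Commute (e a) (f c) := h1
      have h2 : Commute (e b) (f c) := h.e_f_ne b c hbc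
      exact (h1.mul_left h2).sub_left (h2.mul_left h1)

/-- The commutators of distant `f_a` commute with the `e_a`. -/
theorem commute_commutator_f (h : IsPreUq n k kinv e f) {a b c : ℕ} (hab : a + 1 < b)
    (hc : c + 1 < n) : Commute (f a * f b - f b * f a) (e c) :=
  h.swap.commute_commutator_e hab hc

/-- The Serre expressions in the `f_a` commute with the `e_a`. -/
theorem commute_qSerre_f (h : IsPreUq n k kinv e f) {a b c : ℕ} (hab : a + 1 = b ∨ b + 1 = a)
    (hc : c + 1 < n) : Commute (qSerre (f a) (f b)) (e c) :=
  h.swap.commute_qSerre_e hab hc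

end IsPreUq

/-! ### A module on words -/

section Words

variable (χ : ℕ → Kh)

/-- The weight of the word `L` in the letters `f_a`, applied to a vector of weight `χ`. -/
def wordWt : List ℕ → ℕ → Kh
  | [], i => χ i
  | a :: L, i => qK (-wtPair i a) * wordWt L i

theorem wordWt_ne_zero {χ : ℕ → Kh} (hχ : ∀ i, χ i ≠ 0) : ∀ (L : List ℕ) (i : ℕ),
    wordWt χ L i ≠ 0
  | [], i => hχ i
  | _ :: L, i => mul_ne_zero (qK_ne_zero _) (wordWt_ne_zero hχ L i)

/-- The vector space on the words in the letters `f_a`. -/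
abbrev WordMod : Type := List ℕ →₀ Kh

/-- `f_a` puts the letter `a` in front of a word. -/
def wordF (a : ℕ) : Module.End Kh WordMod := Finsupp.lmapDomain Kh Kh (List.cons a)

/-- `q^{h_{ε_i}}` acts on words diagonally. -/
def wordK (i : ℕ) : Module.End Kh WordMod :=
  Finsupp.linearCombination Kh fun L => Finsupp.single L (wordWt χ L i)

/-- `q^{-h_{ε_i}}` acts on words diagonally. -/
def wordKinv (i : ℕ) : Module.End Kh WordMod :=
  Finsupp.linearCombination Kh fun L => Finsupp.single L (wordWt χ L i)⁻¹

/-- The image of a word under `e_a`, found by commuting `e_a` to the right. -/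
def wordEAux (a : ℕ) : List ℕ → WordMod
  | [] => 0
  | b :: L => wordF b (wordEAux a L) + if a = b then
      Finsupp.single L (qDeltaK⁻¹ * (wordWt χ L a * (wordWt χ L (a + 1))⁻¹
        - (wordWt χ L a)⁻¹ * wordWt χ L (a + 1))) else 0

/-- `e_a` on the module of words. -/
def wordE (a : ℕ) : Module.End Kh WordMod := Finsupp.linearCombination Kh (wordEAux χ a)

@[simp] theorem wordF_single (a : ℕ) (L : List ℕ) (c : Kh) :
    wordF a (Finsupp.single L c) = Finsupp.single (a :: L) c := by
  simp [wordF]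

@[simp] theorem wordK_single (i : ℕ) (L : List ℕ) (c : Kh) :
    wordK χ i (Finsupp.single L c) = Finsupp.single L (c * wordWt χ L i) := by
  simp [wordK]

@[simp] theorem wordKinv_single (i : ℕ) (L : List ℕ) (c : Kh) :
    wordKinv χ i (Finsupp.single L c) = Finsupp.single L (c * (wordWt χ L i)⁻¹) := by
  simp [wordKinv]

@[simp] theorem wordE_single (a : ℕ) (L : List ℕ) (c : Kh) :
    wordE χ a (Finsupp.single L c) = c • wordEAux χ a L := by
  simp [wordE]

theorem wordK_wordF (i a : ℕ) (x : WordMod) :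
    wordK χ i (wordF a x) = qK (-wtPair i a) • wordF a (wordK χ i x) := by
  induction x using Finsupp.induction_linear with
  | zero => simp
  | add x y hx hy => simp only [map_add, hx, hy, smul_add]
  | single L c =>
    simp only [wordWt, wordK_single, wordF_single, Finsupp.smul_single, smul_eq_mul]
    ring_nf

theorem wordK_wordE (i a : ℕ) (x : WordMod) :
    wordK χ i (wordE χ a x) = qK (wtPair i a) • wordE χ a (wordK χ i x) := by
  induction x using Finsupp.induction_linear with
  | zero => simp
  | add x y hx hy => simp only [map_add, hx, hy, smul_add]
  | single L c =>
    rw [wordK_single, wordE_single, wordE_single, map_smul, mul_comm c, mul_smul,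
      smul_comm _ c (wordEAux χ a L), smul_comm _ c]
    congr 1
    induction L with
    | nil => simp [wordEAux]
    | cons b L ih =>
      simp only [wordEAux, map_add, wordK_wordF, ih, wordWt, smul_add, map_smul]
      congr 1
      · simp only [smul_smul]
        congr 1
        ring
      · split_ifs with hab
        · subst hab
          rw [wordK_single, smul_smul, ← mul_assoc, qK_mul_neg, one_mul, Finsupp.smul_single,
            smul_eq_mul, mul_comm]
        · simp

variable {χ} in
theorem isPreUq_word (hχ : ∀ i, χ i ≠ 0) (n : ℕ) :
    IsPreUq n (wordK χ) (wordKinv χ) (wordE χ) wordF where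
  k_kinv := fun i => by
    ext L : 2
    simp [wordWt_ne_zero hχ]
  kinv_k := fun i => by
    ext L : 2
    simp [wordWt_ne_zero hχ]
  k_comm := fun i j => by
    ext L : 2
    simp [mul_comm]
  k_e := fun i a => LinearMap.ext fun x => wordK_wordE χ i a x
  k_f := fun i a => LinearMap.ext fun x => wordK_wordF χ i a x
  e_f_ne := fun a b hab => by
    ext L : 2
    simp [wordEAux, hab]
  e_f_self := fun a _ => by
    ext L : 2
    simp only [LinearMap.comp_apply, Finsupp.lsingle_apply, LinearMap.sub_apply,
      Module.End.mul_apply, LinearMap.smul_apply, wordF_single, wordE_single, wordK_single,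
      wordKinv_single, wordEAux, if_true, one_smul, add_sub_cancel_left, one_mul,
      ← Finsupp.single_sub, Finsupp.smul_single, smul_eq_mul]
    ring_nf

variable {χ} in
/-- An operator without constant term that commutes with every `f_a` vanishes on all words. -/
theorem word_eq_zero_of_commute {T : Module.End Kh WordMod} (h0 : T (Finsupp.single [] 1) = 0)
    (h : ∀ c, Commute T (wordF c)) : T = 0 := by
  suffices h : ∀ L : List ℕ, T (Finsupp.single L 1) = 0 by
    ext L : 2
    simpa using h L
  intro L
  induction L with
  | nil => exact h0
  | cons c L ih =>
    have h2 := LinearMap.congr_fun (h c).eq (Finsupp.single L 1)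
    rwa [Module.End.mul_apply, Module.End.mul_apply, ih, map_zero, wordF_single] at h2

variable {χ} in
theorem qSerre_wordE (hχ : ∀ i, χ i ≠ 0) {a b : ℕ} (hab : a + 1 = b ∨ b + 1 = a) :
    qSerre (wordE χ a) (wordE χ b) = 0 :=
  word_eq_zero_of_commute (by simp [qSerre, wordEAux])
    fun c => (isPreUq_word hχ (c + 2)).commute_qSerre_e hab (by omega)

variable {χ} in
theorem wordE_comm (hχ : ∀ i, χ i ≠ 0) {a b : ℕ} (hab : a + 1 < b) :
    wordE χ a * wordE χ b = wordE χ b * wordE χ a :=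
  sub_eq_zero.1 <| word_eq_zero_of_commute (by simp [wordEAux])
    fun c => (isPreUq_word hχ (c + 2)).commute_commutator_e hab (by omega)

/-! ### A representation of the quantum group with a highest weight vector -/

/-- The operator that sends the `a`-th basis vector to the `a + 1`-st one, and the others to `0`. -/
def colShift (a : ℕ) : Module.End Kh (ℕ → Kh) :=
  LinearMap.single Kh (fun _ => Kh) (a + 1) ∘ₗ LinearMap.proj a

/-- The vector of a word in the vector representation of the negative part of `U_q(gl(∞))`, on the
basis vector number `i`. -/
def wordVec (i : ℕ) : WordMod →ₗ[Kh] (ℕ → Kh) :=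
  Finsupp.linearCombination Kh fun L => (L.map colShift).prod (Pi.single i 1)

theorem wordVec_wordF (i a : ℕ) (x : WordMod) :
    wordVec i (wordF a x) = colShift a (wordVec i x) := by
  induction x using Finsupp.induction_linear with
  | zero => simp
  | add x y hx hy => simp only [map_add, hx, hy]
  | single L c => simp [wordVec]

theorem colShift_mul_of_ne {a b : ℕ} (h : a ≠ b + 1) : colShift a * colShift b = 0 := by
  ext g m
  simp [colShift, Pi.single_apply, h]

/-- The operator `e_{a_r} ⋯ e_{a_1}` for the list `a_1, …, a_r`. -/
def eWord {A : Type*} [Ring A] (e : ℕ → A) : List ℕ → A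
  | [] => 1
  | a :: L => eWord e L * e a

/-- The largest subspace of a subspace `P` that is stable under the `e_a`. -/
def eStable {W : Type*} [AddCommGroup W] [Module Kh W] (e : ℕ → Module.End Kh W)
    (P : Submodule Kh W) : Submodule Kh W :=
  ⨅ L : List ℕ, P.comap (eWord e L)

section Stable

variable {W : Type*} [AddCommGroup W] [Module Kh W] {k kinv e f : ℕ → Module.End Kh W}
  {P : Submodule Kh W}

theorem mem_eStable {x : W} : x ∈ eStable e P ↔ ∀ L, eWord e L x ∈ P := by
  simp [eStable]

theorem eStable_e {x : W} (hx : x ∈ eStable e P) (a : ℕ) : e a x ∈ eStable e P :=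
  mem_eStable.2 fun L => mem_eStable.1 hx (a :: L)

theorem eStable_of_qcomm {T : Module.End Kh W} {c : ℕ → Kh} (hT : ∀ a, e a * T = c a • (T * e a))
    (hP : ∀ x ∈ P, T x ∈ P) {x : W} (hx : x ∈ eStable e P) : T x ∈ eStable e P := by
  refine mem_eStable.2 fun L => ?_
  induction L generalizing x with
  | nil => exact hP x (mem_eStable.1 hx [])
  | cons a L ih =>
    have h1 := LinearMap.congr_fun (hT a) x
    rw [Module.End.mul_apply] at h1
    rw [eWord, Module.End.mul_apply, h1, LinearMap.smul_apply, map_smul]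
    exact P.smul_mem _ (ih (eStable_e hx a))

theorem eStable_k (h : ∀ n, IsPreUq n k kinv e f) (hk : ∀ i, ∀ x ∈ P, k i x ∈ P) (i : ℕ) {x : W}
    (hx : x ∈ eStable e P) : k i x ∈ eStable e P := by
  refine eStable_of_qcomm (c := fun a => qK (-wtPair i a)) (fun a => ?_) (hk i) hx
  rw [(h 0).k_e, smul_smul, mul_comm, qK_mul_neg, one_smul]

theorem eStable_kinv (h : ∀ n, IsPreUq n k kinv e f) (hk : ∀ i, ∀ x ∈ P, kinv i x ∈ P) (i : ℕ)
    {x : W} (hx : x ∈ eStable e P) : kinv i x ∈ eStable e P := by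
  refine eStable_of_qcomm (c := fun a => qK (wtPair i a)) (fun a => ?_) (hk i) hx
  rw [(h 0).kinv_e, smul_smul, qK_mul_neg, one_smul]

theorem eStable_f (h : ∀ n, IsPreUq n k kinv e f) (hk : ∀ i, ∀ x ∈ P, k i x ∈ P)
    (hkinv : ∀ i, ∀ x ∈ P, kinv i x ∈ P) (hf : ∀ i, ∀ x ∈ P, f i x ∈ P) (b : ℕ) {x : W}
    (hx : x ∈ eStable e P) : f b x ∈ eStable e P := by
  refine mem_eStable.2 fun L => ?_
  induction L generalizing x with
  | nil => exact hf b x (mem_eStable.1 hx [])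
  | cons a L ih =>
    rw [eWord, Module.End.mul_apply]
    rcases eq_or_ne a b with rfl | hab
    · have h1 := LinearMap.congr_fun ((h (a + 2)).e_f_self a (by omega)) x
      rw [LinearMap.sub_apply, sub_eq_iff_eq_add, Module.End.mul_apply] at h1
      rw [h1, map_add]
      refine P.add_mem ?_ (ih (eStable_e hx a))
      refine mem_eStable.1 (Submodule.smul_mem _ _ (Submodule.sub_mem _ ?_ ?_)) L
      · exact eStable_k h hk _ (eStable_kinv h hkinv _ hx)
      · exact eStable_kinv h hkinv _ (eStable_k h hk _ hx)
    · have h1 := LinearMap.congr_fun ((h 0).e_f_ne a b hab) x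
      rw [Module.End.mul_apply] at h1
      rw [h1]
      exact ih (eStable_e hx a)

theorem eStable_of_commute {T : Module.End Kh W} (hT : ∀ a, Commute T (e a))
    (hP : ∀ x, T x ∈ P) (x : W) : T x ∈ eStable e P := by
  refine mem_eStable.2 fun L => ?_
  induction L generalizing x with
  | nil => exact hP x
  | cons a L ih =>
    have h1 := LinearMap.congr_fun (hT a).eq x
    rw [Module.End.mul_apply, Module.End.mul_apply] at h1
    rw [eWord, Module.End.mul_apply, ← h1]
    exact ih _

end Stable

end Words

section Rep

variable (χ : ℕ → Kh) (i₀ : ℕ)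

/-- The action of `q^{h_{ε_i}}` on the vector representation, normalized on the basis vector
number `i₀`. -/
def colDiag (i : ℕ) : Module.End Kh (ℕ → Kh) :=
  LinearMap.pi fun m =>
    (χ i * qK ((if i = m then 1 else 0) - (if i = i₀ then 1 else 0))) • LinearMap.proj m

theorem wordVec_wordK (i : ℕ) (x : WordMod) :
    wordVec i₀ (wordK χ i x) = colDiag χ i₀ i (wordVec i₀ x) := by
  have hshift : ∀ a g, colDiag χ i₀ i (colShift a g)
      = qK (-wtPair i a) • colShift a (colDiag χ i₀ i g) := by
    intro a g
    ext m
    rcases eq_or_ne m (a + 1) with rfl | hm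
    · simp only [colDiag, colShift, LinearMap.pi_apply, LinearMap.smul_apply, LinearMap.proj_apply,
        LinearMap.comp_apply, LinearMap.single_apply, Pi.single_eq_same, smul_eq_mul,
        Pi.smul_apply, wtPair]
      rw [show ∀ s t u : Kh, s * (t * u) = t * s * u from fun s t u => by ring,
        mul_assoc (χ i) (qK _) (qK _), ← qK_add]
      congr 3
      ring
    · simp [colDiag, colShift, hm]
  suffices h : ∀ L : List ℕ, wordWt χ L i • (L.map colShift).prod (Pi.single i₀ 1)
      = colDiag χ i₀ i ((L.map colShift).prod (Pi.single i₀ 1)) by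
    induction x using Finsupp.induction_linear with
    | zero => simp
    | add x y hx hy => simp only [map_add, hx, hy]
    | single L c =>
      rw [wordK_single, wordVec, Finsupp.linearCombination_single,
        Finsupp.linearCombination_single, map_smul, ← h L, smul_smul]
  intro L
  induction L with
  | nil =>
    ext m
    rcases eq_or_ne m i₀ with rfl | hm
    · simp [colDiag, wordWt, qK_zero]
    · simp [colDiag, hm]
  | cons a L ih =>
    rw [List.map_cons, List.prod_cons, Module.End.mul_apply, hshift, ← ih, map_smul, smul_smul,
      wordWt]

variable {χ} in
theorem colDiag_injective (hχ : ∀ i, χ i ≠ 0) (i : ℕ) :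
    Function.Injective (colDiag χ i₀ i) := by
  intro g g' h
  ext m
  have h1 := congrFun h m
  simpa [colDiag, hχ i, qK_ne_zero] using h1

/-- The subspace by which the module of words is divided: it is stable under the quantum group and
lies in the kernel of `wordVec i₀`. -/
def wordKer : Submodule Kh WordMod :=
  eStable (wordE χ) (LinearMap.ker (wordVec i₀))

variable {χ} (hχ : ∀ i, χ i ≠ 0)

theorem wordVec_k_mem (i : ℕ) : ∀ x ∈ LinearMap.ker (wordVec i₀),
    wordK χ i x ∈ LinearMap.ker (wordVec i₀) := by
  intro x hx
  rw [LinearMap.mem_ker] at hx ⊢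
  rw [wordVec_wordK, hx, map_zero]

include hχ in
theorem wordVec_kinv_mem (i : ℕ) : ∀ x ∈ LinearMap.ker (wordVec i₀),
    wordKinv χ i x ∈ LinearMap.ker (wordVec i₀) := by
  intro x hx
  rw [LinearMap.mem_ker] at hx ⊢
  apply colDiag_injective i₀ hχ i
  have h := LinearMap.congr_fun ((isPreUq_word hχ 0).k_kinv i) x
  rw [Module.End.mul_apply, Module.End.one_apply] at h
  rw [← wordVec_wordK, h, hx, map_zero]

theorem wordVec_f_mem (a : ℕ) : ∀ x ∈ LinearMap.ker (wordVec i₀),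
    wordF a x ∈ LinearMap.ker (wordVec i₀) := by
  intro x hx
  rw [LinearMap.mem_ker] at hx ⊢
  rw [wordVec_wordF, hx, map_zero]

/-- The operators of the generators on the module of words. -/
def wordOp (χ : ℕ → Kh) {n : ℕ} : Gen n → Module.End Kh WordMod
  | .k i => wordK χ i
  | .kinv i => wordKinv χ i
  | .e a => wordE χ a
  | .f a => wordF a

include hχ in
theorem wordOp_mem {n : ℕ} (g : Gen n) :
    wordKer χ i₀ ≤ (wordKer χ i₀).comap (wordOp χ g) := by
  intro x hx
  have h := fun n => isPreUq_word hχ n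
  match g with
  | .k i => exact eStable_k h (wordVec_k_mem i₀) _ hx
  | .kinv i => exact eStable_kinv h (wordVec_kinv_mem i₀ hχ) _ hx
  | .e a => exact eStable_e hx _
  | .f a => exact eStable_f h (wordVec_k_mem i₀) (wordVec_kinv_mem i₀ hχ) (wordVec_f_mem i₀) _ hx

include hχ in
theorem qSerre_wordF_mem {a b : ℕ} (hab : a + 1 = b ∨ b + 1 = a) (x : WordMod) :
    qSerre (wordF a) (wordF b) x ∈ wordKer χ i₀ := by
  refine eStable_of_commute (fun c => (isPreUq_word hχ (c + 2)).commute_qSerre_f hab (by omega))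
    (fun x => ?_) x
  rw [LinearMap.mem_ker, qSerre]
  simp only [LinearMap.add_apply, LinearMap.sub_apply, LinearMap.smul_apply, Module.End.mul_apply,
    map_add, map_sub, map_smul, wordVec_wordF]
  simp only [← Module.End.mul_apply]
  have h1 : colShift a * colShift a = 0 := colShift_mul_of_ne (by omega)
  have h2 : colShift a * colShift b * colShift a = 0 := by
    rcases hab with rfl | rfl
    · rw [colShift_mul_of_ne (by omega), zero_mul]
    · rw [mul_assoc, colShift_mul_of_ne (a := b) (by omega), mul_zero]
  rw [← mul_assoc, h1, ← mul_assoc, h2]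
  simp

include hχ in
theorem commutator_wordF_mem {a b : ℕ} (hab : a + 1 < b) (x : WordMod) :
    (wordF a * wordF b - wordF b * wordF a) x ∈ wordKer χ i₀ := by
  refine eStable_of_commute
    (fun c => (isPreUq_word hχ (c + 2)).commute_commutator_f hab (by omega)) (fun x => ?_) x
  rw [LinearMap.mem_ker]
  simp only [LinearMap.sub_apply, Module.End.mul_apply, map_sub, wordVec_wordF]
  simp only [← Module.End.mul_apply]
  rw [colShift_mul_of_ne (by omega), colShift_mul_of_ne (by omega)]
  simp

/-- The operators of the generators on the quotient of the module of words. -/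
def quotOp {n : ℕ} : FreeU n →ₐ[Kh] Module.End Kh (WordMod ⧸ wordKer χ i₀) :=
  FreeAlgebra.lift Kh fun g => (wordKer χ i₀).mapQ _ (wordOp χ g) (wordOp_mem i₀ hχ g)

theorem quotOp_gen_mk {n : ℕ} (g : Gen n) (x : WordMod) :
    quotOp i₀ hχ (gen g) ((wordKer χ i₀).mkQ x) = (wordKer χ i₀).mkQ (wordOp χ g x) := by
  rw [quotOp, gen, FreeAlgebra.lift_ι_apply]
  rfl

theorem pair_eq_wtPair {n : ℕ} (i : Fin n) (a : Fin (n - 1)) : pair i a = wtPair i a := by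
  simp [pair, wtPair, lo, hi, Fin.ext_iff]

theorem quotOp_rel {n : ℕ} {x y : FreeU n} (h : UqRel n x y) :
    quotOp i₀ hχ x = quotOp i₀ hχ y := by
  refine Submodule.linearMap_qext _ (LinearMap.ext fun z => ?_)
  have hp := isPreUq_word hχ n
  induction h
  all_goals
    simp only [LinearMap.comp_apply, map_mul, map_one, map_sub, map_add, map_smul, map_zero,
      Module.End.mul_apply, LinearMap.sub_apply, LinearMap.add_apply, LinearMap.smul_apply,
      quotOp_gen_mk, Module.End.one_apply, wordOp, pair_eq_wtPair]
    try simp only [← map_smul (wordKer χ i₀).mkQ, ← map_sub (wordKer χ i₀).mkQ,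
      ← map_add (wordKer χ i₀).mkQ]
  case k_kinv i => exact congrArg _ (LinearMap.congr_fun (hp.k_kinv i) z)
  case kinv_k i => exact congrArg _ (LinearMap.congr_fun (hp.kinv_k i) z)
  case k_comm i j => exact congrArg _ (LinearMap.congr_fun (hp.k_comm i j) z)
  case k_e i a => exact congrArg _ (LinearMap.congr_fun (hp.k_e i a) z)
  case k_f i a => exact congrArg _ (LinearMap.congr_fun (hp.k_f i a) z)
  case e_f_self a => exact congrArg _ (LinearMap.congr_fun (hp.e_f_self a (by omega)) z)
  case e_f_ne a b h =>
    exact congrArg _ (LinearMap.congr_fun (hp.e_f_ne a b (fun h' => h (Fin.ext h'))) z)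
  case e_serre a b h =>
    exact (congrArg _ (LinearMap.congr_fun (qSerre_wordE hχ h) z)).trans (map_zero _)
  case f_serre a b h =>
    exact (Submodule.Quotient.mk_eq_zero _).2 (qSerre_wordF_mem i₀ hχ h z)
  case e_comm a b h => exact congrArg _ (LinearMap.congr_fun (wordE_comm hχ h) z)
  case f_comm a b h =>
    exact (Submodule.Quotient.eq _).2 (commutator_wordF_mem i₀ hχ h z)

/-- The representation of the quantum group on the quotient of the module of words. -/
def quotRep (n : ℕ) : Uq n →ₐ[Kh] Module.End Kh (WordMod ⧸ wordKer χ i₀) :=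
  RingQuot.liftAlgHom Kh ⟨quotOp i₀ hχ, fun _ _ h => quotOp_rel i₀ hχ h⟩

theorem quotRep_uGen {n : ℕ} (g : Gen n) (x : WordMod) :
    quotRep i₀ hχ n (uGen g) ((wordKer χ i₀).mkQ x) = (wordKer χ i₀).mkQ (wordOp χ g x) := by
  rw [← quotOp_gen_mk i₀ hχ, quotRep, uGen]
  exact LinearMap.congr_fun (RingQuot.liftAlgHom_mkAlgHom_apply ..) _

end Rep

theorem weightQ_ne_zero {n : ℕ} (μ : Weight n) (i : Fin n) : algebraMap Rh Kh (μ.q i) ≠ 0 := by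
  rw [Weight.q, map_mul]
  refine mul_ne_zero (fun h => ?_) (qK_ne_zero _)
  have h1 := (injective_iff_map_eq_zero (algebraMap Rh Kh)).1 (IsFractionRing.injective Rh Kh) _ h
  simp at h1

/-- The Verma module over `ℂ((ħ))` has maps to the vector representation of the negative part of
the quantum group that send the highest weight vector to a given basis vector. In particular, the
highest weight vector is not zero. -/
theorem exists_vermaVec_map {n : ℕ} (μ : Weight n) (i₀ : ℕ) :
    ∃ Φ : Verma μ →+ (ℕ → Kh), Φ (vermaVec μ) = Pi.single i₀ 1 ∧
      (∀ (a : Fin (n - 1)) x, Φ (uf a • x) = colShift a (Φ x)) ∧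
      ∀ (c : Kh) x, Φ (algebraMap Kh (Uq n) c • x) = c • Φ x := by
  let χ : ℕ → Kh := fun i => if h : i < n then algebraMap Rh Kh (μ.q ⟨i, h⟩) else 1
  have hχ : ∀ i, χ i ≠ 0 := by
    intro i
    by_cases h : i < n
    · simpa [χ, h] using weightQ_ne_zero μ ⟨i, h⟩
    · simp [χ, h]
  let Q := WordMod ⧸ wordKer χ i₀
  let ρ := quotRep i₀ hχ n
  let _ : Module (Uq n) Q := Module.compHom Q ρ.toRingHom
  have hρ : ∀ (u : Uq n) (x : Q), u • x = ρ u x := fun _ _ => rfl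
  let v : Q := (wordKer χ i₀).mkQ (Finsupp.single [] 1)
  have hle : vermaIdeal μ ≤ LinearMap.ker (LinearMap.toSpanSingleton (Uq n) Q v) := by
    refine Submodule.span_le.2 ?_
    rintro _ (⟨a, rfl⟩ | ⟨i, rfl⟩)
    · rw [SetLike.mem_coe, LinearMap.mem_ker, LinearMap.toSpanSingleton_apply, hρ, ue,
        quotRep_uGen]
      simp [wordOp, wordEAux]
    · rw [SetLike.mem_coe, LinearMap.mem_ker, LinearMap.toSpanSingleton_apply, sub_smul, hρ, hρ, uk,
        quotRep_uGen, IsScalarTower.algebraMap_apply Rh Kh (Uq n), AlgHom.commutes,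
        Module.algebraMap_end_apply, ← map_smul, ← map_sub, wordOp, wordK_single, wordWt,
        Finsupp.smul_single, smul_eq_mul, mul_one, one_mul]
      simp only [χ, i.2, dif_pos, Fin.eta, sub_self, map_zero]
  let Ψ : Verma μ →ₗ[Uq n] Q := (vermaIdeal μ).liftQ _ hle
  have hΨv : Ψ (vermaVec μ) = v := one_smul (Uq n) v
  let θ : Q →ₗ[Kh] (ℕ → Kh) := (wordKer χ i₀).liftQ (wordVec i₀)
    (fun x hx => mem_eStable.1 hx [])
  refine ⟨θ.toAddMonoidHom.comp Ψ.toAddMonoidHom, ?_, fun a x => ?_, fun c x => ?_⟩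
  · change θ (Ψ (vermaVec μ)) = _
    rw [hΨv]
    exact (Finsupp.linearCombination_single Kh 1 []).trans (one_smul Kh _)
  · change θ (Ψ (uf a • x)) = colShift a (θ (Ψ x))
    rw [map_smul, hρ]
    obtain ⟨y, hy⟩ := Submodule.mkQ_surjective _ (Ψ x)
    rw [← hy, uf, quotRep_uGen]
    exact wordVec_wordF i₀ a y
  · change θ (Ψ _) = c • θ (Ψ x)
    rw [map_smul, hρ, AlgHom.commutes, Module.algebraMap_end_apply, map_smul]

/-! ### The generators of the quantum group, with indices in `ℕ` -/

section Generators

variable (n : ℕ)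

/-- `q^{h_{ε_i}}`, set to `1` out of range. -/
def uK (i : ℕ) : Uq n := if h : i < n then uk ⟨i, h⟩ else 1

/-- `q^{-h_{ε_i}}`, set to `1` out of range. -/
def uKinv (i : ℕ) : Uq n := if h : i < n then ukinv ⟨i, h⟩ else 1

/-- `e_{α_a}`, set to `0` out of range. -/
def uE (a : ℕ) : Uq n := if h : a < n - 1 then ue ⟨a, h⟩ else 0

/-- `f_{α_a}`, set to `0` out of range. -/
def uF (a : ℕ) : Uq n := if h : a < n - 1 then uf ⟨a, h⟩ else 0

variable {n}

@[simp] theorem uK_val (i : Fin n) : uK n i = uk i := by simp [uK]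
@[simp] theorem uKinv_val (i : Fin n) : uKinv n i = ukinv i := by simp [uKinv]
@[simp] theorem uE_val (a : Fin (n - 1)) : uE n a = ue a := by simp [uE]
@[simp] theorem uF_val (a : Fin (n - 1)) : uF n a = uf a := by simp [uF]

theorem uE_of_le {a : ℕ} (h : n - 1 ≤ a) : uE n a = 0 := dif_neg h.not_gt
theorem uF_of_le {a : ℕ} (h : n - 1 ≤ a) : uF n a = 0 := dif_neg h.not_gt
theorem uK_of_le {a : ℕ} (h : n ≤ a) : uK n a = 1 := dif_neg h.not_gt
theorem uKinv_of_le {a : ℕ} (h : n ≤ a) : uKinv n a = 1 := dif_neg h.not_gt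

/-- The projection of the free algebra to the quantum group. -/
def uMk (n : ℕ) : FreeU n →ₐ[Kh] Uq n := RingQuot.mkAlgHom Kh (UqRel n)

theorem uMk_k (i : Fin n) : uMk n (gen (.k i)) = uk i := rfl
theorem uMk_kinv (i : Fin n) : uMk n (gen (.kinv i)) = ukinv i := rfl
theorem uMk_e (a : Fin (n - 1)) : uMk n (gen (.e a)) = ue a := rfl
theorem uMk_f (a : Fin (n - 1)) : uMk n (gen (.f a)) = uf a := rfl

theorem uMk_rel {x y : FreeU n} (h : UqRel n x y) : uMk n x = uMk n y :=
  RingQuot.mkAlgHom_rel Kh h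

theorem isPreUq_uq : IsPreUq n (uK n) (uKinv n) (uE n) (uF n) where
  k_kinv := fun i => by
    rcases lt_or_ge i n with h | h
    · lift i to Fin n using h
      simpa only [map_mul, uMk_k, uMk_kinv, uMk_e, uMk_f, Commute, SemiconjBy, map_one, uK_val,
        uKinv_val] using
        uMk_rel (UqRel.k_kinv i)
    · simp [uK_of_le h, uKinv_of_le h]
  kinv_k := fun i => by
    rcases lt_or_ge i n with h | h
    · lift i to Fin n using h
      simpa only [map_mul, uMk_k, uMk_kinv, uMk_e, uMk_f, Commute, SemiconjBy, map_one, uK_val,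
        uKinv_val] using
        uMk_rel (UqRel.kinv_k i)
    · simp [uK_of_le h, uKinv_of_le h]
  k_comm := fun i j => by
    rcases lt_or_ge i n with h | h
    · rcases lt_or_ge j n with h' | h'
      · lift i to Fin n using h
        lift j to Fin n using h'
        simpa only [map_mul, uMk_k, uMk_kinv, uMk_e, uMk_f, Commute, SemiconjBy, uK_val] using
          uMk_rel (UqRel.k_comm i j)
      · simp [uK_of_le h']
    · simp [uK_of_le h]
  k_e := fun i a => by
    rcases lt_or_ge a (n - 1) with h' | h'
    · rcases lt_or_ge i n with h | h
      · lift i to Fin n using h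
        lift a to Fin (n - 1) using h'
        simpa only [map_mul, uMk_k, uMk_kinv, uMk_e, uMk_f, Commute, SemiconjBy, map_smul, uK_val,
          uE_val, pair_eq_wtPair] using
          uMk_rel (UqRel.k_e i a)
      · have h1 : wtPair i a = 0 := by
          rw [wtPair, if_neg (by omega), if_neg (by omega), sub_zero]
        simp [uK_of_le h, h1, qK_zero]
    · simp [uE_of_le h']
  k_f := fun i a => by
    rcases lt_or_ge a (n - 1) with h' | h'
    · rcases lt_or_ge i n with h | h
      · lift i to Fin n using h
        lift a to Fin (n - 1) using h'
        simpa only [map_mul, uMk_k, uMk_kinv, uMk_e, uMk_f, Commute, SemiconjBy, map_smul, uK_val,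
          uF_val, pair_eq_wtPair] using
          uMk_rel (UqRel.k_f i a)
      · have h1 : wtPair i a = 0 := by
          rw [wtPair, if_neg (by omega), if_neg (by omega), sub_zero]
        simp [uK_of_le h, h1, qK_zero]
    · simp [uF_of_le h']
  e_f_ne := fun a b hab => by
    rcases lt_or_ge a (n - 1) with h | h
    · rcases lt_or_ge b (n - 1) with h' | h'
      · lift a to Fin (n - 1) using h
        lift b to Fin (n - 1) using h'
        simpa only [map_mul, uMk_k, uMk_kinv, uMk_e, uMk_f, Commute, SemiconjBy, uE_val, uF_val]
          using
          uMk_rel (UqRel.e_f_ne a b (fun h => hab (congrArg _ h)))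
      · simp [uF_of_le h']
    · simp [uE_of_le h]
  e_f_self := fun a h => by
    have h' : a < n - 1 := by omega
    lift a to Fin (n - 1) using h'
    have h1 := uMk_rel (UqRel.e_f_self a)
    simp only [map_mul, map_sub, map_smul] at h1
    have h2 : uK n (a + 1) = uk (hi a) := uK_val (hi a)
    have h3 : uKinv n (a + 1) = ukinv (hi a) := uKinv_val (hi a)
    have h4 : uK n a = uk (lo a) := uK_val (lo a)
    have h5 : uKinv n a = ukinv (lo a) := uKinv_val (lo a)
    rw [uE_val, uF_val, h2, h3, h4, h5]
    exact h1

theorem uE_comm {a b : ℕ} (hab : a + 1 < b) : Commute (uE n a) (uE n b) := by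
  rcases lt_or_ge b (n - 1) with h | h
  · lift a to Fin (n - 1) using by omega
    lift b to Fin (n - 1) using h
    simpa only [map_mul, uMk_k, uMk_kinv, uMk_e, uMk_f, Commute, SemiconjBy, uE_val] using
      uMk_rel (UqRel.e_comm a b hab)
  · simp [uE_of_le h]

theorem uF_comm {a b : ℕ} (hab : a + 1 < b) : Commute (uF n a) (uF n b) := by
  rcases lt_or_ge b (n - 1) with h | h
  · lift a to Fin (n - 1) using by omega
    lift b to Fin (n - 1) using h
    simpa only [map_mul, uMk_k, uMk_kinv, uMk_e, uMk_f, Commute, SemiconjBy, uF_val] using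
      uMk_rel (UqRel.f_comm a b hab)
  · simp [uF_of_le h]

theorem qSerre_uF {a b : ℕ} (hab : a + 1 = b ∨ b + 1 = a) : qSerre (uF n a) (uF n b) = 0 := by
  rcases lt_or_ge a (n - 1) with h | h
  · rcases lt_or_ge b (n - 1) with h' | h'
    · lift a to Fin (n - 1) using h
      lift b to Fin (n - 1) using h'
      simpa only [map_mul, uMk_k, uMk_kinv, uMk_e, uMk_f, Commute, SemiconjBy, map_add, map_sub,
        map_smul, map_zero, uF_val, qSerre] using
        uMk_rel (UqRel.f_serre a b hab)
    · simp [uF_of_le h', qSerre]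
  · simp [uF_of_le h, qSerre]

end Generators

/-! ### Dynamical root vectors -/

section Dynamical

variable {n : ℕ}

theorem commute_bracketH {x : Uq n} {p r : Fin n} (hp : Commute (uk p) x) (hr : Commute (uk r) x)
    (hp' : Commute (ukinv p) x) (hr' : Commute (ukinv r) x) (s : ℂ) :
    Commute (bracketH p r s) x :=
  (((hp.mul_left hr').smul_left _).sub_left ((hp'.mul_left hr).smul_left _)).smul_left _

theorem fCheckAux_succ (d i : ℕ) (h : i + (d + 1) + 1 < n) :
    fCheckAux (n := n) (d + 1) i h =
      uF n i * fCheckAux d (i + 1) (by omega) *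
          bracketH ⟨i + 1, by omega⟩ ⟨i + d + 2, by omega⟩ (d + 1) -
        fCheckAux d (i + 1) (by omega) * uF n i *
          bracketH ⟨i + 1, by omega⟩ ⟨i + d + 2, by omega⟩ d := by
  have h1 : uF n i = uf ⟨i, by omega⟩ := dif_pos _
  have h2 : rho (n := n) ⟨i + 1, by omega⟩ - rho (n := n) ⟨i + d + 2, by omega⟩ = d + 1 := by
    simp only [rho]
    push_cast
    ring
  rw [fCheckAux, h1, h2, add_sub_cancel_right]

theorem commute_uk_uF {p a : ℕ} (h1 : p ≠ a) (h2 : p ≠ a + 1) : Commute (uK n p) (uF n a) := by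
  have h := (isPreUq_uq (n := n)).k_f p a
  rwa [wtPair, if_neg h1, if_neg h2, sub_zero, neg_zero, qK_zero, one_smul] at h

theorem commute_ukinv_uF {p a : ℕ} (h1 : p ≠ a) (h2 : p ≠ a + 1) :
    Commute (uKinv n p) (uF n a) := by
  have h := (isPreUq_uq (n := n)).kinv_f p a
  rwa [wtPair, if_neg h1, if_neg h2, sub_zero, qK_zero, one_smul] at h

theorem commute_uk_uE {p a : ℕ} (h1 : p ≠ a) (h2 : p ≠ a + 1) : Commute (uK n p) (uE n a) := by
  have h := (isPreUq_uq (n := n)).k_e p a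
  rwa [wtPair, if_neg h1, if_neg h2, sub_zero, qK_zero, one_smul] at h

theorem commute_ukinv_uE {p a : ℕ} (h1 : p ≠ a) (h2 : p ≠ a + 1) :
    Commute (uKinv n p) (uE n a) := by
  have h := (isPreUq_uq (n := n)).kinv_e p a
  rwa [wtPair, if_neg h1, if_neg h2, sub_zero, neg_zero, qK_zero, one_smul] at h

theorem commute_uF_fCheckAux {l : ℕ} : ∀ (d i : ℕ) (h : i + d + 1 < n), l + 1 < i →
    Commute (fCheckAux d i h) (uF n l)
  | 0, i, h, hl => by
    have h1 := uF_val (n := n) ⟨i, by omega⟩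
    rw [fCheckAux, ← h1]
    exact (uF_comm hl).symm
  | d + 1, i, h, hl => by
    have ih := commute_uF_fCheckAux d (i + 1) (by omega) (l := l) (by omega)
    have hf : Commute (uF n i) (uF n l) := (uF_comm hl).symm
    have hb : ∀ s, Commute (bracketH (n := n) ⟨i + 1, by omega⟩ ⟨i + d + 2, by omega⟩ s)
        (uF n l) := by
      intro s
      apply commute_bracketH
      · rw [← uK_val]; exact commute_uk_uF (by simp; omega) (by simp; omega)
      · rw [← uK_val]; exact commute_uk_uF (by simp; omega) (by simp; omega)
      · rw [← uKinv_val]; exact commute_ukinv_uF (by simp; omega) (by simp; omega)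
      · rw [← uKinv_val]; exact commute_ukinv_uF (by simp; omega) (by simp; omega)
    rw [fCheckAux_succ]
    exact ((hf.mul_left ih).mul_left (hb _)).sub_left ((ih.mul_left hf).mul_left (hb _))

theorem commute_uE_fCheckAux {l : ℕ} : ∀ (d i : ℕ) (h : i + d + 1 < n), l < i →
    Commute (fCheckAux d i h) (uE n l)
  | 0, i, h, hl => by
    have h1 := uF_val (n := n) ⟨i, by omega⟩
    rw [fCheckAux, ← h1]
    exact (isPreUq_uq.e_f_ne _ _ (by simp; omega)).symm
  | d + 1, i, h, hl => by
    have ih := commute_uE_fCheckAux d (i + 1) (by omega) (l := l) (by omega)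
    have hf : Commute (uF n i) (uE n l) := (isPreUq_uq.e_f_ne _ _ (by omega)).symm
    have hb : ∀ s, Commute (bracketH (n := n) ⟨i + 1, by omega⟩ ⟨i + d + 2, by omega⟩ s)
        (uE n l) := by
      intro s
      apply commute_bracketH
      · rw [← uK_val]; exact commute_uk_uE (by simp; omega) (by simp; omega)
      · rw [← uK_val]; exact commute_uk_uE (by simp; omega) (by simp; omega)
      · rw [← uKinv_val]; exact commute_ukinv_uE (by simp; omega) (by simp; omega)
      · rw [← uKinv_val]; exact commute_ukinv_uE (by simp; omega) (by simp; omega)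
    rw [fCheckAux_succ]
    exact ((hf.mul_left ih).mul_left (hb _)).sub_left ((ih.mul_left hf).mul_left (hb _))

/-- The dynamical root vector of `ε_i - ε_j` lowers weights by `ε_i - ε_j`. -/
theorem uK_mul_fCheckAux (l : ℕ) : ∀ (d i : ℕ) (h : i + d + 1 < n),
    uK n l * fCheckAux d i h =
      qK ((if l = i + d + 1 then 1 else 0) - (if l = i then 1 else 0)) •
        (fCheckAux d i h * uK n l)
  | 0, i, h => by
    have h1 := uF_val (n := n) ⟨i, by omega⟩
    rw [fCheckAux, ← h1, isPreUq_uq.k_f, wtPair, neg_sub, add_zero]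
  | d + 1, i, h => by
    have ih := uK_mul_fCheckAux l d (i + 1) (by omega)
    have hf := isPreUq_uq.k_f (n := n) l i
    have hb : ∀ s, Commute (bracketH (n := n) ⟨i + 1, by omega⟩ ⟨i + d + 2, by omega⟩ s)
        (uK n l) := by
      intro s
      apply commute_bracketH
      · rw [← uK_val]; exact isPreUq_uq.k_comm _ _
      · rw [← uK_val]; exact isPreUq_uq.k_comm _ _
      · rw [← uKinv_val]; exact (isPreUq_uq.commute_k_kinv _ _).symm
      · rw [← uKinv_val]; exact (isPreUq_uq.commute_k_kinv _ _).symm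
    rw [fCheckAux_succ, mul_sub, sub_mul, smul_sub, mul_assoc _ _ (uK n l), (hb _).eq,
      mul_assoc _ _ (uK n l), (hb _).eq]
    simp only [← mul_assoc]
    rw [hf, ih, smul_mul_assoc, smul_mul_assoc, smul_mul_assoc, smul_mul_assoc,
      mul_assoc (uF n i), ih, mul_assoc _ (uK n l), hf]
    simp only [mul_smul_comm, smul_mul_assoc, smul_smul, ← qK_add, mul_assoc, wtPair]
    congr 3 <;> ring_nf

end Dynamical

/-! ### Singularity of the dynamical root vectors -/

section Singular

variable {n : ℕ} {μ : Weight n}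

instance : Module Kh (Verma μ) := Module.compHom (Verma μ) (algebraMap Kh (Uq n))

instance : IsScalarTower Kh (Uq n) (Verma μ) := IsScalarTower.of_algebraMap_smul fun _ _ => rfl

instance : IsScalarTower Rh Kh (Verma μ) :=
  IsScalarTower.of_algebraMap_smul fun _ _ => rfl

theorem uq_smul_comm (u : Uq n) (c : Kh) (x : Verma μ) : u • c • x = c • u • x := by
  rw [← smul_one_smul (Uq n) c x, ← smul_one_smul (Uq n) c (u • x), smul_smul, smul_smul,
    mul_smul_comm, mul_one, smul_mul_assoc, one_mul]

/-- `(y - y⁻¹) / (q - q⁻¹)` in `ℂ((ħ))`. -/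
def qBracket (y : Kh) : Kh := qDeltaK⁻¹ * (y - y⁻¹)

theorem qBracket_mul_sub {a b q : Kh} (ha : a ≠ 0) (hb : b ≠ 0) (hq : q = qK 1) :
    qBracket a * qBracket b - qBracket (q⁻¹ * a) * qBracket (q⁻¹ * b) =
      qBracket (q⁻¹ * (a * b)) := by
  subst hq
  have hd := qDeltaK_ne_zero
  have hq := qK_ne_zero 1
  simp only [qBracket]
  rw [qDeltaK_eq] at *
  generalize qK 1 = q at *
  have hq2 : q ^ 2 - 1 ≠ 0 := by
    intro h
    apply hd
    field_simp
    rw [h, mul_zero]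
  field_simp
  ring

/-- A vector of weight `χ`, where `χ i` is the eigenvalue of `q^{h_{ε_i}}`. -/
def HasWt (χ : ℕ → Kh) (u : Verma μ) : Prop := ∀ i, uK n i • u = χ i • u

theorem HasWt.kinv {χ : ℕ → Kh} {u : Verma μ} (hu : HasWt χ u) (hχ : ∀ i, χ i ≠ 0) (i : ℕ) :
    uKinv n i • u = (χ i)⁻¹ • u := by
  rw [eq_inv_smul_iff₀ (hχ i), ← uq_smul_comm, ← hu i, smul_smul, isPreUq_uq.kinv_k, one_smul]

theorem HasWt.bracketH {χ : ℕ → Kh} {u : Verma μ} (hu : HasWt χ u) (hχ : ∀ i, χ i ≠ 0)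
    (p r : Fin n) (s : ℂ) :
    bracketH p r s • u = qBracket (qK s * (χ p * (χ r)⁻¹)) • u := by
  rw [QuantumGL.bracketH, smul_assoc, sub_smul, smul_assoc, smul_assoc, mul_smul, mul_smul,
    ← uK_val, ← uK_val,
    ← uKinv_val, ← uKinv_val, hu.kinv hχ, hu, uq_smul_comm, uq_smul_comm, hu, hu.kinv hχ,
    smul_smul, smul_smul, smul_smul, smul_smul, ← sub_smul, smul_smul, qBracket, qK_neg]
  congr 2
  have := qK_ne_zero s
  have := hχ p
  have := hχ r
  field_simp

/-- The weight lowered by the simple root `α_a`. -/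
def lowerWt (χ : ℕ → Kh) (a : ℕ) : ℕ → Kh := fun i => qK (-wtPair i a) * χ i

theorem lowerWt_ne_zero {χ : ℕ → Kh} (hχ : ∀ i, χ i ≠ 0) (a i : ℕ) : lowerWt χ a i ≠ 0 :=
  mul_ne_zero (qK_ne_zero _) (hχ i)

theorem HasWt.uF {χ : ℕ → Kh} {u : Verma μ} (hu : HasWt χ u) (a : ℕ) :
    HasWt (lowerWt χ a) (uF n a • u) := by
  intro i
  rw [smul_smul, isPreUq_uq.k_f, smul_assoc, mul_smul, hu i, uq_smul_comm, smul_smul, lowerWt]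

theorem HasWt.fCheckAux_succ {χ : ℕ → Kh} {u : Verma μ} (hu : HasWt χ u) (hχ : ∀ i, χ i ≠ 0)
    (d i : ℕ) (h : i + (d + 1) + 1 < n) :
    fCheckAux (n := n) (d + 1) i h • u =
      qBracket (qK (d + 1) * (χ (i + 1) * (χ (i + d + 2))⁻¹)) •
          (QuantumGL.uF n i • fCheckAux (n := n) d (i + 1) (by omega) • u) -
      qBracket (qK d * (χ (i + 1) * (χ (i + d + 2))⁻¹)) •
          (fCheckAux (n := n) d (i + 1) (by omega) • QuantumGL.uF n i • u) := by
  rw [QuantumGL.fCheckAux_succ, sub_smul, mul_smul _ (QuantumGL.bracketH _ _ _),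
    mul_smul _ (QuantumGL.bracketH _ _ _), hu.bracketH hχ, hu.bracketH hχ,
    uq_smul_comm, uq_smul_comm, mul_smul, mul_smul]

theorem uE_uF_self_smul {χ : ℕ → Kh} {u : Verma μ} (hu : HasWt χ u) (hχ : ∀ i, χ i ≠ 0) {a : ℕ}
    (ha : a + 1 < n) :
    uE n a • uF n a • u = uF n a • uE n a • u + qBracket (χ a * (χ (a + 1))⁻¹) • u := by
  have h := congrArg (· • u) (isPreUq_uq.e_f_self a ha)
  simp only [sub_smul, mul_smul, smul_assoc, hu.kinv hχ, hu a, hu (a + 1), uq_smul_comm] at h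
  rw [← sub_eq_iff_eq_add', h, qBracket]
  simp only [smul_smul, ← sub_smul]
  congr 2
  rw [mul_inv, inv_inv]
  ring

theorem HasWt.fCheckAux {χ : ℕ → Kh} {u : Verma μ} (hu : HasWt χ u) (d i : ℕ)
    (h : i + d + 1 < n) :
    HasWt (fun l => qK ((if l = i + d + 1 then 1 else 0) - (if l = i then 1 else 0)) * χ l)
      (fCheckAux (n := n) d i h • u) := by
  intro l
  rw [smul_smul, uK_mul_fCheckAux, smul_assoc, mul_smul, hu l, uq_smul_comm, smul_smul]

/-- `e_a` annihilates `f̌_{ε_i - ε_j} u` for `a ≠ i`, and maps it to a multiple of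
`f̌_{ε_{i+1} - ε_j} u` for `a = i`, the multiple being `[(μ + ρ, ε_i - ε_j) - 1]`. -/
theorem uE_fCheckAux (d : ℕ) : ∀ (i : ℕ) (h : i + d + 1 < n) (χ : ℕ → Kh) (_ : ∀ i, χ i ≠ 0)
    (u : Verma μ) (_ : HasWt χ u) (_ : ∀ a, i ≤ a → a ≤ i + d → uE n a • u = 0),
    (∀ a, a ≠ i → uE n a • u = 0 → uE n a • fCheckAux (n := n) d i h • u = 0) ∧
    ∃ y : Verma μ, uE n i • fCheckAux (n := n) d i h • u =
        qBracket (qK d * (χ i * (χ (i + d + 1))⁻¹)) • y ∧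
      (d = 0 → y = u) ∧
      ∀ d' (hd : d = d' + 1), y = fCheckAux (n := n) d' (i + 1) (by omega) • u := by
  induction d with
  | zero =>
    intro i h χ hχ u hu hs
    have h1 : fCheckAux (n := n) 0 i h = uF n i := by
      rw [fCheckAux]
      exact (uF_val (n := n) ⟨i, by omega⟩).symm
    refine ⟨fun a ha hau => ?_, u, ?_, fun _ => rfl, fun d' hd => by omega⟩
    · rw [h1, smul_smul, isPreUq_uq.e_f_ne a i ha, mul_smul, hau, smul_zero]
    · rw [h1, uE_uF_self_smul hu hχ (by omega), hs i le_rfl le_rfl, smul_zero, zero_add,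
        Nat.cast_zero, qK_zero, one_mul, add_zero]
  | succ d ih =>
    intro i h χ hχ u hu hs
    have hfu := hu.uF i
    have hχ' := lowerWt_ne_zero hχ i
    have hs' : ∀ a, a ≠ i → uE n a • u = 0 → uE n a • uF n i • u = 0 := fun a ha hau => by
      rw [smul_smul, isPreUq_uq.e_f_ne a i ha, mul_smul, hau, smul_zero]
    obtain ⟨A1, y1, B1, C1, D1⟩ := ih (i + 1) (by omega) χ hχ u hu
      fun a h1 h2 => hs a (by omega) (by omega)
    obtain ⟨A2, y2, B2, C2, D2⟩ := ih (i + 1) (by omega) _ hχ' _ hfu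
      fun a h1 h2 => hs' a (by omega) (hs a (by omega) (by omega))
    have hy : uF n i • y1 = y2 := by
      rcases d with _ | d
      · rw [C1 rfl, C2 rfl]
      · rw [D1 d rfl, D2 d rfl, smul_smul, smul_smul,
          (commute_uF_fCheckAux d (i + 1 + 1) (by omega) (by omega)).eq]
    rw [hu.fCheckAux_succ hχ]
    have hi2 : i + 1 + d + 1 = i + d + 2 := by omega
    refine ⟨fun a ha hau => ?_, QuantumGL.fCheckAux (n := n) d (i + 1) (by omega) • u, ?_,
      fun h => by omega, fun d' hd => by simp only [add_left_inj] at hd; subst hd; rfl⟩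
    · rw [smul_sub, uq_smul_comm, uq_smul_comm]
      rcases eq_or_ne a (i + 1) with rfl | ha'
      · -- both terms are multiples of `f_i f̌_{ε_{i+2} - ε_j} u`, with equal coefficients
        have hcoeff : lowerWt χ i (i + 1) * (lowerWt χ i (i + 1 + d + 1))⁻¹ =
            qK 1 * (χ (i + 1) * (χ (i + d + 2))⁻¹) := by
          rw [lowerWt, lowerWt, wtPair, wtPair, if_neg (by omega), if_pos rfl, if_neg (by omega),
            if_neg (by omega), hi2]
          simp only [zero_sub, neg_neg, sub_zero, neg_zero, qK_zero, one_mul, mul_assoc]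
        rw [smul_smul (QuantumGL.uE n (i + 1)), isPreUq_uq.e_f_ne (i + 1) i (by omega), mul_smul,
          B1, B2, uq_smul_comm, hy, smul_smul, smul_smul, sub_eq_zero, hcoeff, hi2,
          ← mul_assoc (qK d) (qK 1), ← qK_add, mul_comm (qBracket _)]
      · rw [smul_smul (uE n a), isPreUq_uq.e_f_ne a i ha, mul_smul, A1 a ha' hau,
          A2 a ha' (hs' a ha hau), smul_zero, smul_zero, smul_zero, sub_zero]
    · have hw := hu.fCheckAux d (i + 1) (by omega)
      have hew : uE n i • QuantumGL.fCheckAux (n := n) d (i + 1) (by omega) • u = 0 := by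
        rw [smul_smul, ← (commute_uE_fCheckAux d (i + 1) (by omega) (l := i) (by omega)).eq,
          mul_smul, hs i le_rfl (by omega), smul_zero]
      have hcomm : uE n i • QuantumGL.fCheckAux (n := n) d (i + 1) (by omega) • uF n i • u =
          qBracket (χ i * (χ (i + 1))⁻¹) •
            QuantumGL.fCheckAux (n := n) d (i + 1) (by omega) • u := by
        rw [smul_smul, ← (commute_uE_fCheckAux d (i + 1) (by omega) (l := i) (by omega)).eq,
          mul_smul, uE_uF_self_smul hu hχ (by omega), hs i le_rfl (by omega), smul_zero, zero_add,
          uq_smul_comm]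
      rw [smul_sub, uq_smul_comm, uq_smul_comm, hcomm,
        uE_uF_self_smul hw (fun l => mul_ne_zero (qK_ne_zero _) (hχ l)) (by omega), hew, smul_zero,
        zero_add, if_neg (by omega), if_neg (by omega), if_neg (by omega), if_pos rfl, smul_smul,
        smul_smul, ← sub_smul]
      congr 1
      have hq := qK_ne_zero 1
      have hi1 := hχ (i + 1)
      have h1 := qBracket_mul_sub (q := qK 1) (a := qK 1 * (χ i * (χ (i + 1))⁻¹))
        (b := qK (d + 1) * (χ (i + 1) * (χ (i + d + 2))⁻¹))
        (mul_ne_zero hq (mul_ne_zero (hχ _) (inv_ne_zero hi1)))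
        (mul_ne_zero (qK_ne_zero _) (mul_ne_zero hi1 (inv_ne_zero (hχ _)))) rfl
      have hc : qK (d + 1) = qK 1 * qK d := by rw [← qK_add, add_comm]
      rw [Nat.cast_succ, show i + (d + 1) + 1 = i + d + 2 by omega]
      rw [hc] at h1 ⊢
      simp only [sub_zero, qK_zero, one_mul, zero_sub, qK_neg, mul_inv, inv_inv]
      rw [inv_mul_cancel_left₀ hq, mul_assoc (qK 1) (qK d), inv_mul_cancel_left₀ hq,
        mul_assoc (qK 1), inv_mul_cancel_left₀ hq] at h1
      have e1 : χ i * (χ (i + 1))⁻¹ * (qK 1 * (qK d * (χ (i + 1) * (χ (i + d + 2))⁻¹))) =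
          qK 1 * qK d * (χ i * (χ (i + d + 2))⁻¹) := by
        have := hχ (i + d + 2)
        field_simp
      rw [← e1, ← h1, mul_assoc (qK 1) (qK d), mul_left_comm (χ i) (qK 1),
        mul_comm (qBracket (qK 1 * (qK d * _))), mul_comm (qBracket (qK d * _))]

section NonZero

variable {Φ : Verma μ →+ (ℕ → Kh)} (hf : ∀ (a : Fin (n - 1)) x, Φ (uf a • x) = colShift a (Φ x))
  (hc : ∀ (c : Kh) x, Φ (c • x) = c • Φ x)

include hf in
theorem map_uF_smul {a : ℕ} (ha : a + 1 < n) (x : Verma μ) :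
    Φ (uF n a • x) = colShift a (Φ x) := by
  rw [← hf ⟨a, by omega⟩, ← uF_val]

include hf hc in
theorem map_fCheckAux_apply_eq_zero (d : ℕ) : ∀ (i : ℕ) (h : i + d + 1 < n) (χ : ℕ → Kh)
    (_ : ∀ i, χ i ≠ 0) (u : Verma μ) (_ : HasWt χ u) (m : ℕ), m ≤ i →
    Φ (fCheckAux (n := n) d i h • u) m = 0 := by
  have hcol : ∀ i g, ∀ m ≤ i, colShift i g m = 0 := fun i g m hm => by
    simp [colShift, show m ≠ i + 1 by omega]
  induction d with
  | zero =>
    intro i h χ hχ u hu m hm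
    rw [fCheckAux, hf]
    exact hcol i _ m hm
  | succ d ih =>
    intro i h χ hχ u hu m hm
    rw [hu.fCheckAux_succ hχ, map_sub, hc, hc, map_uF_smul hf (by omega), Pi.sub_apply,
      Pi.smul_apply, Pi.smul_apply, hcol i _ m hm,
      ih (i + 1) (by omega) _ (lowerWt_ne_zero hχ i) _ (hu.uF i) m (by omega), smul_zero,
      smul_zero, sub_zero]

include hf hc in
theorem map_fCheckAux_eq (d : ℕ) : ∀ (i : ℕ) (h : i + d + 1 < n) (χ : ℕ → Kh)
    (_ : ∀ i, χ i ≠ 0) (u : Verma μ) (_ : HasWt χ u) (_ : Φ u = Pi.single i 1)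
    (_ : ∀ p, i < p → p < i + d + 1 → ∀ s : ℕ,
      qBracket (qK s * (χ p * (χ (i + d + 1))⁻¹)) ≠ 0),
    ∃ c : Kh, c ≠ 0 ∧ Φ (fCheckAux (n := n) d i h • u) = Pi.single (i + d + 1) c := by
  have hcol : ∀ i, colShift i (Pi.single i (1 : Kh)) = Pi.single (i + 1) 1 := fun i => by
    simp [colShift]
  induction d with
  | zero =>
    intro i h χ hχ u hu hΦ H
    refine ⟨1, one_ne_zero, ?_⟩
    rw [fCheckAux, hf, hΦ, hcol, add_zero]
  | succ d ih =>
    intro i h χ hχ u hu hΦ H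
    have hlow : ∀ p, i + 1 < p → lowerWt χ i p = χ p := fun p hp => by
      rw [lowerWt, wtPair, if_neg (by omega), if_neg (by omega), sub_zero, neg_zero, qK_zero,
        one_mul]
    have hi2 : i + 1 + d + 1 = i + d + 2 := by omega
    obtain ⟨c, hc0, hc1⟩ := ih (i + 1) (by omega) _ (lowerWt_ne_zero hχ i) _ (hu.uF i)
      (by rw [map_uF_smul hf (by omega), hΦ, hcol]) (fun p h1 h2 s => by
        rw [hlow p (by omega), hlow _ (by omega), show i + 1 + d + 1 = i + (d + 1) + 1 by omega]
        exact H p (by omega) (by omega) s)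
    refine ⟨-(qBracket (qK d * (χ (i + 1) * (χ (i + d + 2))⁻¹)) * c),
      neg_ne_zero.2 (mul_ne_zero (H (i + 1) (by omega) (by omega) d) hc0), ?_⟩
    have h0 : colShift i (Φ (fCheckAux (n := n) d (i + 1) (by omega) • u)) = 0 := by
      have h1 := map_fCheckAux_apply_eq_zero hf hc d (i + 1) (by omega) χ hχ u hu i (by omega)
      simp [colShift, h1]
    rw [hu.fCheckAux_succ hχ, map_sub, hc, hc, map_uF_smul hf (by omega), h0, hc1, smul_zero,
      zero_sub, Pi.single_neg, ← smul_eq_mul (a := qBracket _) (b := c), Pi.single_smul, hi2,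
      show i + (d + 1) + 1 = i + d + 2 by omega]

end NonZero

/-- The eigenvalues of the `q^{h_{ε_i}}` on the highest weight vector, set to `1` out of range. -/
def Weight.qN (μ : Weight n) (i : ℕ) : Rh := if h : i < n then μ.q ⟨i, h⟩ else 1

theorem Weight.qN_val (μ : Weight n) (i : Fin n) : μ.qN i = μ.q i := by simp [Weight.qN]

theorem Weight.qN_ne_zero (μ : Weight n) (i : ℕ) : algebraMap Rh Kh (μ.qN i) ≠ 0 := by
  by_cases h : i < n
  · simpa [Weight.qN, h] using weightQ_ne_zero μ ⟨i, h⟩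
  · simp [Weight.qN, h]

theorem hasWt_vermaVec (μ : Weight n) :
    HasWt (fun i => algebraMap Rh Kh (μ.qN i)) (vermaVec μ) := by
  intro i
  rcases lt_or_ge i n with h | h
  · lift i to Fin n using h
    change uK n i • vermaVec μ = algebraMap Rh Kh (μ.qN i) • vermaVec μ
    rw [uK_val, Weight.qN_val, algebraMap_smul, ← algebraMap_smul (Uq n) (μ.q i), ← sub_eq_zero,
      ← sub_smul]
    refine (Submodule.Quotient.mk_eq_zero (vermaIdeal μ)).2 ?_
    change (uk i - algebraMap Rh (Uq n) (μ.q i)) * 1 ∈ _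
    rw [mul_one]
    exact Submodule.subset_span (Or.inr ⟨i, rfl⟩)
  · simp [uK_of_le h, Weight.qN, h.not_gt]

theorem uE_vermaVec (μ : Weight n) (a : ℕ) : uE n a • vermaVec μ = 0 := by
  rcases lt_or_ge a (n - 1) with h | h
  · lift a to Fin (n - 1) using h
    rw [uE_val]
    refine (Submodule.Quotient.mk_eq_zero (vermaIdeal μ)).2 ?_
    change ue a * 1 ∈ _
    rw [mul_one]
    exact Submodule.subset_span (Or.inl ⟨a, rfl⟩)
  · rw [uE_of_le h, zero_smul]

theorem uE_fCheckAux_vermaVec (d i : ℕ) (h : i + d + 1 < n)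
    (h1 : qK d * (algebraMap Rh Kh (μ.qN i) * (algebraMap Rh Kh (μ.qN (i + d + 1)))⁻¹) = 1)
    (a : ℕ) : uE n a • fCheckAux (n := n) d i h • vermaVec μ = 0 := by
  obtain ⟨A, y, B, -, -⟩ := uE_fCheckAux d i h _ μ.qN_ne_zero _ (hasWt_vermaVec μ)
    (fun a _ _ => uE_vermaVec μ a)
  rcases eq_or_ne a i with rfl | ha
  · rw [B, h1, qBracket, inv_one, sub_self, mul_zero, zero_smul]
  · exact A a ha (uE_vermaVec μ a)

/-- The vector `f̌_γ v_μ` is singular if `(μ + ρ, γ) = 1` and if the numbers `q^{(μ, ε_p - ε_j)}`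
are generic for `p` between `i` and `j`, where `γ = ε_i - ε_j`. -/
theorem isSingular_fCheckAux (d i : ℕ) (h : i + d + 1 < n)
    (h1 : qK d * (algebraMap Rh Kh (μ.qN i) * (algebraMap Rh Kh (μ.qN (i + d + 1)))⁻¹) = 1)
    (H : ∀ p, i < p → p < i + d + 1 → ∀ s : ℕ,
      qBracket (qK s * (algebraMap Rh Kh (μ.qN p) *
        (algebraMap Rh Kh (μ.qN (i + d + 1)))⁻¹)) ≠ 0) :
    IsSingular (fCheckAux (n := n) d i h • vermaVec μ) := by
  refine ⟨fun h0 => ?_, fun a => ?_⟩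
  · obtain ⟨Φ, hv, hf, hc⟩ := exists_vermaVec_map μ i
    obtain ⟨c, hc0, hc1⟩ := map_fCheckAux_eq hf hc d i h _ μ.qN_ne_zero _ (hasWt_vermaVec μ) hv H
    rw [h0, map_zero] at hc1
    exact hc0 (by simpa using (congrFun hc1 (i + d + 1)).symm)
  · rw [← uE_val]
    exact uE_fCheckAux_vermaVec d i h h1 a

end Singular

/-! ### Root vectors from the Serre relations -/

section LieRoot

variable {L : Type*} [LieRing L]

/-- The iterated commutator of `f_{a+d}, …, f_a`, a root vector for the root `ε_a - ε_{a+d+1}`. -/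
def lieRoot (f : ℕ → L) : ℕ → ℕ → L
  | 0, a => f a
  | d + 1, a => ⁅lieRoot f d (a + 1), f a⁆

/-- The Serre relations of type `A`. -/
structure IsSerre (f : ℕ → L) : Prop where
  comm : ∀ a b, a + 1 < b → ⁅f a, f b⁆ = 0
  left : ∀ a, ⁅f a, ⁅f a, f (a + 1)⁆⁆ = 0
  right : ∀ a, ⁅f (a + 1), ⁅f (a + 1), f a⁆⁆ = 0

theorem lie_lie_eq_zero {x y z : L} (h1 : ⁅x, z⁆ = 0) (h2 : ⁅y, z⁆ = 0) : ⁅⁅x, y⁆, z⁆ = 0 := by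
  rw [lie_lie, h1, h2, lie_zero, lie_zero, sub_zero]

namespace IsSerre

variable {f : ℕ → L}

theorem comm' (h : IsSerre f) {a b : ℕ} (hab : b + 1 < a) : ⁅f a, f b⁆ = 0 := by
  rw [← lie_skew, h.comm b a hab, neg_zero]

theorem lieRoot_lie_eq_zero {z : L} : ∀ (d a : ℕ), (∀ k, a ≤ k → k ≤ a + d → ⁅f k, z⁆ = 0) →
    ⁅lieRoot f d a, z⁆ = 0
  | 0, a, hz => hz a le_rfl le_rfl
  | d + 1, a, hz => lie_lie_eq_zero
      (lieRoot_lie_eq_zero d (a + 1) fun k h1 h2 => hz k (by omega) (by omega))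
      (hz a le_rfl (by omega))

/-- A root vector is the commutator of the root vectors of two adjacent shorter roots. -/
theorem lieRoot_split (h : IsSerre f) (e : ℕ) : ∀ d a : ℕ,
    ⁅lieRoot f e (a + d + 1), lieRoot f d a⁆ = lieRoot f (e + d + 1) a
  | 0, a => rfl
  | d + 1, a => by
    have h1 : ⁅lieRoot f e (a + (d + 1) + 1), f a⁆ = 0 :=
      lieRoot_lie_eq_zero e _ fun k h1 h2 => h.comm' (by omega)
    have h2 := lieRoot_split h e d (a + 1)
    rw [show a + 1 + d + 1 = a + (d + 1) + 1 by omega] at h2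
    rw [show e + (d + 1) + 1 = (e + d + 1) + 1 by omega, lieRoot, lieRoot, ← h2, lie_lie, h1,
      lie_zero, sub_zero]

theorem lieRoot_lie_first (h : IsSerre f) (d a : ℕ) : ⁅lieRoot f (d + 1) a, f a⁆ = 0 := by
  have h1 : ∀ a, ⁅lieRoot f 1 a, f a⁆ = 0 := fun a => by
    rw [lieRoot, lieRoot, ← lie_skew, ← lie_skew (f (a + 1)), lie_neg, h.left, neg_zero, neg_zero]
  rcases d with _ | d
  · exact h1 a
  · rw [← h.lieRoot_split d 1 a]
    exact lie_lie_eq_zero (lieRoot_lie_eq_zero d _ fun k h1 h2 => h.comm' (by omega)) (h1 a)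

theorem lieRoot_lie_last (h : IsSerre f) (d a : ℕ) :
    ⁅lieRoot f (d + 1) a, f (a + d + 1)⁆ = 0 := by
  have h1 : ∀ a, ⁅lieRoot f 1 a, f (a + 1)⁆ = 0 := fun a => by
    rw [lieRoot, lieRoot, ← lie_skew, h.right, neg_zero]
  rcases d with _ | d
  · exact h1 a
  · rw [show d + 1 + 1 = 1 + d + 1 by omega, ← h.lieRoot_split 1 d a]
    exact lie_lie_eq_zero (h1 _) (lieRoot_lie_eq_zero d a fun k h1 h2 => h.comm _ _ (by omega))

/-- The two ways of splitting the root vector of a sum of three adjacent simple roots show that its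
commutator with the middle simple root vector is equal to its own opposite. -/
theorem lieRoot_two_lie (h : IsSerre f) (h2 : ∀ x : L, x = -x → x = 0) (a : ℕ) :
    ⁅lieRoot f 2 a, f (a + 1)⁆ = 0 := by
  apply h2
  have e1 : lieRoot f 2 a = ⁅lieRoot f 1 (a + 1), f a⁆ := rfl
  have e2 : ⁅f (a + 2), lieRoot f 1 a⁆ = lieRoot f 2 a := h.lieRoot_split 0 1 a
  have z1 := h.lieRoot_lie_first 0 (a + 1)
  have z2 := h.lieRoot_lie_last 0 a
  have d1 : ⁅f (a + 2), f (a + 1)⁆ = lieRoot f 1 (a + 1) := rfl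
  have d2 : ⁅f a, f (a + 1)⁆ = -lieRoot f 1 a := by rw [← lie_skew]; rfl
  have c1 : ⁅lieRoot f 2 a, f (a + 1)⁆ = -⁅lieRoot f 1 (a + 1), lieRoot f 1 a⁆ := by
    rw [e1, lie_lie, z1, lie_zero, sub_zero, d2, lie_neg]
  have c2 : ⁅lieRoot f 2 a, f (a + 1)⁆ = ⁅lieRoot f 1 (a + 1), lieRoot f 1 a⁆ := by
    rw [← e2, lie_lie, z2, lie_zero, zero_sub, d1, lie_skew]
  rw [c2, ← c1, c2]

theorem lieRoot_lie_mid (h : IsSerre f) (h2 : ∀ x : L, x = -x → x = 0) {d a k : ℕ} (h3 : a < k)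
    (h4 : k < a + d) : ⁅lieRoot f d a, f k⁆ = 0 := by
  have key : ∀ e a, ⁅lieRoot f (e + 2) a, f (a + 1)⁆ = 0 := by
    intro e a
    rcases e with _ | e
    · exact h.lieRoot_two_lie h2 a
    · rw [show e + 1 + 2 = e + 2 + 1 by omega, ← h.lieRoot_split e 2 a]
      exact lie_lie_eq_zero (lieRoot_lie_eq_zero e _ fun k h1 h2 => h.comm' (by omega))
        (h.lieRoot_two_lie h2 a)
  obtain ⟨m, rfl⟩ : ∃ m, k = a + m + 1 := ⟨k - a - 1, by omega⟩
  rcases m with _ | m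
  · obtain ⟨e, rfl⟩ : ∃ e, d = e + 2 := ⟨d - 2, by omega⟩
    exact key e a
  · obtain ⟨e, rfl⟩ : ∃ e, d = (e + 2) + m + 1 := ⟨d - m - 3, by omega⟩
    rw [← h.lieRoot_split (e + 2) m a]
    exact lie_lie_eq_zero (key e (a + m + 1))
      (lieRoot_lie_eq_zero m a fun k h1 h2 => h.comm _ _ (by omega))

/-- The additive subgroup generated by the root vectors. -/
def rootSpan (f : ℕ → L) (n : ℕ) : AddSubgroup L :=
  AddSubgroup.closure {x | ∃ d a, a + d + 1 < n ∧ x = lieRoot f d a}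

theorem lieRoot_mem_rootSpan {n d a : ℕ} (h : a + d + 1 < n) : lieRoot f d a ∈ rootSpan f n :=
  AddSubgroup.subset_closure ⟨d, a, h, rfl⟩

theorem lie_f_mem_rootSpan (h : IsSerre f) (h2 : ∀ x : L, x = -x → x = 0) {n k : ℕ}
    (hk : k + 1 < n) {x : L} (hx : x ∈ rootSpan f n) : ⁅x, f k⁆ ∈ rootSpan f n := by
  induction hx using AddSubgroup.closure_induction with
  | zero => rw [zero_lie]; exact zero_mem _
  | add x y _ _ hx hy => rw [add_lie]; exact add_mem hx hy
  | neg x _ hx => rw [neg_lie]; exact neg_mem hx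
  | mem x hx =>
    obtain ⟨d, a, hda, rfl⟩ := hx
    rcases lt_trichotomy (k + 1) a with h1 | h1 | h1
    · rw [lieRoot_lie_eq_zero d a fun l hl _ => h.comm' (by omega)]
      exact zero_mem _
    · subst h1
      exact lieRoot_mem_rootSpan (d := d + 1) (a := k) (by omega)
    · rcases lt_trichotomy k (a + d + 1) with h3 | h3 | h3
      · have h0 : ⁅lieRoot f d a, f k⁆ = 0 := by
          rcases d with _ | d
          · obtain rfl : k = a := by omega
            exact lie_self _
          · rcases eq_or_ne k a with rfl | hka
            · exact h.lieRoot_lie_first d k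
            · rcases eq_or_ne k (a + d + 1) with rfl | hka'
              · exact h.lieRoot_lie_last d a
              · exact h.lieRoot_lie_mid h2 (by omega) (by omega)
        rw [h0]
        exact zero_mem _
      · subst h3
        rw [← lie_skew]
        have h4 := h.lieRoot_split 0 d a
        rw [lieRoot] at h4
        rw [h4, zero_add]
        exact neg_mem (lieRoot_mem_rootSpan (by omega))
      · rw [lieRoot_lie_eq_zero d a fun l _ hl => h.comm _ _ (by omega)]
        exact zero_mem _

theorem lie_mem_rootSpan (h : IsSerre f) (h2 : ∀ x : L, x = -x → x = 0) {n : ℕ} (d : ℕ) :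
    ∀ a, a + d + 1 < n → ∀ x ∈ rootSpan f n, ⁅x, lieRoot f d a⁆ ∈ rootSpan f n := by
  induction d with
  | zero => exact fun a ha x hx => h.lie_f_mem_rootSpan h2 ha hx
  | succ d ih =>
    intro a ha x hx
    rw [lieRoot, leibniz_lie]
    refine add_mem (h.lie_f_mem_rootSpan h2 (by omega) (ih _ (by omega) x hx)) ?_
    rw [← lie_skew]
    exact neg_mem (ih _ (by omega) _ (h.lie_f_mem_rootSpan h2 (by omega) hx))

end IsSerre

end LieRoot

/-! ### Separation of vectors by the upper triangular operators -/

section Separation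

attribute [local instance] LieRing.ofAssociativeRing

variable {R V : Type*} [CommRing R] [AddCommGroup V] [Module R V]

/-- The pairs `a < b < n`, which stand for the positive roots `ε_a - ε_b`. -/
def posPairs (n : ℕ) : Finset (ℕ × ℕ) :=
  (Finset.range n ×ˢ Finset.range n).filter fun p => p.1 < p.2

theorem mem_posPairs {n : ℕ} {p : ℕ × ℕ} : p ∈ posPairs n ↔ p.1 < p.2 ∧ p.2 < n := by
  simp only [posPairs, Finset.mem_filter, Finset.mem_product, Finset.mem_range]
  omega

/-- The root vector of `ε_a - ε_b`. -/
def pairRoot {L : Type*} [LieRing L] (f : ℕ → L) (p : ℕ × ℕ) : L := lieRoot f (p.2 - p.1 - 1) p.1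

/-- The semiclassical situation: operators `f_k` that satisfy the Serre relations, and an upper
triangular matrix `G` of operators with scalar diagonal `s` on which the `f_k` act by infinitesimal
conjugation, together with a cyclic vector that is annihilated by the strictly upper triangular
part of `G`. -/
structure IsConjAction (n : ℕ) (f : ℕ → Module.End R V) (G : ℕ → ℕ → Module.End R V) (s : ℕ → R)
    (v : V) : Prop where
  serre : IsSerre f
  two : ∀ x : Module.End R V, x = -x → x = 0
  lie_f : ∀ i j k, k + 1 < n → ⁅G i j, f k⁆ =
    (if j = k + 1 then G i k else 0) - (if i = k then G (k + 1) j else 0)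
  diag : ∀ i, G i i = s i • 1
  lower : ∀ i j, j < i → G i j = 0
  vec : ∀ i j, i < j → G i j v = 0
  cyclic : ∀ S : Submodule R V, v ∈ S → (∀ k, k + 1 < n → ∀ x ∈ S, f k x ∈ S) → S = ⊤

namespace IsConjAction

variable {n : ℕ} {f : ℕ → Module.End R V} {G : ℕ → ℕ → Module.End R V} {s : ℕ → R} {v : V}

theorem lie_lieRoot (h : IsConjAction n f G s v) (d : ℕ) : ∀ a i j, a + d + 1 < n →
    ⁅G i j, lieRoot f d a⁆ =
      (if j = a + d + 1 then G i a else 0) - (if i = a then G (a + d + 1) j else 0) := by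
  induction d with
  | zero => exact fun a i j ha => h.lie_f i j a ha
  | succ d ih =>
    intro a i j ha
    have e1 : a + 1 + d + 1 = a + (d + 1) + 1 := by omega
    rw [lieRoot, leibniz_lie, ← lie_skew _ ⁅G i j, f a⁆, ih (a + 1) i j (by omega),
      h.lie_f i j a (by omega), e1]
    set b := a + (d + 1) + 1 with hb
    have hab : a + 1 < b := by omega
    have k1 : ∀ i, ⁅G i (a + 1), f a⁆ = G i a - if i = a then G (a + 1) (a + 1) else 0 :=
      fun i => by rw [h.lie_f i _ a (by omega), if_pos rfl]
    have k2 : ⁅G b j, f a⁆ = 0 := by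
      rw [h.lie_f b j a (by omega), if_neg (show b ≠ a by omega), sub_zero]
      split_ifs
      · exact h.lower _ _ (by omega)
      · rfl
    have k3 : ⁅G i a, lieRoot f d (a + 1)⁆ = if i = a + 1 then -G b a else 0 := by
      rw [ih (a + 1) i a (by omega), e1, if_neg (by omega), zero_sub]
      split_ifs <;> simp
    have k4 : ⁅G (a + 1) j, lieRoot f d (a + 1)⁆ =
        (if j = b then G (a + 1) (a + 1) else 0) - G b j := by
      rw [ih (a + 1) (a + 1) j (by omega), e1, if_pos rfl]
    have k5 : G b a = 0 := h.lower _ _ (by omega)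
    rw [sub_lie, sub_lie, apply_ite (fun x => ⁅x, f a⁆), apply_ite (fun x => ⁅x, f a⁆),
      apply_ite (fun x => ⁅x, lieRoot f d (a + 1)⁆), apply_ite (fun x => ⁅x, lieRoot f d (a + 1)⁆),
      k1, k2, k3, k4, k5]
    simp only [zero_lie, neg_zero, ite_self, sub_zero, zero_sub]
    split_ifs <;> first | omega | abel

theorem lie_pairRoot (h : IsConjAction n f G s v) {p : ℕ × ℕ} (hp : p ∈ posPairs n) (i j : ℕ) :
    ⁅G i j, pairRoot f p⁆ =
      (if j = p.2 then G i p.1 else 0) - (if i = p.1 then G p.2 j else 0) := by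
  rw [mem_posPairs] at hp
  have e : p.1 + (p.2 - p.1 - 1) + 1 = p.2 := by omega
  rw [pairRoot, h.lie_lieRoot _ _ _ _ (by omega), e]

/-- The vectors obtained from `v` by less than `r` root vectors. -/
def filt (n : ℕ) (f : ℕ → Module.End R V) (v : V) : ℕ → Submodule R V
  | 0 => ⊥
  | r + 1 => (filt n f v r ⊔ Submodule.span R {v}) ⊔
      ⨆ p ∈ posPairs n, (filt n f v r).map (pairRoot f p)

theorem filt_le_succ (r : ℕ) : filt n f v r ≤ filt n f v (r + 1) :=
  le_sup_left.trans le_sup_left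

theorem vec_mem_filt (r : ℕ) : v ∈ filt n f v (r + 1) :=
  (le_sup_right.trans le_sup_left : Submodule.span R {v} ≤ _) (Submodule.mem_span_singleton_self v)

theorem pairRoot_mem_filt {p : ℕ × ℕ} (hp : p ∈ posPairs n) {r : ℕ} {x : V}
    (hx : x ∈ filt n f v r) : pairRoot f p x ∈ filt n f v (r + 1) :=
  (le_sup_right : _ ≤ filt n f v (r + 1)) <|
    Submodule.mem_iSup_of_mem p (Submodule.mem_iSup_of_mem hp (Submodule.mem_map_of_mem hx))

/-- Induction over the generators of a step of the filtration. -/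
theorem filt_succ_le {r : ℕ} {S : Submodule R V} (h1 : filt n f v r ≤ S) (h2 : v ∈ S)
    (h3 : ∀ p ∈ posPairs n, ∀ x ∈ filt n f v r, pairRoot f p x ∈ S) :
    filt n f v (r + 1) ≤ S := by
  refine sup_le (sup_le h1 ((Submodule.span_singleton_le_iff_mem _ _).2 h2)) ?_
  refine iSup₂_le fun p hp => ?_
  rintro _ ⟨x, hx, rfl⟩
  exact h3 p hp x hx

theorem filt_mono : Monotone (filt n f v) := monotone_nat_of_le_succ filt_le_succ

theorem rootSpan_mem_filt {z : Module.End R V} (hz : z ∈ IsSerre.rootSpan f n) {r : ℕ} {x : V}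
    (hx : x ∈ filt n f v r) : z x ∈ filt n f v (r + 1) := by
  induction hz using AddSubgroup.closure_induction with
  | zero => exact zero_mem _
  | add y z _ _ hy hz => exact add_mem hy hz
  | neg y _ hy => exact neg_mem hy
  | mem y hy =>
    obtain ⟨d, a, hda, rfl⟩ := hy
    have e : lieRoot f d a = pairRoot f (a, a + d + 1) := by
      rw [pairRoot]
      congr
      simp
      omega
    rw [e]
    exact pairRoot_mem_filt (mem_posPairs.2 ⟨by dsimp only; omega, hda⟩) hx

theorem lie_pairRoot_mem_filt (h : IsConjAction n f G s v) {p p' : ℕ × ℕ} (hp : p ∈ posPairs n)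
    (hp' : p' ∈ posPairs n) {r : ℕ} {x : V} (hx : x ∈ filt n f v r) :
    ⁅pairRoot f p, pairRoot f p'⁆ x ∈ filt n f v (r + 1) := by
  rw [mem_posPairs] at hp hp'
  exact rootSpan_mem_filt (h.serre.lie_mem_rootSpan h.two _ _ (by omega) _
    (IsSerre.lieRoot_mem_rootSpan (by omega))) hx

theorem mul_apply_eq_add_lie (A B : Module.End R V) (x : V) : A (B x) = B (A x) + ⁅A, B⁆ x := by
  simp [Ring.lie_def]

/-- The strictly upper triangular operators lower the filtration. -/
theorem upper_mem_filt (h : IsConjAction n f G s v) (r : ℕ) : ∀ i j, i < j →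
    ∀ x ∈ filt n f v (r + 1), G i j x ∈ filt n f v r := by
  induction r with
  | zero =>
    intro i j hij
    refine filt_succ_le (S := (filt n f v 0).comap (G i j)) (fun x hx => ?_) ?_ ?_
    · rw [filt, Submodule.mem_bot] at hx
      simp [hx]
    · simp [h.vec i j hij]
    · intro p hp x hx
      rw [filt, Submodule.mem_bot] at hx
      simp [hx]
  | succ r ih =>
    intro i j hij
    have hG : ∀ i j, ∀ x ∈ filt n f v (r + 1), G i j x ∈ filt n f v (r + 1) := by
      intro i j x hx
      rcases lt_trichotomy i j with hij | rfl | hij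
      · exact filt_le_succ r (ih i j hij x hx)
      · rw [h.diag]
        exact Submodule.smul_mem _ _ hx
      · rw [h.lower i j hij]
        exact zero_mem _
    refine filt_succ_le (S := (filt n f v (r + 1)).comap (G i j))
      (fun x hx => filt_le_succ r (ih i j hij x hx)) ?_ ?_
    · simp [h.vec i j hij]
    · intro p hp x hx
      rw [Submodule.mem_comap, mul_apply_eq_add_lie]
      refine add_mem (pairRoot_mem_filt hp (ih i j hij x hx)) ?_
      rw [h.lie_pairRoot hp, LinearMap.sub_apply]
      refine sub_mem ?_ ?_
      · split_ifs
        · exact hG _ _ _ hx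
        · exact zero_mem _
      · split_ifs
        · exact hG _ _ _ hx
        · exact zero_mem _

/-- On the highest step of the filtration, the operator `G_γ` acts as a derivation that sends the
root vector of `γ` to a scalar and the other root vectors to `0`. -/
theorem lie_pairRoot_sub_mem_filt (h : IsConjAction n f G s v) {p p' : ℕ × ℕ}
    (hp : p ∈ posPairs n) (hp' : p' ∈ posPairs n) {r : ℕ} {x : V}
    (hx : x ∈ filt n f v (r + 1)) :
    ⁅G p.1 p.2, pairRoot f p'⁆ x - (if p = p' then (s p.1 - s p.2) • x else 0)
      ∈ filt n f v r := by
  have hG : ∀ i j, i ≠ j → G i j x ∈ filt n f v r := by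
    intro i j hij
    rcases hij.lt_or_gt with hij | hij
    · exact h.upper_mem_filt r i j hij x hx
    · rw [h.lower i j hij]
      exact zero_mem _
  obtain ⟨a, b⟩ := p
  obtain ⟨a', b'⟩ := p'
  rw [h.lie_pairRoot hp']
  simp only [Prod.mk.injEq]
  by_cases h1 : a = a'
  · by_cases h2 : b = b'
    · subst h1 h2
      simp [h.diag, sub_smul]
    · subst h1
      simp only [h2, if_false, if_true, and_false, zero_sub, sub_zero, LinearMap.neg_apply]
      exact neg_mem (hG _ _ (Ne.symm h2))
  · by_cases h2 : b = b'
    · subst h2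
      simp only [h1, if_false, if_true, false_and, sub_zero]
      exact hG _ _ h1
    · simp [h1, h2]

/-- If `J` is stable under the root vectors, and contains `X_γ v`, then it contains the image of
`X_γ` up to lower terms. -/
theorem pairRoot_mem_sup_filt (h : IsConjAction n f G s v) {J : Submodule R V}
    (hJ : ∀ p ∈ posPairs n, ∀ x ∈ J, pairRoot f p x ∈ J) {p : ℕ × ℕ} (hp : p ∈ posPairs n)
    (hpJ : pairRoot f p v ∈ J) (r : ℕ) :
    filt n f v r ≤ (J ⊔ filt n f v r).comap (pairRoot f p) := by
  induction r with
  | zero =>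
    intro x hx
    rw [filt, Submodule.mem_bot] at hx
    rw [Submodule.mem_comap, hx, map_zero]
    exact zero_mem _
  | succ r ih =>
    refine filt_succ_le (ih.trans (Submodule.comap_mono (sup_le_sup_left (filt_le_succ r) J)))
      (Submodule.mem_sup_left hpJ) fun p' hp' x hx => ?_
    rw [Submodule.mem_comap, mul_apply_eq_add_lie]
    refine add_mem ?_ (Submodule.mem_sup_right (h.lie_pairRoot_mem_filt hp hp' hx))
    obtain ⟨y, hy, z, hz, hyz⟩ := Submodule.mem_sup.1 (ih hx)
    rw [← hyz, map_add]
    exact add_mem (Submodule.mem_sup_left (hJ p' hp' y hy))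
      (Submodule.mem_sup_right (pairRoot_mem_filt hp' hz))

/-- The Euler operator of a set of positive roots. -/
def euler (f : ℕ → Module.End R V) (G : ℕ → ℕ → Module.End R V) (u : ℕ × ℕ → R)
    (Ψ : Finset (ℕ × ℕ)) : Module.End R V :=
  ∑ p ∈ Ψ, u p • (pairRoot f p * G p.1 p.2)

theorem euler_apply (u : ℕ × ℕ → R) (Ψ : Finset (ℕ × ℕ)) (x : V) :
    euler f G u Ψ x = ∑ p ∈ Ψ, u p • pairRoot f p (G p.1 p.2 x) := by
  simp [euler, LinearMap.sum_apply]

section Euler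

variable {J : Submodule R V} {Ψ : Finset (ℕ × ℕ)} {u : ℕ × ℕ → R}

theorem euler_mem_filt (h : IsConjAction n f G s v) (hΨ : Ψ ⊆ posPairs n) {r : ℕ} {x : V}
    (hx : x ∈ filt n f v r) : euler f G u Ψ x ∈ filt n f v r := by
  rw [euler_apply]
  refine sum_mem fun p hp => Submodule.smul_mem _ _ ?_
  rcases r with _ | r
  · rw [filt, Submodule.mem_bot] at hx
    simp [hx]
  · exact pairRoot_mem_filt (hΨ hp)
      (h.upper_mem_filt r _ _ (mem_posPairs.1 (hΨ hp)).1 x hx)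

/-- The commutator of the Euler operator with a root vector is this root vector or zero, up to lower
terms. -/
theorem euler_pairRoot_sub_mem_filt (h : IsConjAction n f G s v) (hΨ : Ψ ⊆ posPairs n)
    (hu : ∀ p ∈ Ψ, u p * (s p.1 - s p.2) = 1) {p' : ℕ × ℕ} (hp' : p' ∈ posPairs n) {r : ℕ} {x : V}
    (hx : x ∈ filt n f v (r + 1)) :
    euler f G u Ψ (pairRoot f p' x) - pairRoot f p' (euler f G u Ψ x)
      - (if p' ∈ Ψ then pairRoot f p' x else 0) ∈ filt n f v (r + 1) := by
  have e1 : (if p' ∈ Ψ then pairRoot f p' x else 0) = ∑ p ∈ Ψ, u p • pairRoot f p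
      (if p = p' then (s p.1 - s p.2) • x else 0) := by
    rw [← Finset.sum_ite_eq' Ψ p' (fun p => pairRoot f p x)]
    refine Finset.sum_congr rfl fun p hp => ?_
    split_ifs
    · rw [map_smul, smul_smul, hu p hp, one_smul]
    · simp
  rw [e1, euler_apply, euler_apply, map_sum, ← Finset.sum_sub_distrib, ← Finset.sum_sub_distrib]
  refine sum_mem fun p hp => ?_
  rw [map_smul, ← smul_sub, ← smul_sub]
  refine Submodule.smul_mem _ _ ?_
  have hGx := h.upper_mem_filt r _ _ (mem_posPairs.1 (hΨ hp)).1 x hx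
  rw [mul_apply_eq_add_lie (G p.1 p.2), map_add, mul_apply_eq_add_lie (pairRoot f p)]
  have e2 : ∀ a b c d : V, a + b + c - a - d = b + (c - d) := fun a b c d => by abel
  rw [e2, ← map_sub]
  exact add_mem (h.lie_pairRoot_mem_filt (hΨ hp) hp' hGx)
    (pairRoot_mem_filt (hΨ hp) (h.lie_pairRoot_sub_mem_filt (hΨ hp) hp' hx))

/-- The Euler operator acts on the step `r` of the filtration as the number `r`, up to lower terms
and modulo `J`. -/
theorem euler_sub_mem (h : IsConjAction n f G s v)
    (hJ : ∀ p ∈ posPairs n, ∀ x ∈ J, pairRoot f p x ∈ J) (hΨ : Ψ ⊆ posPairs n)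
    (hu : ∀ p ∈ Ψ, u p * (s p.1 - s p.2) = 1)
    (hΨJ : ∀ p ∈ posPairs n, p ∉ Ψ → pairRoot f p v ∈ J) (r : ℕ) : ∀ x ∈ filt n f v (r + 1),
    euler f G u Ψ x - (r : R) • x ∈ J ⊔ filt n f v r := by
  have hv : euler f G u Ψ v = 0 := by
    rw [euler_apply]
    refine Finset.sum_eq_zero fun p hp => ?_
    rw [h.vec _ _ (mem_posPairs.1 (hΨ hp)).1, map_zero, smul_zero]
  suffices hle : filt n f v (r + 1) ≤
      (J ⊔ filt n f v r).comap (euler f G u Ψ - (r : R) • LinearMap.id) from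
    fun x hx => hle hx
  induction r with
  | zero =>
    refine filt_succ_le (fun x hx => ?_) ?_ fun p hp x hx => ?_
    · rw [filt, Submodule.mem_bot] at hx
      simp [hx]
    · simp [hv]
    · rw [filt, Submodule.mem_bot] at hx
      simp [hx]
  | succ r ih =>
    refine filt_succ_le (fun x hx => ?_) ?_ fun p hp x hx => ?_
    · exact Submodule.mem_sup_right (sub_mem (h.euler_mem_filt hΨ hx) (Submodule.smul_mem _ _ hx))
    · rw [Submodule.mem_comap, LinearMap.sub_apply, hv, zero_sub]
      exact Submodule.mem_sup_right (neg_mem (Submodule.smul_mem _ _ (vec_mem_filt r)))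
    · have h1 := h.euler_pairRoot_sub_mem_filt hΨ hu hp hx
      have h2 : pairRoot f p (euler f G u Ψ x - (r : R) • x) ∈ J ⊔ filt n f v (r + 1) := by
        obtain ⟨y, hy, z, hz, hyz⟩ := Submodule.mem_sup.1 (ih hx)
        change y + z = euler f G u Ψ x - (r : R) • x at hyz
        rw [← hyz, map_add]
        exact add_mem (Submodule.mem_sup_left (hJ p hp y hy))
          (Submodule.mem_sup_right (pairRoot_mem_filt hp hz))
      have h3 : (if p ∈ Ψ then pairRoot f p x else 0) - pairRoot f p x ∈
          J ⊔ filt n f v (r + 1) := by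
        split_ifs with hpΨ
        · rw [sub_self]
          exact zero_mem _
        · rw [zero_sub]
          exact neg_mem (h.pairRoot_mem_sup_filt hJ hp (hΨJ p hp hpΨ) _ hx)
      have h4 := add_mem (add_mem (Submodule.mem_sup_right (S := J) h1) h2) h3
      rw [map_sub, map_smul] at h4
      rw [Submodule.mem_comap]
      convert h4 using 1
      simp only [LinearMap.sub_apply, LinearMap.add_apply, LinearMap.smul_apply,
        LinearMap.id_apply, Nat.cast_succ,
        add_smul, one_smul]
      abel

theorem mem_of_mem_filt (h : IsConjAction n f G s v)
    (hJ : ∀ p ∈ posPairs n, ∀ x ∈ J, pairRoot f p x ∈ J) (hΨ : Ψ ⊆ posPairs n)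
    (hu : ∀ p ∈ Ψ, u p * (s p.1 - s p.2) = 1)
    (hΨJ : ∀ p ∈ posPairs n, p ∉ Ψ → pairRoot f p v ∈ J)
    (hnat : ∀ r : ℕ, r ≠ 0 → IsUnit (r : R)) {Z : Submodule R V}
    (hZ : ∀ i j, i < j → ∀ x ∈ Z, G i j x ∈ Z) (hJZ : J ≤ Z)
    (hvZ : ∀ c : R, c • v ∈ Z → c • v = 0) (r : ℕ) : filt n f v r ⊓ Z ≤ J := by
  induction r with
  | zero =>
    rintro x ⟨hx, -⟩
    rw [SetLike.mem_coe, filt, Submodule.mem_bot] at hx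
    rw [hx]
    exact zero_mem _
  | succ r ih =>
    rintro x ⟨hx, hxZ⟩
    rcases r with _ | r
    · have hle : filt n f v 1 ≤ Submodule.span R {v} := by
        refine filt_succ_le bot_le (Submodule.mem_span_singleton_self v) fun p hp x hx => ?_
        rw [filt, Submodule.mem_bot] at hx
        simp [hx]
      obtain ⟨c, rfl⟩ := Submodule.mem_span_singleton.1 (hle hx)
      rw [hvZ c hxZ]
      exact zero_mem _
    · have h1 : euler f G u Ψ x ∈ J := by
        rw [euler_apply]
        refine sum_mem fun p hp => Submodule.smul_mem _ _ (hJ p (hΨ hp) _ (ih ?_))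
        have hlt := (mem_posPairs.1 (hΨ hp)).1
        exact ⟨h.upper_mem_filt _ _ _ hlt x hx, hZ _ _ hlt x hxZ⟩
      have h2 := h.euler_sub_mem hJ hΨ hu hΨJ (r + 1) x hx
      have h3 : ((r + 1 : ℕ) : R) • x ∈ J ⊔ filt n f v (r + 1) := by
        have := sub_mem (Submodule.mem_sup_left h1) h2
        rwa [sub_sub_cancel] at this
      have h4 : x ∈ J ⊔ filt n f v (r + 1) :=
        (Submodule.smul_mem_iff_of_isUnit _ (hnat (r + 1) (by omega))).1 h3
      obtain ⟨y, hy, z, hz, rfl⟩ := Submodule.mem_sup.1 h4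
      refine add_mem hy (ih ⟨hz, ?_⟩)
      have := sub_mem hxZ (hJZ hy)
      rwa [add_sub_cancel_left] at this

/-- A vector in a submodule `Z` that is stable under the strictly upper triangular operators and
does not meet the multiples of `v` lies in the submodule `J`, if the `X_γ v` with `X_γ ∉ Ψ` are
in `J`, and if the diagonal of `G` separates the indices of the roots in `Ψ`. -/
theorem le_of_stable (h : IsConjAction n f G s v)
    (hJ : ∀ p ∈ posPairs n, ∀ x ∈ J, pairRoot f p x ∈ J) (hΨ : Ψ ⊆ posPairs n)
    (hu : ∀ p ∈ Ψ, u p * (s p.1 - s p.2) = 1)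
    (hΨJ : ∀ p ∈ posPairs n, p ∉ Ψ → pairRoot f p v ∈ J)
    (hnat : ∀ r : ℕ, r ≠ 0 → IsUnit (r : R)) {Z : Submodule R V}
    (hZ : ∀ i j, i < j → ∀ x ∈ Z, G i j x ∈ Z) (hJZ : J ≤ Z)
    (hvZ : ∀ c : R, c • v ∈ Z → c • v = 0) : Z ≤ J := by
  have hdir : Directed (· ≤ ·) (filt n f v) := filt_mono.directed_le
  have htop : ⨆ r, filt n f v r = ⊤ := by
    refine h.cyclic _ (Submodule.mem_iSup_of_mem 1 (vec_mem_filt 0)) fun k hk x hx => ?_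
    obtain ⟨r, hr⟩ := (Submodule.mem_iSup_of_directed _ hdir).1 hx
    have e : f k = pairRoot f (k, k + 1) := by simp [pairRoot, lieRoot]
    rw [e]
    exact Submodule.mem_iSup_of_mem (r + 1)
      (pairRoot_mem_filt (mem_posPairs.2 ⟨by simp, hk⟩) hr)
  intro x hx
  obtain ⟨r, hr⟩ := (Submodule.mem_iSup_of_directed _ hdir).1 (htop ▸ Submodule.mem_top : x ∈ _)
  exact h.mem_of_mem_filt hJ hΨ hu hΨJ hnat hZ hJZ hvZ r ⟨hr, hx⟩

end Euler

/-- A submodule that is stable under the simple root vectors is stable under all root vectors. -/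
theorem pairRoot_mem {J : Submodule R V} (hJ : ∀ k, k + 1 < n → ∀ x ∈ J, f k x ∈ J)
    {p : ℕ × ℕ} (hp : p ∈ posPairs n) {x : V} (hx : x ∈ J) : pairRoot f p x ∈ J := by
  have key : ∀ d a, a + d + 1 < n → ∀ x ∈ J, lieRoot f d a x ∈ J := by
    intro d
    induction d with
    | zero => exact fun a ha x hx => hJ a ha x hx
    | succ d ih =>
      intro a ha x hx
      rw [lieRoot, Ring.lie_def, LinearMap.sub_apply]
      exact sub_mem (ih _ (by omega) _ (hJ a (by omega) x hx))
        (hJ a (by omega) _ (ih _ (by omega) x hx))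
  rw [mem_posPairs] at hp
  exact key _ _ (by omega) x hx

end IsConjAction

end Separation

/-! ### A criterion for freeness over `ℂ⟦ħ⟧` -/

section Free

variable {P : Type*} [AddCommGroup P] [Module Rh P]

/-- The elements that are torsion modulo a submodule. -/
def saturation (N : Submodule Rh P) : Submodule Rh P where
  carrier := {x | ∃ r : Rh, r ≠ 0 ∧ r • x ∈ N}
  zero_mem' := ⟨1, one_ne_zero, by simp⟩
  add_mem' := by
    rintro x y ⟨r, hr, hx⟩ ⟨s, hs, hy⟩
    refine ⟨r * s, mul_ne_zero hr hs, ?_⟩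
    rw [smul_add, mul_comm r s, mul_smul, mul_comm s r, mul_smul]
    exact add_mem (N.smul_mem _ hx) (N.smul_mem _ hy)
  smul_mem' := by
    rintro c x ⟨r, hr, hx⟩
    exact ⟨r, hr, by rw [smul_comm]; exact N.smul_mem _ hx⟩

theorem le_saturation (N : Submodule Rh P) : N ≤ saturation N :=
  fun x hx => ⟨1, one_ne_zero, by simpa using hx⟩

theorem isTorsionFree_quotient {N : Submodule Rh P} (h : saturation N ≤ N) :
    Module.IsTorsionFree Rh (P ⧸ N) := by
  rw [Module.isTorsionFree_iff_smul_eq_zero]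
  intro r x hrx
  obtain ⟨y, rfl⟩ := N.mkQ_surjective x
  rw [← map_smul, Submodule.mkQ_apply, Submodule.Quotient.mk_eq_zero] at hrx
  refine or_iff_not_imp_left.2 fun hr => ?_
  exact (Submodule.Quotient.mk_eq_zero N).2 (h ⟨r, hr, hrx⟩)

theorem saturation_le [Module.IsTorsionFree Rh P] {D : ℕ → Submodule Rh P}
    (hD : DirectSum.IsInternal D) (hfg : ∀ d, (D d).FG) {N : Submodule Rh P}
    (hN : N ≤ ⨆ d, N ⊓ D d)
    (hkey : ∀ x ∈ saturation N, ∃ y ∈ N, ∃ z, x = y + (PowerSeries.X : Rh) • z) :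
    saturation N ≤ N := by
  classical
  let _ := hD.chooseDecomposition
  have hp : ∀ x ∈ N, ∀ d, (DirectSum.decompose D x d : P) ∈ N := by
    intro x hx d
    replace hx := hN hx
    induction hx using Submodule.iSup_induction' with
    | mem e x hx =>
      rcases eq_or_ne e d with rfl | hed
      · rw [DirectSum.decompose_of_mem_same D hx.2]
        exact hx.1
      · rw [DirectSum.decompose_of_mem_ne D hx.2 hed]
        exact zero_mem _
    | zero => simp
    | add x y _ _ hx hy =>
      rw [DirectSum.decompose_add, DirectSum.add_apply, Submodule.coe_add]
      exact add_mem hx hy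
  have hps : ∀ x ∈ saturation N, ∀ d, (DirectSum.decompose D x d : P) ∈ saturation N := by
    rintro x ⟨r, hr, hx⟩ d
    refine ⟨r, hr, ?_⟩
    have h1 := hp _ hx d
    rwa [DirectSum.decompose_smul] at h1
  have hle : ∀ d, saturation N ⊓ D d ≤ N := by
    intro d
    have : IsNoetherian Rh (D d) := isNoetherian_of_fg_of_noetherian _ (hfg d)
    have hfg' : (saturation N ⊓ D d).FG := by
      have h1 : (Submodule.comap (D d).subtype (saturation N)).FG := IsNoetherian.noetherian _
      have h2 := h1.map (D d).subtype
      rwa [Submodule.map_comap_subtype, inf_comm] at h2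
    refine Submodule.le_of_le_smul_of_le_jacobson_bot (I := Ideal.span {(PowerSeries.X : Rh)})
      hfg' ?_ ?_
    · rw [IsLocalRing.jacobson_eq_maximalIdeal ⊥ bot_ne_top, Ideal.span_le,
        Set.singleton_subset_iff, SetLike.mem_coe, IsLocalRing.mem_maximalIdeal, mem_nonunits_iff]
      exact PowerSeries.X_prime.not_isUnit
    · rintro x ⟨hx, hxd⟩
      obtain ⟨y, hy, z, rfl⟩ := hkey x hx
      have hz : z ∈ saturation N := by
        have h1 := sub_mem hx (le_saturation N hy)
        rw [add_sub_cancel_left] at h1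
        obtain ⟨r, hr, h2⟩ := h1
        exact ⟨r * PowerSeries.X, mul_ne_zero hr PowerSeries.X_ne_zero, by rwa [mul_smul]⟩
      have h3 := DirectSum.decompose_of_mem_same D hxd
      rw [DirectSum.decompose_add, DirectSum.decompose_smul, DirectSum.add_apply,
        Submodule.coe_add] at h3
      rw [← h3]
      exact add_mem (Submodule.mem_sup_left (hp y hy d)) (Submodule.mem_sup_right
        (Submodule.smul_mem_smul (Ideal.mem_span_singleton_self _)
          ⟨hps z hz d, Submodule.coe_mem _⟩))
  intro x hx
  rw [← DirectSum.sum_support_decompose D x]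
  exact sum_mem fun d _ => hle d ⟨hps x hx d, Submodule.coe_mem _⟩

theorem isInternal_of_eigenspace [Module.IsTorsionFree Rh P] {D : ℕ → Submodule Rh P}
    (htop : ⨆ d, D d = ⊤) (κ : Module.End Rh P) {χ : ℕ → Rh} (hχ : Function.Injective χ)
    (hκ : ∀ d, ∀ x ∈ D d, κ x = χ d • x) : DirectSum.IsInternal D := by
  refine DirectSum.isInternal_submodule_of_iSupIndep_of_iSup_eq_top ?_ htop
  exact (κ.eigenspaces_iSupIndep.comp hχ).mono
    fun d x hx => Module.End.mem_eigenspace_iff.2 (hκ d x hx)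

/-- Freeness of the quotient of a graded module by a graded submodule `N`. The grading is by
eigenspaces of an operator `κ`, with components of finite type; the submodule is saturated up to
multiples of `ħ`, hence saturated by Nakayama's lemma in each degree. -/
theorem free_quotient_of_graded [Module.IsTorsionFree Rh P] {D : ℕ → Submodule Rh P}
    (htop : ⨆ d, D d = ⊤) (hfg : ∀ d, (D d).FG) (κ : Module.End Rh P) {χ : ℕ → Rh}
    (hχ : Function.Injective χ) (hκ : ∀ d, ∀ x ∈ D d, κ x = χ d • x) {N : Submodule Rh P}
    (hN : N ≤ ⨆ d, N ⊓ D d)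
    (hkey : ∀ x ∈ saturation N, ∃ y ∈ N, ∃ z, x = y + (PowerSeries.X : Rh) • z) :
    Module.Free Rh (P ⧸ N) := by
  have hint := isInternal_of_eigenspace htop κ hχ hκ
  have htf := isTorsionFree_quotient (saturation_le hint hfg hN hkey)
  have hκN : N ≤ N.comap κ := by
    intro x hx
    replace hx := hN hx
    induction hx using Submodule.iSup_induction' with
    | mem e x hx =>
      rw [Submodule.mem_comap, hκ e x hx.2]
      exact N.smul_mem _ hx.1
    | zero => exact zero_mem _
    | add x y _ _ hx hy => exact add_mem hx hy
  have hint' : DirectSum.IsInternal fun d => (D d).map N.mkQ := by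
    refine isInternal_of_eigenspace ?_ (N.mapQ N κ hκN) hχ ?_
    · rw [← Submodule.map_iSup, htop, Submodule.map_top, Submodule.range_mkQ]
    · rintro d _ ⟨x, hx, rfl⟩
      rw [Submodule.mkQ_apply, Submodule.mapQ_apply, hκ d x hx, Submodule.Quotient.mk_smul]
  have hfree : ∀ d, Module.Free Rh ((D d).map N.mkQ) := fun d => by
    have : Module.Finite Rh ((D d).map N.mkQ) := Module.Finite.iff_fg.2 ((hfg d).map _)
    infer_instance
  exact Module.Free.of_equiv (LinearEquiv.ofBijective (DirectSum.coeLinearMap _) hint')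

end Free

/-! ### Root vectors of the positive part -/

section ERoot

variable {n : ℕ}

/-- The root vector of `ε_i - ε_{i+d+1}` in the positive part of `U_q(gl(n))`. -/
def eRoot (n : ℕ) : ℕ → ℕ → Uq n
  | 0, i => uE n i
  | d + 1, i => uE n i * eRoot n d (i + 1) - qK (-1) • (eRoot n d (i + 1) * uE n i)

theorem commute_eRoot {x : Uq n} : ∀ d i, (∀ k, i ≤ k → k ≤ i + d → Commute (uE n k) x) →
    Commute (eRoot n d i) x
  | 0, i, h => h i le_rfl le_rfl
  | d + 1, i, h => by
    have h1 := commute_eRoot d (i + 1) fun k h1 h2 => h k (by omega) (by omega)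
    have h2 := h i le_rfl (by omega)
    exact (h2.mul_left h1).sub_left ((h1.mul_left h2).smul_left _)

theorem uK_mul_eRoot (l : ℕ) : ∀ d i, uK n l * eRoot n d i =
    qK ((if l = i then 1 else 0) - (if l = i + d + 1 then 1 else 0)) • (eRoot n d i * uK n l)
  | 0, i => isPreUq_uq.k_e l i
  | d + 1, i => by
    have ih := uK_mul_eRoot l d (i + 1)
    have he := isPreUq_uq.k_e (n := n) l i
    rw [eRoot, mul_sub, sub_mul, smul_sub, mul_smul_comm, ← mul_assoc, ← mul_assoc, he, ih,
      smul_mul_assoc, smul_mul_assoc, mul_assoc, mul_assoc, he, ih]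
    simp only [mul_smul_comm, smul_mul_assoc, smul_smul, ← qK_add, mul_assoc, wtPair]
    congr 3 <;> ring_nf

theorem uKinv_mul_eRoot (l d i : ℕ) : uKinv n l * eRoot n d i =
    qK (-((if l = i then 1 else 0) - (if l = i + d + 1 then 1 else 0))) •
      (eRoot n d i * uKinv n l) :=
  isPreUq_uq.kinv_mul_of_k_mul (uK_mul_eRoot l d i)

theorem eRoot_zero_commutator {i : ℕ} (hi : i + 1 < n) :
    eRoot n 0 i * uF n i - uF n i * eRoot n 0 i =
      qDeltaK⁻¹ • (uK n i * uKinv n (i + 1) - uKinv n i * uK n (i + 1)) :=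
  isPreUq_uq.e_f_self i hi

theorem commute_eRoot_uF {d i k : ℕ} (hk : k < i ∨ i + d < k) :
    Commute (eRoot n d i) (uF n k) :=
  commute_eRoot d i fun l h1 h2 => isPreUq_uq.e_f_ne l k (by omega)

theorem eRoot_commutator_first {d i : ℕ} (hi : i + 1 < n) :
    eRoot n (d + 1) i * uF n i - uF n i * eRoot n (d + 1) i =
      -(eRoot n d (i + 1) * (uKinv n i * uK n (i + 1))) := by
  have h0 := (commute_eRoot_uF (n := n) (d := d) (i := i + 1) (k := i) (by omega)).eq
  have h1 : (uK n i * uKinv n (i + 1)) * eRoot n d (i + 1) =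
      qK (-1) • (eRoot n d (i + 1) * (uK n i * uKinv n (i + 1))) := by
    rw [mul_assoc, uKinv_mul_eRoot, mul_smul_comm, ← mul_assoc, uK_mul_eRoot, if_pos rfl,
      if_neg (by omega), if_neg (by omega), if_neg (by omega), smul_mul_assoc, smul_smul, ← qK_add,
      mul_assoc]
    norm_num
  have h2 : (uKinv n i * uK n (i + 1)) * eRoot n d (i + 1) =
      qK 1 • (eRoot n d (i + 1) * (uKinv n i * uK n (i + 1))) := by
    rw [mul_assoc, uK_mul_eRoot, mul_smul_comm, ← mul_assoc, uKinv_mul_eRoot, if_pos rfl,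
      if_neg (by omega), if_neg (by omega), if_neg (by omega), smul_mul_assoc, smul_smul, ← qK_add,
      mul_assoc]
    norm_num
  have h3 := isPreUq_uq.e_f_self (n := n) i hi
  have hd : qDeltaK⁻¹ * (qK 1 - qK (-1)) = 1 := inv_mul_cancel₀ qDeltaK_ne_zero
  have e1 : eRoot n (d + 1) i * uF n i - uF n i * eRoot n (d + 1) i =
      (uE n i * uF n i - uF n i * uE n i) * eRoot n d (i + 1)
        - qK (-1) • (eRoot n d (i + 1) * (uE n i * uF n i - uF n i * uE n i)) := by
    have h0' : ∀ z, eRoot n d (i + 1) * (uF n i * z) = uF n i * (eRoot n d (i + 1) * z) :=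
      fun z => by rw [← mul_assoc, h0, mul_assoc]
    rw [eRoot, sub_mul, mul_sub, smul_mul_assoc, mul_smul_comm, sub_mul, mul_sub, smul_sub]
    simp only [mul_assoc, h0, h0']
    abel
  rw [e1, h3, smul_mul_assoc, sub_mul, h1, h2, mul_smul_comm, mul_sub, smul_sub, smul_sub]
  generalize eRoot n d (i + 1) * (uK n i * uKinv n (i + 1)) = A
  generalize eRoot n d (i + 1) * (uKinv n i * uK n (i + 1)) = B
  match_scalars
  · ring
  · linear_combination -hd

theorem eRoot_commutator_mid {d : ℕ} : ∀ {i k : ℕ}, i < k → k < i + d → i + d + 1 < n →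
    Commute (eRoot n d i) (uF n k) := by
  induction d with
  | zero => intro i k h1 h2; omega
  | succ d ih =>
    intro i k h1 h2 hn
    have hE : uE n i * uF n k = uF n k * uE n i := isPreUq_uq.e_f_ne i k (by omega)
    rcases eq_or_ne k (i + 1) with rfl | hk
    · obtain ⟨d, rfl⟩ : ∃ d', d = d' + 1 := ⟨d - 1, by omega⟩
      have h3 := eRoot_commutator_first (n := n) (d := d) (i := i + 1) (by omega)
      rw [sub_eq_iff_eq_add] at h3
      have h4 : uE n i * eRoot n d (i + 1 + 1) = eRoot n d (i + 1 + 1) * uE n i :=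
        (commute_eRoot d (i + 1 + 1) fun k h1 h2 => (uE_comm (by omega)).symm).symm.eq
      have h5 : (uKinv n (i + 1) * uK n (i + 1 + 1)) * uE n i =
          qK 1 • (uE n i * (uKinv n (i + 1) * uK n (i + 1 + 1))) := by
        rw [mul_assoc, isPreUq_uq.k_e, mul_smul_comm, ← mul_assoc, isPreUq_uq.kinv_e,
          smul_mul_assoc, smul_smul, ← qK_add, mul_assoc, wtPair, wtPair, if_neg (by omega),
          if_neg (by omega), if_neg (by omega), if_pos rfl]
        norm_num
      have hq : qK (-1) * qK 1 = 1 := by rw [← qK_add]; norm_num [qK_zero]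
      rw [Commute, SemiconjBy, eRoot, sub_mul, mul_sub, smul_mul_assoc, mul_smul_comm, mul_assoc,
        h3, mul_assoc _ (uE n i), hE, ← mul_assoc _ (uF n (i + 1)), h3, add_mul, mul_add, neg_mul,
        mul_assoc (eRoot n d (i + 1 + 1)), h5, mul_smul_comm, ← mul_assoc _ (uE n i), ← h4,
        mul_neg, ← mul_assoc (uE n i) (uF n (i + 1)), hE, smul_add, smul_neg, smul_smul, hq,
        one_smul]
      simp only [mul_assoc]
      abel
    · have h3 := (ih (i := i + 1) (k := k) (by omega) (by omega) (by omega))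
      have hE' : Commute (uE n i) (uF n k) := hE
      exact (hE'.mul_left h3).sub_left ((h3.mul_left hE').smul_left _)

theorem eRoot_commutator_last {d : ℕ} : ∀ {i : ℕ}, i + d + 2 < n →
    eRoot n (d + 1) i * uF n (i + d + 1) - uF n (i + d + 1) * eRoot n (d + 1) i =
      qK (-1) • (eRoot n d i * (uK n (i + d + 1) * uKinv n (i + d + 2))) := by
  have general : ∀ (i k : ℕ) (E H : Uq n), i < k → E * uF n k - uF n k * E = H →
      (uE n i * E - qK (-1) • (E * uE n i)) * uF n k
        - uF n k * (uE n i * E - qK (-1) • (E * uE n i)) =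
        uE n i * H - qK (-1) • (H * uE n i) := by
    rintro i k E H hik rfl
    have hE : uE n i * uF n k = uF n k * uE n i := isPreUq_uq.e_f_ne i k (by omega)
    rw [sub_mul, mul_sub, smul_mul_assoc, mul_smul_comm, mul_assoc _ (uE n i), hE, mul_sub,
      sub_mul, ← mul_assoc (uE n i) (uF n k), hE, smul_sub]
    simp only [mul_assoc]
    abel
  induction d with
  | zero =>
    intro i hi
    have h1 := general i (i + 1) _ _ (by omega) (eRoot_zero_commutator (n := n) (i := i + 1) hi)
    rw [eRoot]
    refine h1.trans ?_
    have h2 : (uK n (i + 1) * uKinv n (i + 1 + 1)) * uE n i =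
        qK (-1) • (uE n i * (uK n (i + 1) * uKinv n (i + 1 + 1))) := by
      rw [isPreUq_uq.kk_e, wtPair, wtPair, if_neg (by omega), if_pos rfl, if_neg (by omega),
        if_neg (by omega)]
      norm_num
    have h3 : (uKinv n (i + 1) * uK n (i + 1 + 1)) * uE n i =
        qK 1 • (uE n i * (uKinv n (i + 1) * uK n (i + 1 + 1))) := by
      rw [isPreUq_uq.kk'_e, wtPair, wtPair, if_neg (by omega), if_pos rfl, if_neg (by omega),
        if_neg (by omega)]
      norm_num
    have hd : qDeltaK⁻¹ * (qK 1 - qK (-1)) = 1 := inv_mul_cancel₀ qDeltaK_ne_zero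
    have hq : qK 1 * qK (-1) = 1 := qK_mul_neg 1
    rw [smul_mul_assoc, sub_mul, h2, h3, mul_smul_comm, mul_sub, add_zero]
    change _ = qK (-1) • (uE n i * (uK n (i + 1) * uKinv n (i + 1 + 1)))
    generalize uE n i * (uK n (i + 1) * uKinv n (i + 1 + 1)) = A
    generalize uE n i * (uKinv n (i + 1) * uK n (i + 1 + 1)) = B
    generalize qK 1 = q at *
    generalize qK (-1) = q' at *
    match_scalars
    · grind
    · grind
  | succ d ih =>
    intro i hi
    have h0 := ih (i := i + 1) (by omega)
    have h1 := general i (i + 1 + d + 1) _ _ (by omega) h0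
    have e1 : i + 1 + d + 1 = i + (d + 1) + 1 := by omega
    have e2 : i + 1 + d + 2 = i + (d + 1) + 2 := by omega
    rw [e1, e2] at h1
    rw [eRoot]
    refine h1.trans ?_
    have hK : Commute (uK n (i + (d + 1) + 1) * uKinv n (i + (d + 1) + 2)) (uE n i) :=
      (commute_uk_uE (by omega) (by omega)).mul_left (commute_ukinv_uE (by omega) (by omega))
    rw [mul_smul_comm, smul_mul_assoc, mul_assoc _ _ (uE n i), hK.eq, eRoot, sub_mul, smul_sub,
      smul_mul_assoc]
    simp only [mul_assoc]

end ERoot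

/-! ### The submodules spanned by words in the `f_α` -/

section FSpan

variable {n : ℕ} {μ : Weight n}

/-- The `ℂ⟦ħ⟧`-submodule spanned by the words in the `f_α`, applied to a vector. -/
def fSpan (u : Verma μ) : Submodule Rh (Verma μ) :=
  Submodule.span Rh (Set.range fun L : List (Fin (n - 1)) => (L.map uf).prod • u)

/-- The part of `fSpan` spanned by the words of a given length. -/
def fDeg (u : Verma μ) (d : ℕ) : Submodule Rh (Verma μ) :=
  Submodule.span Rh ((fun L : List (Fin (n - 1)) => (L.map uf).prod • u) '' {L | L.length = d})

theorem fDeg_le_fSpan (u : Verma μ) (d : ℕ) : fDeg u d ≤ fSpan u :=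
  Submodule.span_mono (Set.image_subset_range _ _)

theorem iSup_fDeg (u : Verma μ) : ⨆ d, fDeg u d = fSpan u := by
  refine le_antisymm (iSup_le (fDeg_le_fSpan u)) (Submodule.span_le.2 ?_)
  rintro _ ⟨L, rfl⟩
  exact Submodule.mem_iSup_of_mem L.length (Submodule.subset_span ⟨L, rfl, rfl⟩)

theorem fDeg_fg (u : Verma μ) (d : ℕ) : (fDeg u d).FG :=
  Submodule.fg_span ((List.finite_length_eq _ d).image _)

theorem mem_fDeg_zero (u : Verma μ) : u ∈ fDeg u 0 :=
  Submodule.subset_span ⟨[], rfl, one_smul _ u⟩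

theorem mem_fSpan (u : Verma μ) : u ∈ fSpan u := fDeg_le_fSpan u 0 (mem_fDeg_zero u)

theorem uF_mem_fDeg {u x : Verma μ} {d : ℕ} (hx : x ∈ fDeg u d) (k : ℕ) :
    uF n k • x ∈ fDeg u (d + 1) := by
  rcases lt_or_ge k (n - 1) with h | h
  · lift k to Fin (n - 1) using h
    rw [uF_val]
    have hle : fDeg u d ≤ (fDeg u (d + 1)).comap (Algebra.lsmul Rh Rh (Verma μ) (uf k)) := by
      refine Submodule.span_le.2 ?_
      rintro _ ⟨L, hL, rfl⟩
      refine Submodule.subset_span ⟨k :: L, ?_, ?_⟩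
      · change L.length = d at hL
        change (k :: L).length = d + 1
        rw [List.length_cons, hL]
      · simp [mul_smul]
    exact hle hx
  · rw [uF_of_le h, zero_smul]
    exact zero_mem _

/-- Induction principle for `fSpan`. -/
theorem fSpan_le {u : Verma μ} {S : Submodule Rh (Verma μ)} (hu : u ∈ S)
    (hS : ∀ k, k + 1 < n → ∀ x ∈ S, uF n k • x ∈ S) : fSpan u ≤ S := by
  refine Submodule.span_le.2 ?_
  rintro _ ⟨L, rfl⟩
  induction L with
  | nil => simpa using hu
  | cons k L ih =>
    have h1 := hS k (by omega) _ ih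
    rw [uF_val, smul_smul] at h1
    simpa using h1

theorem uF_mem_fSpan {u x : Verma μ} (hx : x ∈ fSpan u) (k : ℕ) : uF n k • x ∈ fSpan u := by
  rw [← iSup_fDeg] at hx
  induction hx using Submodule.iSup_induction' with
  | mem d x hx => exact fDeg_le_fSpan u _ (uF_mem_fDeg hx k)
  | zero => rw [smul_zero]; exact zero_mem _
  | add x y _ _ hx hy => rw [smul_add]; exact add_mem hx hy

theorem qK_smul_verma (c : ℂ) (x : Verma μ) : qK c • x = qpow c • x := algebraMap_smul Kh _ x

/-- An element of the quantum group that commutes with the `f_α` up to powers of `q` acts diagonally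
on words. -/
theorem smul_word {T : Uq n} {a : Fin (n - 1) → ℂ} (hT : ∀ k, T * uf k = qK (a k) • (uf k * T))
    {u : Verma μ} {c : Rh} (hu : T • u = c • u) (L : List (Fin (n - 1))) :
    T • (L.map uf).prod • u = (qpow (L.map a).sum * c) • (L.map uf).prod • u := by
  induction L with
  | nil => simp [hu, qpow_zero]
  | cons k L ih =>
    rw [List.map_cons, List.prod_cons, mul_smul, smul_smul, hT, smul_assoc, mul_smul, ih,
      List.map_cons, List.sum_cons, qpow_add, qK_smul_verma, smul_comm (uf k) _ _, smul_smul,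
      mul_assoc]

/-- A vector annihilated by the `e_α` on which the `q^{h_{ε_i}}` and `q^{-h_{ε_i}}` act by scalars
from `ℂ⟦ħ⟧`. -/
structure IsHighest (c cinv : ℕ → Rh) (u : Verma μ) : Prop where
  k : ∀ i, uK n i • u = c i • u
  kinv : ∀ i, uKinv n i • u = cinv i • u
  e : ∀ a, uE n a • u = 0

variable {c cinv : ℕ → Rh} {u : Verma μ}

theorem uK_mul_uf (i : ℕ) (k : Fin (n - 1)) :
    uK n i * uf k = qK (-wtPair i k) • (uf k * uK n i) := by
  rw [← uF_val]
  exact isPreUq_uq.k_f i k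

theorem uKinv_mul_uf (i : ℕ) (k : Fin (n - 1)) :
    uKinv n i * uf k = qK (wtPair i k) • (uf k * uKinv n i) := by
  rw [← uF_val]
  exact isPreUq_uq.kinv_f i k

theorem mem_fDeg_of_diag {T : Uq n} {a : Fin (n - 1) → ℂ}
    (hT : ∀ k, T * uf k = qK (a k) • (uf k * T)) {r : Rh} (hu : T • u = r • u) {d : ℕ}
    {x : Verma μ} (hx : x ∈ fDeg u d) : T • x ∈ fDeg u d := by
  have hle : fDeg u d ≤ (fDeg u d).comap (Algebra.lsmul Rh Rh (Verma μ) T) := by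
    refine Submodule.span_le.2 ?_
    rintro _ ⟨L, hL, rfl⟩
    change T • (L.map uf).prod • u ∈ fDeg u d
    rw [smul_word hT hu]
    exact Submodule.smul_mem _ _ (Submodule.subset_span ⟨L, hL, rfl⟩)
  exact hle hx

theorem IsHighest.uK_mem_fDeg (h : IsHighest c cinv u) (i : ℕ) {d : ℕ} {x : Verma μ}
    (hx : x ∈ fDeg u d) : uK n i • x ∈ fDeg u d :=
  mem_fDeg_of_diag (uK_mul_uf i) (h.k i) hx

theorem IsHighest.uKinv_mem_fDeg (h : IsHighest c cinv u) (i : ℕ) {d : ℕ} {x : Verma μ}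
    (hx : x ∈ fDeg u d) : uKinv n i • x ∈ fDeg u d :=
  mem_fDeg_of_diag (uKinv_mul_uf i) (h.kinv i) hx

theorem mem_fSpan_of_fDeg {T : Uq n} (hT : ∀ d, ∀ x ∈ fDeg u d, T • x ∈ fSpan u)
    {x : Verma μ} (hx : x ∈ fSpan u) : T • x ∈ fSpan u := by
  rw [← iSup_fDeg] at hx
  induction hx using Submodule.iSup_induction' with
  | mem d x hx => exact hT d x hx
  | zero => rw [smul_zero]; exact zero_mem _
  | add x y _ _ hx hy => rw [smul_add]; exact add_mem hx hy

theorem IsHighest.uK_mem_fSpan (h : IsHighest c cinv u) (i : ℕ) {x : Verma μ}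
    (hx : x ∈ fSpan u) : uK n i • x ∈ fSpan u :=
  mem_fSpan_of_fDeg (fun _ _ hx => fDeg_le_fSpan _ _ (h.uK_mem_fDeg i hx)) hx

theorem IsHighest.uKinv_mem_fSpan (h : IsHighest c cinv u) (i : ℕ) {x : Verma μ}
    (hx : x ∈ fSpan u) : uKinv n i • x ∈ fSpan u :=
  mem_fSpan_of_fDeg (fun _ _ hx => fDeg_le_fSpan _ _ (h.uKinv_mem_fDeg i hx)) hx

/-- The rescaled root vectors `(q - q⁻¹) e_γ`. -/
def eForm (n d i : ℕ) : Uq n := qDelta • eRoot n d i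

theorem eForm_zero_commutator {i : ℕ} (hi : i + 1 < n) :
    eForm n 0 i * uF n i - uF n i * eForm n 0 i =
      uK n i * uKinv n (i + 1) - uKinv n i * uK n (i + 1) := by
  rw [eForm, smul_mul_assoc, mul_smul_comm, ← smul_sub, eRoot_zero_commutator hi,
    ← algebraMap_smul Kh qDelta, algebraMap_qDelta, smul_smul, mul_inv_cancel₀ qDeltaK_ne_zero,
    one_smul]

theorem eForm_commutator_first {d i : ℕ} (hi : i + 1 < n) :
    eForm n (d + 1) i * uF n i - uF n i * eForm n (d + 1) i =
      -(eForm n d (i + 1) * (uKinv n i * uK n (i + 1))) := by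
  rw [eForm, smul_mul_assoc, mul_smul_comm, ← smul_sub, eRoot_commutator_first hi, eForm,
    smul_mul_assoc, smul_neg]

theorem eForm_commutator_last {d i : ℕ} (hi : i + d + 2 < n) :
    eForm n (d + 1) i * uF n (i + d + 1) - uF n (i + d + 1) * eForm n (d + 1) i =
      qpow (-1) • (eForm n d i * (uK n (i + d + 1) * uKinv n (i + d + 2))) := by
  rw [eForm, smul_mul_assoc, mul_smul_comm, ← smul_sub, eRoot_commutator_last hi, eForm,
    smul_mul_assoc, smul_comm (qpow (-1)), qK, algebraMap_smul]

theorem eForm_commutator_eq_zero {d i k : ℕ} (hn : i + d + 1 < n) (h1 : k ≠ i)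
    (h2 : k ≠ i + d) : eForm n d i * uF n k - uF n k * eForm n d i = 0 := by
  have hc : Commute (eRoot n d i) (uF n k) := by
    rcases lt_or_gt_of_ne h1 with h | h
    · exact commute_eRoot_uF (Or.inl h)
    · rcases lt_or_gt_of_ne h2 with h' | h'
      · exact eRoot_commutator_mid h h' hn
      · exact commute_eRoot_uF (Or.inr h')
  rw [eForm, smul_mul_assoc, mul_smul_comm, hc.eq, sub_self]

theorem eRoot_smul_eq_zero (hu : ∀ a, uE n a • u = 0) : ∀ d i, eRoot n d i • u = 0
  | 0, i => hu i
  | d + 1, i => by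
    rw [eRoot, sub_smul, mul_smul, eRoot_smul_eq_zero hu d, smul_assoc, mul_smul, hu, smul_zero,
      smul_zero, smul_zero, sub_zero]

theorem eForm_mul_uK (d i l : ℕ) : eForm n d i * uK n l =
    qpow (-((if l = i then 1 else 0) - (if l = i + d + 1 then 1 else 0))) •
      (uK n l * eForm n d i) := by
  rw [eForm, mul_smul_comm, uK_mul_eRoot, smul_mul_assoc, smul_comm qDelta,
    ← algebraMap_smul Kh (qpow _), smul_smul]
  rw [← qK, ← qK_add, neg_add_cancel, qK_zero, one_smul]

theorem eForm_mul_uKinv (d i l : ℕ) : eForm n d i * uKinv n l =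
    qpow ((if l = i then 1 else 0) - (if l = i + d + 1 then 1 else 0)) •
      (uKinv n l * eForm n d i) := by
  rw [eForm, mul_smul_comm, uKinv_mul_eRoot, smul_mul_assoc, smul_comm qDelta,
    ← algebraMap_smul Kh (qpow _), smul_smul]
  rw [← qK, ← qK_add, add_neg_cancel, qK_zero, one_smul]

theorem IsHighest.eForm_mul_mem_fSpan (h : IsHighest c cinv u) {x : Verma μ} {d i : ℕ}
    (hx : eForm n d i • x ∈ fSpan u) (a b : ℕ) :
    (eForm n d i * (uK n a * uKinv n b)) • x ∈ fSpan u ∧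
      (eForm n d i * (uKinv n a * uK n b)) • x ∈ fSpan u := by
  constructor
  · rw [← mul_assoc, eForm_mul_uK, smul_mul_assoc, mul_assoc, eForm_mul_uKinv, smul_assoc, mul_smul,
      smul_assoc, mul_smul]
    exact Submodule.smul_mem _ _
      (h.uK_mem_fSpan _ (Submodule.smul_mem _ _ (h.uKinv_mem_fSpan _ hx)))
  · rw [← mul_assoc, eForm_mul_uKinv, smul_mul_assoc, mul_assoc, eForm_mul_uK, smul_assoc, mul_smul,
      smul_assoc, mul_smul]
    exact Submodule.smul_mem _ _
      (h.uKinv_mem_fSpan _ (Submodule.smul_mem _ _ (h.uK_mem_fSpan _ hx)))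

/-- The span of words is stable under `(q - q⁻¹) e_γ`: commutators with the `f_k` produce no
denominators. -/
theorem IsHighest.eForm_mem_fSpan (h : IsHighest c cinv u) {x : Verma μ} (hx : x ∈ fSpan u)
    {d i : ℕ} (hn : i + d + 1 < n) : eForm n d i • x ∈ fSpan u := by
  -- the vectors that all `(q - q⁻¹) e_γ` map to the span form a submodule stable under the `f_k`
  let S : Submodule Rh (Verma μ) := fSpan u ⊓
    ⨅ (d : ℕ) (i : ℕ) (_ : i + d + 1 < n),
      (fSpan u).comap (Algebra.lsmul Rh Rh (Verma μ) (eForm n d i))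
  have hS : ∀ x, x ∈ S ↔ x ∈ fSpan u ∧ ∀ d i, i + d + 1 < n → eForm n d i • x ∈ fSpan u := by
    simp [S]
  refine ((hS x).1 (fSpan_le ((hS u).2 ⟨mem_fSpan u, fun d i _ => ?_⟩) (fun k hk x hx => ?_) hx)).2
    d i hn
  · rw [eForm, smul_assoc, eRoot_smul_eq_zero h.e, smul_zero]
    exact zero_mem _
  · obtain ⟨hx1, hx2⟩ := (hS x).1 hx
    refine (hS _).2 ⟨uF_mem_fSpan hx1 k, fun d i hn => ?_⟩
    have key : (eForm n d i * uF n k - uF n k * eForm n d i) • x ∈ fSpan u := by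
      rcases d with _ | d
      · rcases eq_or_ne k i with rfl | hki
        · rw [eForm_zero_commutator hk, sub_smul, mul_smul, mul_smul]
          exact sub_mem (h.uK_mem_fSpan _ (h.uKinv_mem_fSpan _ hx1))
            (h.uKinv_mem_fSpan _ (h.uK_mem_fSpan _ hx1))
        · rw [eForm_commutator_eq_zero (d := 0) hn hki hki, zero_smul]
          exact zero_mem _
      · rcases eq_or_ne k i with rfl | hki
        · rw [eForm_commutator_first hk, neg_smul]
          exact neg_mem (h.eForm_mul_mem_fSpan (hx2 d (k + 1) (by omega)) _ _).2
        · rcases eq_or_ne k (i + (d + 1)) with rfl | hki'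
          · rw [← add_assoc, eForm_commutator_last (by omega), smul_assoc]
            exact Submodule.smul_mem _ _
              (h.eForm_mul_mem_fSpan (hx2 d i (by omega)) _ _).1
          · rw [eForm_commutator_eq_zero hn hki hki', zero_smul]
            exact zero_mem _
    rw [sub_smul, mul_smul, mul_smul] at key
    have := add_mem key (uF_mem_fSpan (hx2 d i hn) k)
    rwa [sub_add_cancel] at this

/-- The subalgebra of elements that preserve `fSpan`. -/
def formStab (u : Verma μ) : Subalgebra Rh (Uq n) where
  carrier := {T | ∀ x ∈ fSpan u, T • x ∈ fSpan u}
  mul_mem' {S T} hS hT x hx := by rw [mul_smul]; exact hS _ (hT _ hx)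
  add_mem' {S T} hS hT x hx := by rw [add_smul]; exact add_mem (hS _ hx) (hT _ hx)
  algebraMap_mem' r x hx := by rw [algebraMap_smul]; exact Submodule.smul_mem _ _ hx

theorem uF_mem_formStab (k : ℕ) : uF n k ∈ formStab u := fun _ hx => uF_mem_fSpan hx k

theorem IsHighest.uK_mem_formStab (h : IsHighest c cinv u) (k : ℕ) : uK n k ∈ formStab u :=
  fun _ hx => h.uK_mem_fSpan k hx

theorem IsHighest.uKinv_mem_formStab (h : IsHighest c cinv u) (k : ℕ) :
    uKinv n k ∈ formStab u :=
  fun _ hx => h.uKinv_mem_fSpan k hx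

theorem IsHighest.eForm_mem_formStab (h : IsHighest c cinv u) {d i : ℕ} (hn : i + d + 1 < n) :
    eForm n d i ∈ formStab u :=
  fun _ hx => h.eForm_mem_fSpan hx hn

theorem IsHighest.uqForm_le_formStab (h : IsHighest c cinv u) : uqForm n ≤ formStab u := by
  refine Algebra.adjoin_le ?_
  rintro _ (((⟨i, rfl⟩ | ⟨i, rfl⟩) | ⟨a, rfl⟩) | ⟨a, rfl⟩)
  · simpa using h.uK_mem_formStab i
  · simpa using h.uKinv_mem_formStab i
  · simpa using uF_mem_formStab (u := u) a
  · have h1 := h.eForm_mem_formStab (d := 0) (i := a) (by omega)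
    rwa [eForm, eRoot, uE_val] at h1

end FSpan

/-! ### Reduction modulo `ħ` -/

section Reduction

attribute [local instance] LieRing.ofAssociativeRing

variable {P : Type*} [AddCommGroup P] [Module Rh P]

/-- The submodule `ħ P`. -/
def hbarSub (P : Type*) [AddCommGroup P] [Module Rh P] : Submodule Rh P :=
  LinearMap.range (LinearMap.lsmul Rh P PowerSeries.X)

/-- The reduction `P / ħ P`. -/
abbrev Reduced (P : Type*) [AddCommGroup P] [Module Rh P] : Type _ := P ⧸ hbarSub P

theorem reduced_smul_eq {r s : Rh} (h : PowerSeries.constantCoeff r = PowerSeries.constantCoeff s)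
    (x : Reduced P) : r • x = s • x := by
  obtain ⟨x, rfl⟩ := (hbarSub P).mkQ_surjective x
  have h0 : PowerSeries.constantCoeff (r - s) = 0 := by rw [map_sub, h, sub_self]
  obtain ⟨t, ht⟩ := PowerSeries.X_dvd_iff.2 h0
  rw [← sub_eq_zero, ← sub_smul, ← map_smul, ht]
  exact (Submodule.Quotient.mk_eq_zero _).2 ⟨t • x, (mul_smul _ _ _).symm⟩

theorem qpow_smul_reduced_end (a : ℂ) (T : Module.End Rh (Reduced P)) : qpow a • T = T := by
  ext x
  simpa using reduced_smul_eq (r := qpow a) (s := 1) (by simp [constantCoeff_qpow]) (T _)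

theorem smul_lie_end (r : Rh) (S T : Module.End Rh P) : ⁅r • S, T⁆ = r • ⁅S, T⁆ := by
  ext x
  simp [Ring.lie_def, smul_sub]

/-- Reduction of endomorphisms modulo `ħ`. -/
def reduceEnd (P : Type*) [AddCommGroup P] [Module Rh P] :
    Module.End Rh P →ₐ[Rh] Module.End Rh (Reduced P) where
  toFun T := (hbarSub P).mapQ (hbarSub P) T <| by
    rintro _ ⟨z, rfl⟩
    exact ⟨T z, by simp⟩
  map_one' := by ext; rfl
  map_mul' _ _ := by ext; rfl
  map_zero' := by ext; rfl
  map_add' _ _ := by ext; rfl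
  commutes' _ := by ext; rfl

variable {n : ℕ} {μ : Weight n}

/-- The action of the elements that preserve `fSpan u` on `fSpan u`. -/
def actEnd (u : Verma μ) : formStab u →ₐ[Rh] Module.End Rh (fSpan u) where
  toFun T := (Algebra.lsmul Rh Rh (Verma μ) T.1).restrict T.2
  map_one' := by ext; simp
  map_mul' S T := by ext x; exact mul_smul S.1 T.1 x.1
  map_zero' := by ext; simp
  map_add' S T := by ext x; exact add_smul S.1 T.1 x.1
  commutes' _ := by ext; simp

/-- The action of the elements that preserve `fSpan u` on its reduction modulo `ħ`. -/
def redAct (u : Verma μ) : formStab u →ₐ[Rh] Module.End Rh (Reduced (fSpan u)) :=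
  (reduceEnd _).comp (actEnd u)

theorem redAct_mk {u : Verma μ} (T : formStab u) (x : fSpan u) :
    redAct u T ((hbarSub (fSpan u)).mkQ x) = (hbarSub (fSpan u)).mkQ ⟨T.1 • x.1, T.2 x x.2⟩ := rfl

/-- The reduction of the generating vector. -/
def redVec (u : Verma μ) : Reduced (fSpan u) := (hbarSub (fSpan u)).mkQ ⟨u, mem_fSpan u⟩

/-- The action of `f_k` modulo `ħ`. -/
def redF (u : Verma μ) (k : ℕ) : Module.End Rh (Reduced (fSpan u)) :=
  redAct u ⟨uF n k, uF_mem_formStab k⟩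

theorem redVec_cyclic (u : Verma μ) (S : Submodule Rh (Reduced (fSpan u))) (hu : redVec u ∈ S)
    (hS : ∀ k, k + 1 < n → ∀ x ∈ S, redF u k x ∈ S) : S = ⊤ := by
  have h1 : fSpan u ≤ (S.comap (hbarSub (fSpan u)).mkQ).map (fSpan u).subtype := by
    refine fSpan_le ⟨⟨u, mem_fSpan u⟩, hu, rfl⟩ ?_
    rintro k hk _ ⟨x, hx, rfl⟩
    exact ⟨⟨uF n k • x.1, uF_mem_fSpan x.2 k⟩, hS k hk _ hx, rfl⟩
  refine eq_top_iff.2 fun x _ => ?_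
  obtain ⟨x, rfl⟩ := (hbarSub (fSpan u)).mkQ_surjective x
  obtain ⟨y, hy, hyx⟩ := h1 x.2
  rwa [Subtype.ext (show y.1 = x.1 from hyx)] at hy

theorem redAct_eq_smul_one {u : Verma μ} {T : formStab u} {a : ℕ → ℂ}
    (hT : ∀ k, T.1 * uF n k = qK (a k) • (uF n k * T.1)) {r : Rh} (hu : T.1 • u = r • u) :
    redAct u T = r • 1 := by
  have h1 : ∀ k, redAct u T * redF u k = redF u k * redAct u T := by
    intro k
    rw [redF, ← map_mul, ← map_mul]
    rw [← qpow_smul_reduced_end (a k) (redAct u (_ * T)), ← map_smul]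
    congr 1
    refine Subtype.ext ((hT k).trans ?_)
    rw [qK, algebraMap_smul]
    rfl
  have h2 : LinearMap.eqLocus (redAct u T) (r • 1) = ⊤ := by
    refine redVec_cyclic u _ ?_ fun k _ x hx => ?_
    · rw [LinearMap.mem_eqLocus, redVec, redAct_mk]
      exact congrArg _ (Subtype.ext hu)
    · rw [LinearMap.mem_eqLocus] at hx ⊢
      have h3 := LinearMap.congr_fun (h1 k) x
      rw [Module.End.mul_apply, Module.End.mul_apply, hx] at h3
      simpa using h3
  exact LinearMap.ext fun x => by
    have : x ∈ LinearMap.eqLocus (redAct u T) (r • 1) := h2 ▸ Submodule.mem_top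
    exact this

variable {c cinv : ℕ → Rh} {u : Verma μ}

theorem IsHighest.redAct_uK (h : IsHighest c cinv u) (i : ℕ) :
    redAct u ⟨uK n i, h.uK_mem_formStab i⟩ = c i • 1 :=
  redAct_eq_smul_one (fun k => isPreUq_uq.k_f i k) (h.k i)

theorem IsHighest.redAct_uKinv (h : IsHighest c cinv u) (i : ℕ) :
    redAct u ⟨uKinv n i, h.uKinv_mem_formStab i⟩ = cinv i • 1 :=
  redAct_eq_smul_one (fun k => isPreUq_uq.kinv_f i k) (h.kinv i)

/-- Modulo `ħ` the quantum Serre relations become the Serre relations. -/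
theorem isSerre_redF (u : Verma μ) : IsSerre (redF u) := by
  have hs : ∀ a b, (a + 1 = b ∨ b + 1 = a) → ⁅redF u a, ⁅redF u a, redF u b⁆⁆ = 0 := by
    intro a b hab
    have h1 := qSerre_uF (n := n) hab
    rw [qSerre] at h1
    have h2 : (⟨uF n a, uF_mem_formStab a⟩ * ⟨uF n a, uF_mem_formStab a⟩ *
        ⟨uF n b, uF_mem_formStab b⟩ - (qpow 1 + qpow (-1)) •
        (⟨uF n a, uF_mem_formStab a⟩ * ⟨uF n b, uF_mem_formStab b⟩ *
        ⟨uF n a, uF_mem_formStab a⟩) + ⟨uF n b, uF_mem_formStab b⟩ *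
        ⟨uF n a, uF_mem_formStab a⟩ * ⟨uF n a, uF_mem_formStab a⟩ : formStab u) = 0 := by
      refine Subtype.ext (Eq.trans ?_ h1)
      rw [qK, qK, ← map_add, algebraMap_smul]
      rfl
    have h3 := congrArg (redAct u) h2
    rw [map_add, map_sub, map_smul, map_mul, map_mul, map_mul, map_mul, map_mul, map_mul,
      map_zero, add_smul, qpow_smul_reduced_end, qpow_smul_reduced_end] at h3
    change redF u a * redF u a * redF u b - (redF u a * redF u b * redF u a +
      redF u a * redF u b * redF u a) + redF u b * redF u a * redF u a = 0 at h3
    rw [← h3, Ring.lie_def, Ring.lie_def, mul_sub, sub_mul]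
    simp only [mul_assoc]
    abel
  refine ⟨fun a b hab => ?_, fun a => hs _ _ (Or.inl rfl), fun a => hs _ _ (Or.inr rfl)⟩
  rw [Ring.lie_def, redF, redF, ← map_mul, ← map_mul, sub_eq_zero]
  exact congrArg _ (Subtype.ext (uF_comm hab).eq)

theorem eRoot_of_le : ∀ {d i : ℕ}, n ≤ i + d + 1 → eRoot n d i = 0
  | 0, i, h => uE_of_le (by omega)
  | d + 1, i, h => by rw [eRoot, eRoot_of_le (by omega), mul_zero, zero_mul, smul_zero, sub_zero]

theorem IsHighest.eForm_mem_formStab' (h : IsHighest c cinv u) (d i : ℕ) :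
    eForm n d i ∈ formStab u := by
  rcases lt_or_ge (i + d + 1) n with hn | hn
  · exact h.eForm_mem_formStab hn
  · rw [eForm, eRoot_of_le hn, smul_zero]
    exact zero_mem _

/-- The action of `(q - q⁻¹) e_γ` modulo `ħ`. -/
def IsHighest.redE (h : IsHighest c cinv u) (d i : ℕ) : Module.End Rh (Reduced (fSpan u)) :=
  redAct u ⟨eForm n d i, h.eForm_mem_formStab' d i⟩

theorem IsHighest.redE_zero_lie (h : IsHighest c cinv u) {i : ℕ} (hi : i + 1 < n) :
    ⁅h.redE 0 i, redF u i⁆ = (c i * cinv (i + 1) - cinv i * c (i + 1)) • 1 := by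
  have h1 : (⟨eForm n 0 i, h.eForm_mem_formStab' 0 i⟩ * ⟨uF n i, uF_mem_formStab i⟩ -
      ⟨uF n i, uF_mem_formStab i⟩ * ⟨eForm n 0 i, h.eForm_mem_formStab' 0 i⟩ : formStab u) =
      ⟨uK n i, h.uK_mem_formStab i⟩ * ⟨uKinv n (i + 1), h.uKinv_mem_formStab _⟩ -
        ⟨uKinv n i, h.uKinv_mem_formStab i⟩ * ⟨uK n (i + 1), h.uK_mem_formStab _⟩ :=
    Subtype.ext (eForm_zero_commutator hi)
  have h2 := congrArg (redAct u) h1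
  simp only [map_sub, map_mul, h.redAct_uK, h.redAct_uKinv, smul_mul_assoc, one_mul, smul_smul,
    ← sub_smul] at h2
  exact h2

theorem IsHighest.redE_lie_first (h : IsHighest c cinv u) {d i : ℕ} (hi : i + 1 < n) :
    ⁅h.redE (d + 1) i, redF u i⁆ = -((cinv i * c (i + 1)) • h.redE d (i + 1)) := by
  have h1 : (⟨eForm n (d + 1) i, h.eForm_mem_formStab' _ _⟩ * ⟨uF n i, uF_mem_formStab i⟩ -
      ⟨uF n i, uF_mem_formStab i⟩ * ⟨eForm n (d + 1) i, h.eForm_mem_formStab' _ _⟩ : formStab u) =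
      -(⟨eForm n d (i + 1), h.eForm_mem_formStab' _ _⟩ *
        (⟨uKinv n i, h.uKinv_mem_formStab i⟩ * ⟨uK n (i + 1), h.uK_mem_formStab _⟩)) :=
    Subtype.ext (eForm_commutator_first hi)
  have h2 := congrArg (redAct u) h1
  simp only [map_sub, map_mul, map_neg, h.redAct_uK, h.redAct_uKinv, smul_smul, mul_smul_comm,
    mul_one] at h2
  rwa [mul_comm (c _)] at h2

theorem IsHighest.redE_lie_last (h : IsHighest c cinv u) {d i : ℕ} (hi : i + d + 2 < n) :
    ⁅h.redE (d + 1) i, redF u (i + d + 1)⁆ =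
      (c (i + d + 1) * cinv (i + d + 2)) • h.redE d i := by
  have h1 : (⟨eForm n (d + 1) i, h.eForm_mem_formStab' _ _⟩ *
      ⟨uF n (i + d + 1), uF_mem_formStab _⟩ - ⟨uF n (i + d + 1), uF_mem_formStab _⟩ *
      ⟨eForm n (d + 1) i, h.eForm_mem_formStab' _ _⟩ : formStab u) =
      qpow (-1) • (⟨eForm n d i, h.eForm_mem_formStab' _ _⟩ *
        (⟨uK n (i + d + 1), h.uK_mem_formStab _⟩ *
          ⟨uKinv n (i + d + 2), h.uKinv_mem_formStab _⟩)) :=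
    Subtype.ext (eForm_commutator_last hi)
  have h2 := congrArg (redAct u) h1
  simp only [map_sub, map_mul, map_smul, h.redAct_uK, h.redAct_uKinv, mul_smul_comm, mul_one] at h2
  rw [qpow_smul_reduced_end, smul_smul, mul_comm (cinv _)] at h2
  exact h2

theorem IsHighest.redE_lie_eq_zero (h : IsHighest c cinv u) {d i k : ℕ} (h1 : k ≠ i)
    (h2 : k ≠ i + d) : ⁅h.redE d i, redF u k⁆ = 0 := by
  have h3 : eForm n d i * uF n k - uF n k * eForm n d i = 0 := by
    rcases lt_or_ge (i + d + 1) n with hn | hn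
    · exact eForm_commutator_eq_zero hn h1 h2
    · rw [eForm, eRoot_of_le hn, smul_zero, zero_mul, mul_zero, sub_zero]
  have h4 : (⟨eForm n d i, h.eForm_mem_formStab' _ _⟩ * ⟨uF n k, uF_mem_formStab k⟩ -
      ⟨uF n k, uF_mem_formStab k⟩ * ⟨eForm n d i, h.eForm_mem_formStab' _ _⟩ : formStab u) = 0 :=
    Subtype.ext h3
  have h5 := congrArg (redAct u) h4
  rw [map_zero, map_sub, map_mul, map_mul] at h5
  exact h5

/-- The upper triangular matrix with entries `q^{h_{ε_i}} q^{h_{ε_j}} (q - q⁻¹) e_{ε_i - ε_j}` above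
the diagonal and `q^{2 h_{ε_i}}` on the diagonal, modulo `ħ`. -/
def IsHighest.redG (h : IsHighest c cinv u) (i j : ℕ) : Module.End Rh (Reduced (fSpan u)) :=
  if i = j then (c i * c i) • 1 else if i < j then (c i * c j) • h.redE (j - i - 1) i else 0

theorem IsHighest.isConjAction (h : IsHighest c cinv u) (hc : ∀ i, c i * cinv i = 1) :
    IsConjAction n (redF u) h.redG (fun i => c i * c i) (redVec u) where
  serre := isSerre_redF u
  two x hx := by
    have h2 : IsUnit (2 : Rh) := by
      rw [PowerSeries.isUnit_iff_constantCoeff, map_ofNat]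
      exact isUnit_iff_ne_zero.2 two_ne_zero
    have h3 : (2 : Rh) • x = 0 := by rw [two_smul]; exact add_eq_zero_iff_eq_neg.2 hx
    exact h2.smul_eq_zero.1 h3
  lie_f i j k hk := by
    have hdiag : ∀ i, h.redG i i = (c i * c i) • 1 := fun i => if_pos rfl
    have hlow : ∀ i j, j < i → h.redG i j = 0 := fun i j hij => by
      rw [redG, if_neg (by omega), if_neg (by omega)]
    have hup : ∀ d i, h.redG i (i + d + 1) = (c i * c (i + d + 1)) • h.redE d i := fun d i => by
      rw [redG, if_neg (by omega), if_pos (by omega), show i + d + 1 - i - 1 = d by omega]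
    rcases lt_trichotomy i j with hij | rfl | hij
    · obtain ⟨d, rfl⟩ : ∃ d, j = i + d + 1 := ⟨j - i - 1, by omega⟩
      rw [hup, smul_lie_end]
      rcases d with _ | d
      · rcases eq_or_ne k i with rfl | hki
        · rw [if_pos rfl, if_pos rfl, h.redE_zero_lie hk, add_zero, hdiag, hdiag, smul_smul]
          refine Eq.trans ?_ (sub_smul _ _ _)
          congr 1
          linear_combination (c k * c k) * hc (k + 1) - (c (k + 1) * c (k + 1)) * hc k
        · rw [if_neg (by omega), if_neg (by omega), h.redE_lie_eq_zero (d := 0) hki hki, smul_zero,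
              sub_zero]
      · rcases eq_or_ne k i with rfl | hki
        · rw [if_neg (by omega), if_pos rfl, h.redE_lie_first hk,
            show k + (d + 1) + 1 = k + 1 + d + 1 by omega, hup, smul_neg, smul_smul, zero_sub]
          congr 2
          linear_combination (c (k + 1) * c (k + 1 + d + 1)) * hc k
        · rw [if_neg (Ne.symm hki), sub_zero]
          rcases eq_or_ne k (i + d + 1) with rfl | hki'
          · rw [if_pos (by omega), h.redE_lie_last hk, hup, smul_smul]
            congr 1
            rw [show i + (d + 1) + 1 = i + d + 2 by omega]
            linear_combination (c i * c (i + d + 1)) * hc (i + d + 2)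
          · rw [if_neg (by omega), h.redE_lie_eq_zero hki (by omega), smul_zero]
    · rw [hdiag, Ring.lie_def, smul_mul_assoc, mul_smul_comm, one_mul, mul_one, sub_self]
      split_ifs with h1 h2 h2
      · omega
      · rw [hlow _ _ (by omega), sub_zero]
      · rw [hlow _ _ (by omega), sub_zero]
      · rw [sub_zero]
    · rw [hlow _ _ hij, zero_lie]
      split_ifs with h1 h2 h2
      · omega
      · rw [hlow _ _ (by omega), sub_zero]
      · rw [hlow _ _ (by omega), sub_zero]
      · rw [sub_zero]
  diag i := if_pos rfl
  lower i j hij := by rw [redG, if_neg (by omega), if_neg (by omega)]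
  vec i j hij := by
    have h1 : h.redE (j - i - 1) i (redVec u) = 0 := by
      rw [redE, redVec, redAct_mk]
      have h2 : eForm n (j - i - 1) i • u = 0 := by
        rw [eForm, smul_assoc, eRoot_smul_eq_zero h.e, smul_zero]
      rw [← map_zero (hbarSub (fSpan u)).mkQ]
      exact congrArg _ (Subtype.ext h2)
    rw [redG, if_neg (by omega), if_pos hij, LinearMap.smul_apply, h1, smul_zero]
  cyclic := redVec_cyclic u

end Reduction

/-! ### Rescaled dynamical root vectors -/

section FForm

attribute [local instance] LieRing.ofAssociativeRing

variable {n : ℕ} {μ : Weight n} {c cinv : ℕ → Rh} {u : Verma μ}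

/-- The rescaled dynamical root vector `(q - q⁻¹)^d f̌_γ`, where `γ = ε_i - ε_{i+d+1}`. -/
def fForm (d i : ℕ) (h : i + d + 1 < n) : Uq n := qDelta ^ d • fCheckAux d i h

theorem fForm_zero (i : ℕ) (h : i + 0 + 1 < n) : fForm 0 i h = uF n i := by
  rw [fForm, fCheckAux, pow_zero, one_smul]
  exact (uF_val (n := n) ⟨i, by omega⟩).symm

theorem fForm_succ (d i : ℕ) (h : i + (d + 1) + 1 < n) :
    fForm (n := n) (d + 1) i h =
      uF n i * fForm d (i + 1) (by omega) *
          (qDelta • bracketH ⟨i + 1, by omega⟩ ⟨i + d + 2, by omega⟩ (d + 1)) -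
        fForm d (i + 1) (by omega) * uF n i *
          (qDelta • bracketH ⟨i + 1, by omega⟩ ⟨i + d + 2, by omega⟩ d) := by
  rw [fForm, fCheckAux_succ, fForm]
  simp only [smul_sub, pow_succ, smul_mul_assoc, mul_smul_comm, smul_smul, mul_comm qDelta]

theorem fForm_mem_uqForm (d i : ℕ) (h : i + d + 1 < n) : fForm d i h ∈ uqForm n :=
  fCheckAux_mem d i h

theorem qDelta_smul_bracketH' {i j : ℕ} (hi : i < n) (hj : j < n) (s : ℂ) :
    qDelta • bracketH (n := n) ⟨i, hi⟩ ⟨j, hj⟩ s =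
      qpow s • (uK n i * uKinv n j) - qpow (-s) • (uKinv n i * uK n j) := by
  rw [qDelta_smul_bracketH, ← uK_val, ← uKinv_val, ← uK_val, ← uKinv_val]

/-- The action of a rescaled dynamical root vector modulo `ħ`. -/
def IsHighest.redFForm (hu : IsHighest c cinv u) (d i : ℕ) (h : i + d + 1 < n) :
    Module.End Rh (Reduced (fSpan u)) :=
  redAct u ⟨fForm d i h, hu.uqForm_le_formStab (fForm_mem_uqForm d i h)⟩

theorem IsHighest.redFForm_succ (hu : IsHighest c cinv u) (d i : ℕ)
    (h : i + (d + 1) + 1 < n) : hu.redFForm (d + 1) i h =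
      -(c (i + 1) * cinv (i + d + 2) - cinv (i + 1) * c (i + d + 2)) •
        ⁅hu.redFForm d (i + 1) (by omega), redF u i⁆ := by
  have hb : ∀ s, ∃ B : formStab u, B.1 = qDelta • bracketH (n := n) ⟨i + 1, by omega⟩
      ⟨i + d + 2, by omega⟩ s ∧ redAct u B =
        (c (i + 1) * cinv (i + d + 2) - cinv (i + 1) * c (i + d + 2)) • 1 := by
    intro s
    refine ⟨qpow s • (⟨uK n (i + 1), hu.uK_mem_formStab _⟩ *
      ⟨uKinv n (i + d + 2), hu.uKinv_mem_formStab _⟩) -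
      qpow (-s) • (⟨uKinv n (i + 1), hu.uKinv_mem_formStab _⟩ *
      ⟨uK n (i + d + 2), hu.uK_mem_formStab _⟩), (qDelta_smul_bracketH' _ _ s).symm, ?_⟩
    rw [map_sub, map_smul, map_smul, map_mul, map_mul, hu.redAct_uK, hu.redAct_uKinv,
      hu.redAct_uK, hu.redAct_uKinv, qpow_smul_reduced_end, qpow_smul_reduced_end]
    ext x
    simp [smul_smul, sub_smul, mul_comm]
  obtain ⟨B1, hB1, hr1⟩ := hb (d + 1)
  obtain ⟨B2, hB2, hr2⟩ := hb d
  have h1 : (⟨fForm (d + 1) i h, hu.uqForm_le_formStab (fForm_mem_uqForm _ i h)⟩ : formStab u) =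
      ⟨uF n i, uF_mem_formStab i⟩ * ⟨fForm d (i + 1) (by omega), hu.uqForm_le_formStab
        (fForm_mem_uqForm d (i + 1) _)⟩ * B1 -
      ⟨fForm d (i + 1) (by omega), hu.uqForm_le_formStab
        (fForm_mem_uqForm d (i + 1) _)⟩ * ⟨uF n i, uF_mem_formStab i⟩ * B2 := by
    refine Subtype.ext ((fForm_succ d i h).trans ?_)
    rw [← hB1, ← hB2]
    rfl
  have h2 := congrArg (redAct u) h1
  rw [map_sub, map_mul, map_mul, map_mul, map_mul, hr1, hr2] at h2
  refine h2.trans ?_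
  change redF u i * hu.redFForm d (i + 1) _ * _ - hu.redFForm d (i + 1) _ * redF u i * _ = _
  generalize c (i + 1) * cinv (i + d + 2) - cinv (i + 1) * c (i + d + 2) = b
  ext x
  simp only [neg_smul, LinearMap.comp_apply, LinearMap.sub_apply, LinearMap.neg_apply,
    LinearMap.smul_apply, Module.End.mul_apply, Module.End.one_apply, Ring.lie_def, map_smul,
    smul_sub]
  abel

/-- Modulo `ħ` the rescaled dynamical root vector is a unit multiple of the classical root vector,
if the eigenvalues of the `q^{2h}` at the indices between are distinct from the last one. -/
theorem IsHighest.redFForm_eq (hu : IsHighest c cinv u) (d : ℕ) : ∀ (i : ℕ) (h : i + d + 1 < n),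
    (∀ p, i < p → p < i + d + 1 →
      IsUnit (c p * cinv (i + d + 1) - cinv p * c (i + d + 1))) →
    ∃ t : Rh, IsUnit t ∧ hu.redFForm d i h = t • lieRoot (redF u) d i := by
  induction d with
  | zero =>
    intro i h _
    refine ⟨1, isUnit_one, ?_⟩
    have h1 : (⟨fForm 0 i h, hu.uqForm_le_formStab (fForm_mem_uqForm 0 i h)⟩ : formStab u) =
        ⟨uF n i, uF_mem_formStab i⟩ := Subtype.ext (fForm_zero i h)
    rw [one_smul, lieRoot, redF, ← h1, redFForm]
  | succ d ih =>
    intro i h H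
    have e : i + 1 + d + 1 = i + (d + 1) + 1 := by omega
    obtain ⟨t, ht, h1⟩ := ih (i + 1) (by omega) fun p h1 h2 => by
      rw [e]
      exact H p (by omega) (by omega)
    have h2 := H (i + 1) (by omega) (by omega)
    rw [show i + (d + 1) + 1 = i + d + 2 by omega] at h2
    refine ⟨_, h2.neg.mul ht, ?_⟩
    rw [hu.redFForm_succ, h1, smul_lie_end, smul_smul, lieRoot]

theorem IsHighest.fForm_mem_fDeg (hu : IsHighest c cinv u) (d : ℕ) :
    ∀ (i : ℕ) (h : i + d + 1 < n) (e : ℕ) (x : Verma μ), x ∈ fDeg u e →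
      fForm d i h • x ∈ fDeg u (e + d + 1) := by
  induction d with
  | zero =>
    intro i h e x hx
    rw [fForm_zero]
    exact uF_mem_fDeg hx i
  | succ d ih =>
    intro i h e x hx
    have hb : ∀ s, (qDelta • bracketH (n := n) ⟨i + 1, by omega⟩ ⟨i + d + 2, by omega⟩ s) • x ∈
        fDeg u e := by
      intro s
      rw [qDelta_smul_bracketH', sub_smul, smul_assoc, smul_assoc, mul_smul, mul_smul]
      exact sub_mem
        (Submodule.smul_mem _ _ (hu.uK_mem_fDeg _ (hu.uKinv_mem_fDeg _ hx)))
        (Submodule.smul_mem _ _ (hu.uKinv_mem_fDeg _ (hu.uK_mem_fDeg _ hx)))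
    rw [fForm_succ, sub_smul, mul_smul, mul_smul, mul_smul, mul_smul]
    refine sub_mem (uF_mem_fDeg (ih _ _ _ _ (hb _)) i) ?_
    have h1 := ih (i + 1) (by omega) _ _ (uF_mem_fDeg (hb d) i)
    rwa [show e + 1 + d + 1 = e + (d + 1) + 1 by omega] at h1

theorem word_mem_fDeg {x : Verma μ} {e : ℕ} (hx : x ∈ fDeg u e) (L : List (Fin (n - 1))) :
    (L.map uf).prod • x ∈ fDeg u (L.length + e) := by
  induction L with
  | nil => simpa using hx
  | cons k L ih =>
    have h1 := uF_mem_fDeg ih k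
    rw [uF_val, smul_smul] at h1
    rwa [List.map_cons, List.prod_cons, List.length_cons, add_right_comm]

theorem fDeg_le_fDeg {x : Verma μ} {e : ℕ} (hx : x ∈ fDeg u e) (d : ℕ) :
    fDeg x d ≤ fDeg u (d + e) := by
  refine Submodule.span_le.2 ?_
  rintro _ ⟨L, rfl, rfl⟩
  exact word_mem_fDeg hx L

theorem IsHighest.fForm_smul (hu : IsHighest c cinv u) (d i : ℕ) (h : i + d + 1 < n)
    (he : ∀ a, uE n a • fCheckAux (n := n) d i h • u = 0) :
    IsHighest
      (fun l => qpow ((if l = i + d + 1 then 1 else 0) - (if l = i then 1 else 0)) * c l)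
      (fun l => qpow (-((if l = i + d + 1 then 1 else 0) - (if l = i then 1 else 0))) * cinv l)
      (fForm d i h • u) where
  k l := by
    rw [fForm, smul_assoc, smul_comm (uK n l), smul_smul, uK_mul_fCheckAux, smul_assoc, mul_smul,
      hu.k, qK_smul_verma, smul_comm _ (c l), smul_smul, smul_smul, smul_smul]
    congr 1
    ring
  kinv l := by
    rw [fForm, smul_assoc, smul_comm (uKinv n l), smul_smul,
      isPreUq_uq.kinv_mul_of_k_mul (uK_mul_fCheckAux l d i h), smul_assoc, mul_smul,
      hu.kinv, qK_smul_verma, smul_comm _ (cinv l), smul_smul, smul_smul, smul_smul]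
    congr 1
    ring
  e a := by rw [fForm, smul_assoc, smul_comm (uE n a), he, smul_zero]

end FForm

/-! ### The submodule generated by singular vectors -/

section Grading

variable {n : ℕ} {μ : Weight n} {c cinv : ℕ → Rh} {u : Verma μ}

instance (μ : Weight n) : Module.IsTorsionFree Rh (Verma μ) := by
  rw [Module.isTorsionFree_iff_smul_eq_zero]
  intro r x h
  rw [← algebraMap_smul Kh r x, smul_eq_zero] at h
  exact h.imp_left fun h => (IsFractionRing.to_map_eq_zero_iff (K := Kh)).1 h

/-- There is a product of the `q^{h}` that commutes with all `f_α` up to the same power of `q`, so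
that its eigenvalues separate the lengths of words. -/
theorem IsHighest.exists_grading (hu : IsHighest c cinv u) (hc : ∀ i, c i ≠ 0) :
    ∃ (T : Uq n) (r : Rh), r ≠ 0 ∧ T • u = r • u ∧
      ∀ k : Fin (n - 1), T * uf k = qK (-1) • (uf k * T) := by
  -- the product of the first `m` of the `q^{h_{ε_i}}` sees only the root `α_{m-1}`
  have hP : ∀ m : ℕ, ∃ (T : Uq n) (r : Rh), r ≠ 0 ∧ T • u = r • u ∧
      ∀ k : Fin (n - 1), T * uf k = qK (if k + 1 = m then -1 else 0) • (uf k * T) := by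
    intro m
    induction m with
    | zero => exact ⟨1, 1, one_ne_zero, by simp, fun k => by simp [qK_zero]⟩
    | succ m ih =>
      obtain ⟨T, r, hr, hT, hk⟩ := ih
      refine ⟨T * uK n m, r * c m, mul_ne_zero hr (hc m), ?_, fun k => ?_⟩
      · rw [mul_smul, hu.k, smul_comm, hT, smul_smul, mul_comm]
      · rw [mul_assoc, uK_mul_uf, mul_smul_comm, ← mul_assoc, hk, smul_mul_assoc, smul_smul,
          ← qK_add, mul_assoc, wtPair]
        congr 2
        split_ifs <;> first | omega | norm_num
  -- the products of these products give each root `α_k` with `k < m` the same weight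
  have hT : ∀ m : ℕ, ∃ (T : Uq n) (r : Rh), r ≠ 0 ∧ T • u = r • u ∧
      ∀ k : Fin (n - 1), T * uf k = qK (if k < m then -1 else 0) • (uf k * T) := by
    intro m
    induction m with
    | zero => exact ⟨1, 1, one_ne_zero, by simp, fun k => by simp [qK_zero]⟩
    | succ m ih =>
      obtain ⟨T, r, hr, hT, hk⟩ := ih
      obtain ⟨T', r', hr', hT', hk'⟩ := hP (m + 1)
      refine ⟨T * T', r * r', mul_ne_zero hr hr', ?_, fun k => ?_⟩
      · rw [mul_smul, hT', smul_comm, hT, smul_smul, mul_comm]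
      · rw [mul_assoc, hk', mul_smul_comm, ← mul_assoc, hk, smul_mul_assoc, smul_smul,
          ← qK_add, mul_assoc]
        congr 2
        split_ifs <;> first | omega | norm_num
  obtain ⟨T, r, hr, hT, hk⟩ := hT (n - 1)
  exact ⟨T, r, hr, hT, fun k => by rw [hk, if_pos k.2]⟩

theorem qpow_neg_natCast_injective : Function.Injective fun d : ℕ => qpow (-(d : ℂ)) := by
  intro a b h
  have h1 := congrArg (PowerSeries.coeff 1) h
  simpa [qpow, PowerSeries.coeff_rescale, PowerSeries.coeff_exp] using h1

/-- Freeness of the quotient of the span of words by a graded submodule that is saturated up to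
multiples of `ħ`. -/
theorem IsHighest.free_quotient (hu : IsHighest c cinv u) (hc : ∀ i, c i ≠ 0)
    {N : Submodule Rh (Verma μ)} (hN : N ≤ ⨆ d, N ⊓ fDeg u d)
    (hkey : ∀ x ∈ saturation (N.comap (fSpan u).subtype), ∃ y ∈ N.comap (fSpan u).subtype, ∃ z,
      x = y + (PowerSeries.X : Rh) • z) :
    Module.Free Rh (fSpan u ⧸ N.comap (fSpan u).subtype) := by
  obtain ⟨T, r, hr, hT, hk⟩ := hu.exists_grading hc
  have hT' : ∀ d, ∀ x ∈ fDeg u d, T • x = (qpow (-(d : ℂ)) * r) • x := by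
    intro d x hx
    have hle : fDeg u d ≤ LinearMap.eqLocus (Algebra.lsmul Rh Rh (Verma μ) T)
        ((qpow (-(d : ℂ)) * r) • LinearMap.id) := by
      refine Submodule.span_le.2 ?_
      rintro _ ⟨L, rfl, rfl⟩
      have h1 := smul_word (a := fun _ => -1) hk hT L
      rw [List.map_const', List.sum_replicate, nsmul_eq_mul, mul_neg_one] at h1
      exact h1
    exact hle hx
  have hTV : ∀ x ∈ fSpan u, T • x ∈ fSpan u := fun x =>
    mem_fSpan_of_fDeg fun d x hx => by
      rw [hT' d x hx]
      exact Submodule.smul_mem _ _ (fDeg_le_fSpan _ _ hx)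
  have hmap : ∀ S : Submodule Rh (Verma μ), S ≤ fSpan u →
      (S.comap (fSpan u).subtype).map (fSpan u).subtype = S := fun S hS => by
    rw [Submodule.map_comap_subtype, inf_eq_right.2 hS]
  have hinj := (fSpan u).injective_subtype
  refine free_quotient_of_graded (D := fun d => (fDeg u d).comap (fSpan u).subtype) ?_ ?_
    ((Algebra.lsmul Rh Rh (Verma μ) T).restrict hTV) (χ := fun d => qpow (-(d : ℂ)) * r) ?_ ?_ ?_
    hkey
  · apply Submodule.map_injective_of_injective hinj
    rw [Submodule.map_iSup, Submodule.map_top, Submodule.range_subtype]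
    exact (iSup_congr fun d => hmap _ (fDeg_le_fSpan u d)).trans (iSup_fDeg u)
  · intro d
    apply Submodule.fg_of_fg_map_injective _ hinj
    rw [hmap _ (fDeg_le_fSpan u d)]
    exact fDeg_fg u d
  · exact fun a b h => qpow_neg_natCast_injective (mul_right_cancel₀ hr h)
  · exact fun d x hx => Subtype.ext (hT' d x hx)
  · rw [← Submodule.map_le_map_iff_of_injective hinj, Submodule.map_iSup]
    refine (Submodule.map_comap_le _ _).trans (hN.trans (iSup_mono fun d => ?_))
    rw [← Submodule.comap_inf, hmap _ (inf_le_right.trans (fDeg_le_fSpan u d))]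

end Grading

/-! ### Quotients of the Verma module by singular vectors -/

section SingularQuotient

attribute [local instance] LieRing.ofAssociativeRing

variable {n : ℕ} {μ : Weight n}

theorem Weight.constantCoeff_qN (μ : Weight n) (i : Fin n) :
    PowerSeries.constantCoeff (μ.qN i) = Complex.exp (μ.polar i) := by
  rw [Weight.qN_val, Weight.q, map_mul, constantCoeff_qpow, mul_one, PowerSeries.constantCoeff_C]

theorem Weight.isUnit_qN (μ : Weight n) (i : ℕ) : IsUnit (μ.qN i) := by
  rcases lt_or_ge i n with h | h
  · lift i to Fin n using h
    rw [PowerSeries.isUnit_iff_constantCoeff, Weight.constantCoeff_qN]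
    exact isUnit_iff_ne_zero.2 (Complex.exp_ne_zero _)
  · rw [Weight.qN, dif_neg h.not_gt]
    exact isUnit_one

theorem isHighest_vermaVec (μ : Weight n) :
    IsHighest μ.qN (fun i => Ring.inverse (μ.qN i)) (vermaVec μ) where
  k i := by rw [hasWt_vermaVec μ i, algebraMap_smul]
  kinv i := by
    have h1 : uK n i • vermaVec μ = μ.qN i • vermaVec μ := by
      rw [hasWt_vermaVec μ i, algebraMap_smul]
    have h2 := congrArg (fun x => Ring.inverse (μ.qN i) • uKinv n i • x) h1
    simp only [smul_smul (uKinv n i) (uK n i), isPreUq_uq.kinv_k, one_smul] at h2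
    rw [h2, smul_comm (uKinv n i), smul_smul, Ring.inverse_mul_cancel _ (μ.isUnit_qN i), one_smul]
  e := uE_vermaVec μ

theorem iSup_fSpan_smul_mem {ι : Type*} {w : ι → Verma μ} {T : Uq n}
    (hT : ∀ t, T ∈ formStab (w t)) {x : Verma μ} (hx : x ∈ ⨆ t, fSpan (w t)) :
    T • x ∈ ⨆ t, fSpan (w t) := by
  induction hx using Submodule.iSup_induction' with
  | mem t x hx => exact Submodule.mem_iSup_of_mem t (hT t x hx)
  | zero => rw [smul_zero]; exact zero_mem _
  | add x y _ _ hx hy => rw [smul_add]; exact add_mem hx hy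

/-- A linear form on the Verma module with value `1` on the highest weight vector, which vanishes on
everything generated by the dynamical root vectors. -/
theorem exists_highest_coeff (μ : Weight n) : ∃ ε : Verma μ →ₗ[Rh] Kh, ε (vermaVec μ) = 1 ∧
    (∀ k, k + 1 < n → ∀ x, ε (uF n k • x) = 0) ∧
    ∀ d i h, ε (fForm (n := n) d i h • vermaVec μ) = 0 := by
  obtain ⟨Φ, hv, hf, hc⟩ := exists_vermaVec_map μ 0
  have hc' : ∀ (c : Kh) (x : Verma μ), Φ (c • x) = c • Φ x := hc
  let ε : Verma μ →ₗ[Rh] Kh :=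
    { toFun := fun x => Φ x 0
      map_add' := fun x y => by rw [map_add, Pi.add_apply]
      map_smul' := fun r x => by
        rw [← algebraMap_smul Kh r x, hc', Pi.smul_apply, RingHom.id_apply, algebraMap_smul] }
  refine ⟨ε, ?_, fun k hk x => ?_, fun d i h => ?_⟩
  · change Φ (vermaVec μ) 0 = 1
    rw [hv, Pi.single_eq_same]
  · change Φ (uF n k • x) 0 = 0
    rw [map_uF_smul hf hk]
    simp [colShift]
  · have h1 : Φ (fCheckAux (n := n) d i h • vermaVec μ) 0 = 0 :=
      map_fCheckAux_apply_eq_zero hf hc' d i h _ μ.qN_ne_zero _ (hasWt_vermaVec μ) 0 (Nat.zero_le i)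
    rw [fForm, smul_assoc, map_smul]
    change _ • Φ _ 0 = 0
    rw [h1, smul_zero]

section Family

variable {ι : Type*} {d i : ι → ℕ} (hn : ∀ t, i t + d t + 1 < n)
  (hsing : ∀ t a, uE n a • fCheckAux (d t) (i t) (hn t) • vermaVec μ = 0)

/-- The submodule generated by the vectors `(q - q⁻¹)^d f̌_γ v_μ`, for a family of roots `γ`. -/
def singSpan (μ : Weight n) (hn : ∀ t, i t + d t + 1 < n) : Submodule Rh (Verma μ) :=
  ⨆ t, fSpan (fForm (d t) (i t) (hn t) • vermaVec μ)

include hsing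

theorem uqForm_smul_mem_singSpan {T : Uq n} (hT : T ∈ uqForm n) {x : Verma μ}
    (hx : x ∈ singSpan μ hn) : T • x ∈ singSpan μ hn :=
  iSup_fSpan_smul_mem
    (fun t => ((isHighest_vermaVec μ).fForm_smul _ _ (hn t) (hsing t)).uqForm_le_formStab hT) hx

theorem eForm_smul_mem_singSpan (e j : ℕ) {x : Verma μ} (hx : x ∈ singSpan μ hn) :
    eForm n e j • x ∈ singSpan μ hn :=
  iSup_fSpan_smul_mem
    (fun t => ((isHighest_vermaVec μ).fForm_smul _ _ (hn t) (hsing t)).eForm_mem_formStab' e j) hx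

omit hsing in
theorem uF_smul_mem_singSpan (k : ℕ) {x : Verma μ} (hx : x ∈ singSpan μ hn) :
    uF n k • x ∈ singSpan μ hn :=
  iSup_fSpan_smul_mem (fun _ => uF_mem_formStab k) hx

omit hsing in
theorem singSpan_le_iSup : singSpan μ hn ≤ ⨆ e, singSpan μ hn ⊓ fDeg (vermaVec μ) e := by
  refine iSup_le fun t => ?_
  rw [← iSup_fDeg]
  refine iSup_le fun e => ?_
  refine le_trans (le_inf ?_ (fDeg_le_fDeg
    ((isHighest_vermaVec μ).fForm_mem_fDeg _ _ (hn t) 0 _ (mem_fDeg_zero _)) e))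
    (le_iSup (fun e => singSpan μ hn ⊓ fDeg (vermaVec μ) e) (e + (0 + d t + 1)))
  exact (fDeg_le_fSpan _ _).trans (le_iSup (fun t => fSpan (fForm (d t) (i t) (hn t) • vermaVec μ))
      t)

/-- Freeness of the quotient by a family of singular vectors. The set `Ψ` contains the positive
roots whose indices are separated by the eigenvalues of the `q^{2h}` modulo `ħ`, and the other root
vectors, applied to the highest weight vector, are generated by the given family modulo `ħ`. -/
theorem free_quotient_singSpan
    (hsep : ∀ t p, i t < p → p < i t + d t + 1 →
      IsUnit (μ.qN p * μ.qN p - μ.qN (i t + d t + 1) * μ.qN (i t + d t + 1)))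
    {Ψ : Finset (ℕ × ℕ)} (hΨ : Ψ ⊆ posPairs n)
    (hu : ∀ p ∈ Ψ, IsUnit (μ.qN p.1 * μ.qN p.1 - μ.qN p.2 * μ.qN p.2))
    (hΨJ : ∀ J : Submodule Rh (Reduced (fSpan (vermaVec μ))),
      (∀ k, k + 1 < n → ∀ x ∈ J, redF (vermaVec μ) k x ∈ J) →
      (∀ t, lieRoot (redF (vermaVec μ)) (d t) (i t) (redVec (vermaVec μ)) ∈ J) →
      ∀ p ∈ posPairs n, p ∉ Ψ → pairRoot (redF (vermaVec μ)) p (redVec (vermaVec μ)) ∈ J) :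
    Module.Free Rh (fSpan (vermaVec μ) ⧸ (singSpan μ hn).comap (fSpan (vermaVec μ)).subtype) := by
  set v := vermaVec μ with hv
  have hhv := isHighest_vermaVec μ
  have hcinv : ∀ i, μ.qN i * Ring.inverse (μ.qN i) = 1 := fun i =>
    Ring.mul_inverse_cancel _ (μ.isUnit_qN i)
  refine hhv.free_quotient (fun i => (μ.isUnit_qN i).ne_zero) (singSpan_le_iSup hn) ?_
  set N := (singSpan μ hn).comap (fSpan v).subtype with hN
  have hact := hhv.isConjAction hcinv
  let π := (hbarSub (fSpan v)).mkQ
  let J := N.map π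
  let Z := (saturation N).map π
  have hJf : ∀ k, k + 1 < n → ∀ x ∈ J, redF v k x ∈ J := by
    rintro k - _ ⟨x, hx, rfl⟩
    exact ⟨⟨uF n k • x.1, uF_mem_fSpan x.2 k⟩, uF_smul_mem_singSpan hn k hx, rfl⟩
  have hJt : ∀ t, lieRoot (redF v) (d t) (i t) (redVec v) ∈ J := by
    intro t
    obtain ⟨r, hr, h1⟩ := hhv.redFForm_eq (d t) (i t) (hn t) fun p h1 h2 => by
      have h3 := (((μ.isUnit_qN p).ringInverse).mul
        (μ.isUnit_qN (i t + d t + 1)).ringInverse).mul (hsep t p h1 h2)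
      have h4 : ∀ {a b a' b' : Rh}, a * a' = 1 → b * b' = 1 →
          a * b' - a' * b = a' * b' * (a * a - b * b) := fun {a b a' b'} ha hb => by
        linear_combination (-(a * b')) * ha + (a' * b) * hb
      rwa [← h4 (hcinv p) (hcinv _)] at h3
    have h2 : r • lieRoot (redF v) (d t) (i t) (redVec v) ∈ J := by
      rw [← LinearMap.smul_apply, ← h1]
      refine ⟨⟨fForm (d t) (i t) (hn t) • v, hhv.uqForm_le_formStab
        (fForm_mem_uqForm _ _ _) _ (mem_fSpan v)⟩, ?_, rfl⟩
      exact Submodule.mem_iSup_of_mem t (mem_fSpan _)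
    obtain ⟨s, hs⟩ := hr.exists_left_inv
    have h3 := J.smul_mem s h2
    rwa [smul_smul, hs, one_smul] at h3
  have hJZ : J ≤ Z := Submodule.map_mono (le_saturation N)
  -- the saturation is stable under the positive part and does not involve the highest weight vector
  have hZ : ∀ i j, i < j → ∀ x ∈ Z, hhv.redG i j x ∈ Z := by
    rintro i j hij _ ⟨x, ⟨r, hr, hx⟩, rfl⟩
    rw [IsHighest.redG, if_neg hij.ne, if_pos hij, LinearMap.smul_apply]
    refine Z.smul_mem _ ⟨⟨eForm n (j - i - 1) i • x.1, hhv.eForm_mem_formStab' _ _ _ x.2⟩,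
      ⟨r, hr, ?_⟩, rfl⟩
    have h1 := eForm_smul_mem_singSpan hn hsing (j - i - 1) i hx
    change r • eForm n (j - i - 1) i • x.1 ∈ singSpan μ hn
    rw [smul_comm]
    exact h1
  have hvZ : ∀ r : Rh, r • redVec v ∈ Z → r • redVec v = 0 := by
    rintro r ⟨x, ⟨s, hs, hx⟩, hxr⟩
    obtain ⟨ε, hε1, hεf, hεw⟩ := exists_highest_coeff μ
    have hker : singSpan μ hn ≤ LinearMap.ker ε := iSup_le fun t =>
      fSpan_le (hεw _ _ _) fun k hk x _ => hεf k hk x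
    have hεx : ε x.1 = 0 := by
      have h1 : ε (s • x.1) = 0 := hker hx
      rw [map_smul] at h1
      exact (smul_eq_zero.1 h1).resolve_left hs
    have hrange : fSpan v ≤ (LinearMap.range (Algebra.linearMap Rh Kh)).comap ε :=
      fSpan_le ⟨1, by simp [hv, hε1]⟩ fun k hk x _ => ⟨0, by rw [hεf k hk, map_zero]⟩
    have h2 : x - r • ⟨v, mem_fSpan v⟩ ∈ hbarSub (fSpan v) := by
      rw [← Submodule.Quotient.mk_eq_zero, Submodule.Quotient.mk_sub, sub_eq_zero]
      exact hxr
    obtain ⟨z, hz⟩ := h2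
    obtain ⟨y, hy⟩ := hrange z.2
    have h3 := congrArg (fun w : fSpan v => ε w.1) hz
    have h4 : (PowerSeries.X : Rh) • ε z.1 = ε x.1 - r • ε v := by
      rw [← map_smul, ← map_smul, ← map_sub]
      exact h3
    have h5 : PowerSeries.X * y = -r := by
      apply IsFractionRing.injective Rh Kh
      rw [hεx, show ε v = 1 from hε1, ← (show algebraMap Rh Kh y = ε z.1 from hy), zero_sub,
        Algebra.smul_def,
        Algebra.smul_def, mul_one] at h4
      rw [map_mul, map_neg, h4]
    have h6 : PowerSeries.constantCoeff r = PowerSeries.constantCoeff (0 : Rh) := by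
      have h7 := congrArg PowerSeries.constantCoeff h5
      rw [map_mul, PowerSeries.constantCoeff_X, zero_mul, map_neg] at h7
      rw [map_zero]
      exact neg_eq_zero.1 h7.symm
    rw [reduced_smul_eq h6, zero_smul]
  have hnat : ∀ r : ℕ, r ≠ 0 → IsUnit (r : Rh) := by
    intro r hr
    rw [PowerSeries.isUnit_iff_constantCoeff, map_natCast]
    exact isUnit_iff_ne_zero.2 (Nat.cast_ne_zero.2 hr)
  have hle : Z ≤ J := hact.le_of_stable
    (u := fun p => Ring.inverse (μ.qN p.1 * μ.qN p.1 - μ.qN p.2 * μ.qN p.2))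
    (fun p hp x hx => IsConjAction.pairRoot_mem hJf hp hx) hΨ
    (fun p hp => Ring.inverse_mul_cancel _ (hu p hp)) (hΨJ J hJf hJt) hnat hZ hJZ hvZ
  intro x hx
  obtain ⟨y, hy, hyx⟩ := hle ⟨x, hx, rfl⟩
  have h1 : x - y ∈ hbarSub (fSpan v) := by
    rw [← Submodule.Quotient.mk_eq_zero, Submodule.Quotient.mk_sub, sub_eq_zero]
    exact hyx.symm
  obtain ⟨z, hz⟩ := h1
  exact ⟨y, hy, z, sub_eq_iff_eq_add'.1 hz.symm⟩

end Family

end SingularQuotient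

/-! ### Blocks of a composition and regular weights -/

section Blocks

variable {n : ℕ} {c : Composition n} {a : Fin n → ℂ} {σ : Equiv.Perm (Fin n)}

/-- A block of a composition is an interval. -/
theorem index_eq_of_between {i j k : Fin n} (hij : c.index i = c.index j) (h1 : i ≤ k)
    (h2 : k ≤ j) : c.index k = c.index i := by
  symm
  rw [← c.mem_range_embedding_iff', c.mem_range_embedding_iff]
  have h3 := c.sizeUpTo_index_le i
  have h4 := c.lt_sizeUpTo_index_succ j
  rw [← hij] at h4
  exact ⟨h3.trans h1, lt_of_le_of_lt h2 h4⟩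

theorem eq_of_index_eq_of_le (ha : a ∈ cReg c) (m : ℕ) : ∀ i j : Fin n, (j : ℕ) = i + m →
    c.index i = c.index j → a i = a j := by
  induction m with
  | zero => exact fun i j h _ => by rw [show i = j from Fin.ext h.symm]
  | succ m ih =>
    intro i j h hij
    have h1 : (i : ℕ) + m < n := by omega
    have h2 : c.index ⟨i + m, h1⟩ = c.index i :=
      index_eq_of_between hij (Fin.le_def.2 (by simp)) (Fin.le_def.2 (by simp [h]))
    have h3 := ha.1 ⟨i + m, by omega⟩ (by
      have h4 : hi (n := n) ⟨i + m, by omega⟩ = j := Fin.ext (by simp [hi, h, add_assoc])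
      rw [leviSimple, Set.mem_ofPred_eq, h4, ← hij]
      exact h2)
    have h4 : hi (n := n) ⟨i + m, by omega⟩ = j := Fin.ext (by simp [hi, h, add_assoc])
    rw [h4] at h3
    exact (ih i ⟨i + m, h1⟩ rfl h2.symm).trans h3

theorem eq_of_index_eq (ha : a ∈ cReg c) {i j : Fin n} (hij : c.index i = c.index j) :
    a i = a j := by
  rcases le_total i j with h | h
  · exact eq_of_index_eq_of_le ha (j - i) i j (by have := Fin.le_def.1 h; omega) hij
  · exact (eq_of_index_eq_of_le ha (i - j) j i (by have := Fin.le_def.1 h; omega) hij.symm).symm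

theorem exp_ne_of_index_ne (ha : a ∈ cReg c) {i j : Fin n} (hij : c.index i ≠ c.index j) :
    Complex.exp (2 * a i) ≠ Complex.exp (2 * a j) := by
  have h1 : ∀ i, a (firstIndex c (c.index i)) = a i := fun i =>
    eq_of_index_eq ha (c.index_embedding _ _)
  intro h
  refine hij (ha.2 ?_)
  simpa only [h1] using h

theorem lo_lt_hi (α : Fin (n - 1)) : lo α < hi α := Fin.lt_def.2 (by simp [lo, hi])

/-- The indices between `σ(lo α)` and `σ(hi α)` come from other blocks. -/
theorem index_ne_of_between (hσ : Admissible c σ) {α : Fin (n - 1)} (hα : α ∈ leviSimple c)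
    {p : Fin n} (h1 : σ (lo α) < p) (h2 : p < σ (hi α)) :
    c.index (σ⁻¹ p) ≠ c.index (hi α) := by
  intro h
  have hσp : σ (σ⁻¹ p) = p := σ.apply_symm_apply p
  have hα' : c.index (lo α) = c.index (hi α) := hα
  rcases lt_trichotomy (σ⁻¹ p) (lo α) with h3 | h3 | h3
  · have := hσ _ _ (h.trans hα'.symm) h3
    rw [hσp] at this
    exact lt_asymm this h1
  · rw [← h3, hσp] at h1
    exact lt_irrefl _ h1
  · rcases lt_trichotomy (σ⁻¹ p) (hi α) with h4 | h4 | h4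
    · rw [Fin.lt_def] at h3 h4
      simp only [lo, hi] at h3 h4
      omega
    · rw [← h4, hσp] at h2
      exact lt_irrefl _ h2
    · have := hσ _ _ h.symm h4
      rw [hσp] at this
      exact lt_asymm this h2

/-- The weight `σ · λ` for `λ = ħ⁻¹ a`. -/
abbrev dotWeight (a : Fin n → ℂ) (σ : Equiv.Perm (Fin n)) : Weight n := (Weight.ofPolar a).dot σ

theorem isUnit_qN_sub (ha : a ∈ cReg c) {i j : Fin n} (hij : c.index (σ⁻¹ i) ≠ c.index (σ⁻¹ j)) :
    IsUnit ((dotWeight a σ).qN i * (dotWeight a σ).qN i -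
      (dotWeight a σ).qN j * (dotWeight a σ).qN j) := by
  rw [PowerSeries.isUnit_iff_constantCoeff, map_sub, map_mul, map_mul, Weight.constantCoeff_qN,
    Weight.constantCoeff_qN, ← Complex.exp_add, ← Complex.exp_add, ← two_mul, ← two_mul]
  exact isUnit_iff_ne_zero.2 (sub_ne_zero.2 (exp_ne_of_index_ne ha hij))

theorem qN_hi (ha : a ∈ cReg c) {α : Fin (n - 1)} (hα : α ∈ leviSimple c) {d : ℕ}
    (hd : (σ (hi α) : ℕ) = σ (lo α) + d + 1) :
    (dotWeight a σ).qN (σ (hi α)) = qpow d * (dotWeight a σ).qN (σ (lo α)) := by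
  rw [Weight.qN_val, Weight.qN_val, Weight.q, Weight.q, mul_left_comm, ← qpow_add]
  have h1 : ∀ i, σ⁻¹ (σ i) = i := σ.symm_apply_apply
  simp only [Weight.dot, Weight.ofPolar, h1, ha.1 α hα, Pi.zero_apply]
  congr 2
  have h2 : ((hi α : ℕ) : ℂ) = (lo α : ℕ) + 1 := by simp [lo, hi]
  simp only [rho, hd, h2]
  push_cast
  ring

end Blocks

/-! ### Freeness of `M_{σ·λ}` -/

section Final

attribute [local instance] LieRing.ofAssociativeRing

variable {n : ℕ} {c : Composition n} {a : Fin n → ℂ} {σ : Equiv.Perm (Fin n)}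

theorem fCheck_of_lt {i j : Fin n} (h : i < j) :
    fCheck i j = fCheckAux (j - i - 1) i (by have := Fin.lt_def.1 h; omega) := dif_pos h

theorem lt_of_leviSimple (hσ : Admissible c σ) {α : Fin (n - 1)} (hα : α ∈ leviSimple c) :
    σ (lo α) < σ (hi α) := hσ _ _ hα (lo_lt_hi α)

theorem qK_mul_qN (ha : a ∈ cReg c) {α : Fin (n - 1)}
    (hα : α ∈ leviSimple c) {d : ℕ} (hd : (σ (hi α) : ℕ) = σ (lo α) + d + 1) :
    qK d * (algebraMap Rh Kh ((dotWeight a σ).qN (σ (lo α))) *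
      (algebraMap Rh Kh ((dotWeight a σ).qN (σ (lo α) + d + 1)))⁻¹) = 1 := by
  have h1 := (dotWeight a σ).qN_ne_zero (σ (lo α))
  have h2 := qK_ne_zero d
  rw [← hd, qN_hi ha hα hd, map_mul, ← qK]
  field_simp

theorem isSingular_fCheck (ha : a ∈ cReg c) (hσ : Admissible c σ) {α : Fin (n - 1)}
    (hα : α ∈ leviSimple c) :
    IsSingular (fCheck (σ (lo α)) (σ (hi α)) • vermaVec (dotWeight a σ)) := by
  have hlt := lt_of_leviSimple hσ hα
  have hlt' := Fin.lt_def.1 hlt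
  have hd : (σ (hi α) : ℕ) = σ (lo α) + (σ (hi α) - σ (lo α) - 1 : ℕ) + 1 := by omega
  rw [fCheck_of_lt hlt]
  refine isSingular_fCheckAux _ _ _ (qK_mul_qN ha hα hd) fun p h1 h2 s h0 => ?_
  rw [← hd] at h0 h2
  have hp : p < n := by omega
  lift p to Fin n using hp
  have hu := isUnit_qN_sub (σ := σ) (i := p) (j := σ (hi α)) ha (by
    rw [show σ⁻¹ (σ (hi α)) = hi α from σ.symm_apply_apply _]
    exact index_ne_of_between hσ hα h1 h2)
  have hx := (dotWeight a σ).qN_ne_zero p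
  have hy := (dotWeight a σ).qN_ne_zero (σ (hi α))
  have hq := qK_ne_zero s
  have h3 := (mul_eq_zero.1 h0).resolve_left (inv_ne_zero qDeltaK_ne_zero)
  have h4 : (qK s * algebraMap Rh Kh ((dotWeight a σ).qN p)) ^ 2 =
      (algebraMap Rh Kh ((dotWeight a σ).qN (σ (hi α)))) ^ 2 := by
    field_simp at h3
    linear_combination h3
  have h5 : (qpow s * (dotWeight a σ).qN p) ^ 2 = ((dotWeight a σ).qN (σ (hi α))) ^ 2 := by
    apply IsFractionRing.injective Rh Kh
    rw [map_pow, map_mul, map_pow]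
    exact h4
  -- the constant coefficients of both sides are different
  have h6 := congrArg PowerSeries.constantCoeff h5
  rw [map_pow, map_mul, map_pow, constantCoeff_qpow, one_mul] at h6
  have h7 := hu.map (PowerSeries.constantCoeff (R := ℂ))
  rw [map_sub, map_mul, map_mul, ← sq, ← sq, h6, sub_self] at h7
  exact not_isUnit_zero h7

/-- The root vectors of a block are generated by those of the simple roots of the block. -/
theorem pairRoot_mem_of_block (hσ : Admissible c σ) {μ : Weight n}
    {J : Submodule Rh (Reduced (fSpan (vermaVec μ)))}
    (hJ : ∀ k, k + 1 < n → ∀ x ∈ J, redF (vermaVec μ) k x ∈ J)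
    (hJα : ∀ α ∈ leviSimple c,
      pairRoot (redF (vermaVec μ)) (σ (lo α), σ (hi α)) (redVec (vermaVec μ)) ∈ J) (m : ℕ) :
    ∀ i j : Fin n, (j : ℕ) = i + m + 1 → c.index i = c.index j →
      pairRoot (redF (vermaVec μ)) (σ i, σ j) (redVec (vermaVec μ)) ∈ J := by
  induction m with
  | zero =>
    intro i j h hij
    have h1 : lo (n := n) ⟨i, by omega⟩ = i := rfl
    have h2 : hi (n := n) ⟨i, by omega⟩ = j := Fin.ext (by simp [hi, h])
    have h3 := hJα ⟨i, by omega⟩ (by rw [leviSimple, Set.mem_ofPred_eq, h1, h2]; exact hij)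
    rwa [h1, h2] at h3
  | succ m ih =>
    intro i j h hij
    have hk : (i : ℕ) + m + 1 < n := by omega
    have h1 : c.index ⟨i + m + 1, hk⟩ = c.index i :=
      index_eq_of_between hij (Fin.le_def.2 (by dsimp only; omega))
        (Fin.le_def.2 (by dsimp only; omega))
    have h2 := ih i ⟨i + m + 1, hk⟩ rfl h1.symm
    have e1 : lo (n := n) ⟨i + m + 1, by omega⟩ = ⟨i + m + 1, hk⟩ := rfl
    have e2 : hi (n := n) ⟨i + m + 1, by omega⟩ = j := Fin.ext (by simp [hi, h]; omega)
    have h3 := hJα ⟨i + m + 1, by omega⟩ (by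
      rw [leviSimple, Set.mem_ofPred_eq, e1, e2, h1, hij])
    rw [e1, e2] at h3
    have l1 := Fin.lt_def.1 (hσ i ⟨i + m + 1, hk⟩ h1.symm (Fin.lt_def.2 (by dsimp only; omega)))
    have l2 := Fin.lt_def.1 (hσ ⟨i + m + 1, hk⟩ j (h1.trans hij) (Fin.lt_def.2 (by
      dsimp only
      omega)))
    have hjn := (σ j).2
    generalize (σ i : ℕ) = x at *
    generalize (σ ⟨i + m + 1, hk⟩ : ℕ) = y at *
    generalize (σ j : ℕ) = z at *
    have h4 : pairRoot (redF (vermaVec μ)) (x, z) =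
        ⁅pairRoot (redF (vermaVec μ)) (y, z), pairRoot (redF (vermaVec μ)) (x, y)⁆ := by
      have h5 := (isSerre_redF (vermaVec μ)).lieRoot_split (z - y - 1) (y - x - 1) x
      rw [show x + (y - x - 1) + 1 = y by omega,
        show z - y - 1 + (y - x - 1) + 1 = z - x - 1 by omega] at h5
      exact h5.symm
    rw [h4, Ring.lie_def, LinearMap.sub_apply, Module.End.mul_apply, Module.End.mul_apply]
    exact sub_mem
      (IsConjAction.pairRoot_mem hJ (mem_posPairs.2 ⟨l2, hjn⟩) h2)
      (IsConjAction.pairRoot_mem hJ (mem_posPairs.2 ⟨l1, l2.trans hjn⟩) h3)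

theorem levi_lt (hσ : Admissible c σ) (α : leviSimple c) :
    (σ (lo α.1) : ℕ) + (σ (hi α.1) - σ (lo α.1) - 1 : ℕ) + 1 < n := by
  have := Fin.lt_def.1 (lt_of_leviSimple hσ α.2)
  omega

theorem uE_fCheckAux_levi (ha : a ∈ cReg c) (hσ : Admissible c σ) (α : leviSimple c) (k : ℕ) :
    uE n k • fCheckAux _ _ (levi_lt hσ α) • vermaVec (dotWeight a σ) = 0 :=
  uE_fCheckAux_vermaVec _ _ _ (qK_mul_qN ha α.2 (by
    have := Fin.lt_def.1 (lt_of_leviSimple hσ α.2)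
    omega)) k

theorem free_quotient_levi (ha : a ∈ cReg c) (hσ : Admissible c σ) :
    Module.Free Rh (fSpan (vermaVec (dotWeight a σ)) ⧸
      (singSpan (dotWeight a σ) (levi_lt hσ)).comap (fSpan (vermaVec (dotWeight a σ))).subtype) := by
  classical
  have hinv : ∀ i, σ⁻¹ (σ i) = i := σ.symm_apply_apply
  have hinv' : ∀ i, σ (σ⁻¹ i) = i := σ.apply_symm_apply
  refine free_quotient_singSpan (levi_lt hσ) (uE_fCheckAux_levi ha hσ) (fun α p h1 h2 => ?_)
    (Ψ := (posPairs n).filter fun p => ∃ i j : Fin n, (i : ℕ) = p.1 ∧ (j : ℕ) = p.2 ∧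
      c.index (σ⁻¹ i) ≠ c.index (σ⁻¹ j)) (Finset.filter_subset _ _) (fun p hp => ?_)
    fun J hJ hJα p hp hpΨ => ?_
  · have hlt := Fin.lt_def.1 (lt_of_leviSimple hσ α.2)
    have e : (σ (lo α.1) : ℕ) + (σ (hi α.1) - σ (lo α.1) - 1 : ℕ) + 1 = σ (hi α.1) := by omega
    rw [e] at h2 ⊢
    have hp : p < n := by omega
    lift p to Fin n using hp
    refine isUnit_qN_sub ha ?_
    rw [hinv]
    exact index_ne_of_between hσ α.2 h1 h2
  · obtain ⟨-, i, j, h1, h2, h3⟩ := Finset.mem_filter.1 hp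
    rw [← h1, ← h2]
    exact isUnit_qN_sub ha h3
  · obtain ⟨x, y⟩ := p
    obtain ⟨hxy, hy⟩ := mem_posPairs.1 hp
    dsimp only at hxy hy
    lift y to Fin n using hy
    lift x to Fin n using hxy.trans y.2
    have hidx : c.index (σ⁻¹ x) = c.index (σ⁻¹ y) := by
      by_contra h
      exact hpΨ (Finset.mem_filter.2 ⟨hp, x, y, rfl, rfl, h⟩)
    have hlt : σ⁻¹ x < σ⁻¹ y := by
      rcases lt_trichotomy (σ⁻¹ x) (σ⁻¹ y) with h | h | h
      · exact h
      · rw [σ⁻¹.injective h] at hxy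
        exact absurd hxy (lt_irrefl _)
      · have h1 := hσ _ _ hidx.symm h
        rw [hinv', hinv', Fin.lt_def] at h1
        omega
    have h1 := pairRoot_mem_of_block hσ hJ (fun α hα => hJα ⟨α, hα⟩)
      ((σ⁻¹ y : ℕ) - (σ⁻¹ x : ℕ) - 1) (σ⁻¹ x) (σ⁻¹ y) (by rw [Fin.lt_def] at hlt; omega) hidx
    rwa [hinv', hinv'] at h1

variable {μ : Weight n}

theorem word_mem_uqForm (L : List (Fin (n - 1))) : (L.map uf).prod ∈ uqForm n :=
  list_prod_mem fun x hx => by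
    obtain ⟨k, -, rfl⟩ := List.mem_map.1 hx
    exact uf_mem k

theorem mem_vermaForm_iff {x : Verma μ} : x ∈ vermaForm μ ↔ x ∈ fSpan (vermaVec μ) := by
  constructor
  · intro hx
    induction hx using Submodule.span_induction with
    | mem x hx => rw [Set.mem_singleton_iff.1 hx]; exact mem_fSpan _
    | zero => exact zero_mem _
    | add x y _ _ hx hy => exact add_mem hx hy
    | smul T x _ hx => exact (isHighest_vermaVec μ).uqForm_le_formStab T.2 x hx
  · intro hx
    induction hx using Submodule.span_induction with
    | mem x hx =>
      obtain ⟨L, rfl⟩ := hx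
      exact (vermaForm μ).smul_mem (⟨_, word_mem_uqForm L⟩ : UqForm n)
        (Submodule.mem_span_singleton_self _)
    | zero => exact zero_mem _
    | add x y _ _ hx hy => exact add_mem hx hy
    | smul r x _ hx =>
      have h1 := (vermaForm μ).smul_mem (algebraMap Rh (UqForm n) r) hx
      have h2 : algebraMap Rh (UqForm n) r • x = r • x := algebraMap_smul (Uq n) r x
      rwa [h2] at h1

theorem fCheckForm_smul (hσ : Admissible c σ) (α : leviSimple c) :
    ((fCheckForm (σ (lo α.1)) (σ (hi α.1)) • vermaFormVec μ : VermaForm μ) : vermaForm μ).1 =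
      fForm _ _ (levi_lt hσ α) • vermaVec μ := by
  change (qDelta ^ _ • fCheck _ _ : Uq n) • vermaVec μ = _
  rw [fCheck_of_lt (lt_of_leviSimple hσ α.2), fForm]

theorem mem_singularSubmodule_iff (ha : a ∈ cReg c) (hσ : Admissible c σ)
    {x : VermaForm (dotWeight a σ)} : x ∈ singularSubmodule c σ (dotWeight a σ) ↔
      (x : vermaForm (dotWeight a σ)).1 ∈ singSpan (dotWeight a σ) (levi_lt hσ) := by
  constructor
  · intro hx
    induction hx using Submodule.span_induction with
    | mem x hx =>
      obtain ⟨α, hα, rfl⟩ := hx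
      have h1 := fCheckForm_smul (μ := dotWeight a σ) hσ ⟨α, hα⟩
      dsimp only at h1 ⊢
      rw [h1]
      exact Submodule.mem_iSup_of_mem (⟨α, hα⟩ : leviSimple c) (mem_fSpan _)
    | zero => exact zero_mem _
    | add x y _ _ hx hy => exact add_mem hx hy
    | smul T x _ hx =>
      exact uqForm_smul_mem_singSpan (levi_lt hσ) (uE_fCheckAux_levi ha hσ) T.2 hx
  · intro hx
    have key : ∀ y ∈ singSpan (dotWeight a σ) (levi_lt hσ),
        ∃ z ∈ singularSubmodule c σ (dotWeight a σ), (z : vermaForm (dotWeight a σ)).1 = y := by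
      intro y hy
      induction hy using Submodule.iSup_induction' with
      | mem α y hy =>
        induction hy using Submodule.span_induction with
        | mem y hy =>
          obtain ⟨L, rfl⟩ := hy
          let T : UqForm n := ⟨_, word_mem_uqForm L⟩
          refine ⟨T • (fCheckForm (σ (lo α.1)) (σ (hi α.1)) • vermaFormVec (dotWeight a σ)),
            Submodule.smul_mem _ _ (Submodule.subset_span ⟨α.1, α.2, rfl⟩), ?_⟩
          exact congrArg ((L.map uf).prod • ·) (fCheckForm_smul hσ α)
        | zero => exact ⟨0, zero_mem _, rfl⟩
        | add x y _ _ hx hy =>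
          obtain ⟨z, hz, rfl⟩ := hx
          obtain ⟨w, hw, rfl⟩ := hy
          exact ⟨z + w, add_mem hz hw, rfl⟩
        | smul r x _ hx =>
          obtain ⟨z, hz, rfl⟩ := hx
          exact ⟨algebraMap Rh (UqForm n) r • z, Submodule.smul_mem _ _ hz,
            algebraMap_smul (Uq n) r _⟩
      | zero => exact ⟨0, zero_mem _, rfl⟩
      | add x y _ _ hx hy =>
        obtain ⟨z, hz, rfl⟩ := hx
        obtain ⟨w, hw, rfl⟩ := hy
        exact ⟨z + w, add_mem hz hw, rfl⟩
    obtain ⟨z, hz, hzx⟩ := key _ hx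
    rwa [← (Subtype.ext hzx : z = x)]

/-- The module `M_{σ·λ}` as a quotient of the span of words. -/
theorem free_mForm (ha : a ∈ cReg c) (hσ : Admissible c σ) :
    Module.Free Rh (MForm c σ (Weight.ofPolar a)) := by
  let g : fSpan (vermaVec (dotWeight a σ)) →ₗ[Rh] MForm c σ (Weight.ofPolar a) :=
    { toFun := fun x => (singularSubmodule c σ (dotWeight a σ)).mkQ
        (⟨x.1, mem_vermaForm_iff.2 x.2⟩ : vermaForm (dotWeight a σ))
      map_add' := fun _ _ => rfl
      map_smul' := fun r x => congrArg (singularSubmodule c σ (dotWeight a σ)).mkQ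
        (Subtype.ext (algebraMap_smul (Uq n) r x.1).symm) }
  have hg : Function.Surjective g := by
    intro y
    obtain ⟨x, rfl⟩ := (singularSubmodule c σ (dotWeight a σ)).mkQ_surjective y
    exact ⟨⟨(x : vermaForm (dotWeight a σ)).1, mem_vermaForm_iff.1
      (x : vermaForm (dotWeight a σ)).2⟩, rfl⟩
  have hker : LinearMap.ker g = (singSpan (dotWeight a σ) (levi_lt hσ)).comap
      (fSpan (vermaVec (dotWeight a σ))).subtype := by
    ext x
    rw [LinearMap.mem_ker, Submodule.mem_comap]
    exact (Submodule.Quotient.mk_eq_zero _).trans (mem_singularSubmodule_iff ha hσ)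
  have hfree := free_quotient_levi ha hσ
  rw [← hker] at hfree
  exact Module.Free.of_equiv (g.quotKerEquivOfSurjective hg)

end Final

end QuantumGL

end

theorem mainTheorem4 (n : ℕ) (c : Composition n) (a : Fin n → ℂ) (ha : a ∈ QuantumGL.cReg c)
    (σ : Equiv.Perm (Fin n)) (hσ : QuantumGL.Admissible c σ) :
    (∀ α ∈ QuantumGL.leviSimple c,
      QuantumGL.IsSingular
        (QuantumGL.fCheck (σ (QuantumGL.lo α)) (σ (QuantumGL.hi α)) •
          QuantumGL.vermaVec ((QuantumGL.Weight.ofPolar a).dot σ))) ∧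
    Module.Free QuantumGL.Rh (QuantumGL.MForm c σ (QuantumGL.Weight.ofPolar a)) :=
  ⟨fun _ hα => QuantumGL.isSingular_fCheck ha hσ hα, QuantumGL.free_mForm ha hσ⟩
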